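/- Let $p$ be a prime, $k$ a field of characteristic $p$, $d\ge 1$ an integer, $q$ a power of $p$, and let $A$ be a local $k$-algebra with a fixed isomorphism of $k$-algebras $A\cong k[[X_1,\dots,X_d]]$. Let $\phi$ be the $k$-algebra endomorphism of $A$ with $\phi(X_j)=X_j^q$ for all $j$; it induces the identity on the residue field $k$ of $A$. Let $A[X]_\phi$ be the ring of twisted polynomials $\sum_i a_iX^i$ ($a_i\in A$), with multiplication determined by $Xa=\phi(a)X$. A left $A[X]_\phi$-module is called smooth if its underlying $A$-module is locally artinian, i.e. all its finitely generated $A$-submodules are artinian. For a left $A[X]_\phi$-module $M$, the group $\mathrm{Tor}_i^A(k,M)$ is a module over the (commutative) polynomial ring $k[X]$: if $P_\bullet\to M$ is a projective resolution over $A[X]_\phi$, it is also a projective resolution over $A$, and $X$ acts on $\mathrm{Tor}_i^A(k,M)=H_i(k\otimes_A P_\bullet)$ through $c\otimes x\mapsto c\otimes Xx$. Put $$h_i(M)=\dim_{k(X)}\bigl(k(X)\otimes_{k[X]}\mathrm{Tor}_i^A(k,M)\bigr),\qquad \chi(M)=\sum_{i\ge 0}(-1)^i h_i(M).$$ Let $M$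 be a smooth, finitely presented left $A[X]_\phi$-module. Then $\chi(M)$ is well defined, i.e. every $\mathrm{Tor}_i^A(k,M)$ is a finitely generated $k[X]$-module and $\mathrm{Tor}_i^A(k,M)=0$ for $i>d$; and $\chi(M)=0$. -/

import Mathlib

open CategoryTheory

universe u

/-! ### Twisted polynomial rings -/

/-- The ring `A[X]_φ` of twisted polynomials `∑ aᵢ Xⁱ` with coefficients on the left and
`X * a = φ a * X`.  This is Mathlib's `SkewPolynomial A`, for the action of `Multiplicative ℕ` on
`A` in which `n` acts as the `n`-th iterate of `φ`. -/
def TwistedPolynomial {A : Type u} [CommRing A] (_φ : A →+* A) : Type u := SkewPolynomial A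

namespace TwistedPolynomial

variable {A : Type u} [CommRing A] (φ : A →+* A)

/-- The action of `Multiplicative ℕ` on `A` through the powers of `φ`. -/
abbrev action : MulSemiringAction (Multiplicative ℕ) A :=
  MulSemiringAction.compHom A (powersHom (A →+* A) φ)

noncomputable instance : Ring (TwistedPolynomial φ) :=
  letI := action φ
  inferInstanceAs (Ring (SkewPolynomial A))

/-- The inclusion of the constants `A → A[X]_φ`. -/
noncomputable def C : A →+* TwistedPolynomial φ :=
  letI := action φ
  (SkewPolynomial.CRingHom : A →+* SkewPolynomial A)

/-- The variable of `A[X]_φ`. -/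
noncomputable def X : TwistedPolynomial φ := (SkewPolynomial.X : SkewPolynomial A)

theorem X_mul_C (a : A) : X φ * C φ a = C φ (φ a) * X φ := by
  let _ := action φ
  have h : (SkewPolynomial.φ : A →+* A) a = φ a := by
    change (powersHom (A →+* A) φ (Multiplicative.ofAdd 1)) a = φ a
    simp
  have key : (SkewPolynomial.X : SkewPolynomial A) * SkewPolynomial.C a
      = SkewPolynomial.C (φ a) * SkewPolynomial.X := by
    rw [SkewPolynomial.C_mul_X_eq_monomial, ← SkewPolynomial.monomial_zero_left,
      SkewPolynomial.X_mul_monomial, h]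
  exact key

/-- `A[X]_φ` is free as a left `A`-module. -/
theorem free : letI := Module.compHom (TwistedPolynomial φ) (C φ)
    Module.Free A (TwistedPolynomial φ) := by
  let _ := action φ
  let _ := Module.compHom (TwistedPolynomial φ) (C φ)
  have key (a : A) (p : SkewPolynomial A) : a • p = SkewPolynomial.C a * p := by
    induction p using SkewPolynomial.induction with
    | h0 => simp
    | ha n r q _ _ ih =>
      rw [smul_add, mul_add, ih, SkewPolynomial.smul_monomial,
        SkewPolynomial.C_mul_monomial, smul_eq_mul]
  let e : SkewPolynomial A ≃ₗ[A] TwistedPolynomial φ :=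
    { AddEquiv.refl (SkewPolynomial A) with
      map_smul' := fun a p => key a p }
  exact Module.Free.of_equiv e

/-- The functor sending an `A[X]_φ`-module to its underlying `A`-module. -/
noncomputable abbrev restrict : ModuleCat.{u} (TwistedPolynomial φ) ⥤ ModuleCat.{u} A :=
  ModuleCat.restrictScalars.{u} (C φ)

/-- An `A[X]_φ`-module is smooth if the underlying `A`-module is locally artinian. -/
def IsSmooth (M : Type u) [AddCommGroup M] [Module (TwistedPolynomial φ) M] : Prop :=
  ∀ N : Submodule A ((restrict φ).obj (ModuleCat.of (TwistedPolynomial φ) M)),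
    N.FG → IsArtinian A N

instance : (restrict φ).PreservesHomology := by
  have key : ∀ S : ShortComplex (ModuleCat.{u} (TwistedPolynomial φ)), S.Exact →
      (S.map (restrict φ)).Exact := fun S h => by
    rw [ShortComplex.ShortExact.moduleCat_exact_iff_function_exact] at h ⊢
    exact h
  exact ((Functor.exact_tfae (restrict φ)).out 1 2).mp key

instance : (restrict φ).PreservesProjectiveObjects where
  projective_obj {P} hP := by
    have : Module.Projective (TwistedPolynomial φ) P :=
      (IsProjective.iff_projective P).2 hP
    obtain ⟨s, hs⟩ := Module.projective_def'.1 this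
    let _ : Module A (TwistedPolynomial φ) := Module.compHom _ (C φ)
    have : Module.Free A (TwistedPolynomial φ) := free φ
    let P' := (restrict φ).obj P
    let i : P' →ₗ[A] (P →₀ TwistedPolynomial φ) :=
      { s.toAddMonoidHom with map_smul' := fun a x => s.map_smul (C φ a) x }
    let r : (P →₀ TwistedPolynomial φ) →ₗ[A] P' :=
      { (Finsupp.linearCombination (TwistedPolynomial φ) id).toAddMonoidHom with
        map_smul' := fun a x =>
          (Finsupp.linearCombination (TwistedPolynomial φ) (id : P → P)).map_smul (C φ a) x }
    have hri : r ∘ₗ i = LinearMap.id := LinearMap.ext fun x => LinearMap.congr_fun hs x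
    exact (IsProjective.iff_projective P').1 (Module.Projective.of_split i r hri)

end TwistedPolynomial

/-! ### `Tor_i^A(k, M)` as a `k[X]`-module, and the Euler-Poincaré characteristic -/

section Tor

open TwistedPolynomial IsLocalRing MonoidalCategory

variable {A : Type u} [CommRing A] [IsLocalRing A] (φ : A →+* A)

/-- The residue field of `A`, as an `A`-module. -/
noncomputable abbrev residueModule (A : Type u) [CommRing A] [IsLocalRing A] : ModuleCat.{u} A :=
  ModuleCat.of A (ResidueField A)

/-- The functor `M ↦ κ ⊗_A M` from `A[X]_φ`-modules to `A`-modules, `κ` being the residue field. -/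
noncomputable abbrev fiber : ModuleCat.{u} (TwistedPolynomial φ) ⥤ ModuleCat.{u} A :=
  restrict φ ⋙ (tensoringLeft (ModuleCat.{u} A)).obj (residueModule A)

variable {φ}

/-- The endomorphism `c ⊗ m ↦ c ⊗ X m` of `κ ⊗_A M`.  It is well defined and `A`-linear because
`X (a m) = φ(a) (X m)` and because `φ` induces the identity on the residue field. -/
noncomputable def fiberX (hφ : ∀ a, residue A (φ a) = residue A a)
    (M : ModuleCat.{u} (TwistedPolynomial φ)) :
    TensorProduct A (ResidueField A) ((restrict φ).obj M) →ₗ[A]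
      TensorProduct A (ResidueField A) ((restrict φ).obj M) :=
  TensorProduct.lift <| LinearMap.mk₂ A
    (fun (c : ResidueField A) (m : (restrict φ).obj M) =>
      TensorProduct.tmul A c ((X φ • (m : M) : M) : (restrict φ).obj M))
    (fun c c' m => TensorProduct.add_tmul _ _ _)
    (fun a c m => rfl)
    (fun c m m' => by
      rw [← TensorProduct.tmul_add]
      exact congrArg _ (smul_add (X φ) (m : M) (m' : M)))
    (fun a c m => by
      have h : (X φ • ((C φ a • (m : M)) : M) : M) = C φ (φ a) • (X φ • (m : M)) := by
        rw [← mul_smul, X_mul_C, mul_smul]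
      have h' : φ a • c = a • c := by
        rw [Algebra.smul_def, Algebra.smul_def]
        exact congrArg (· * c) (hφ a)
      calc
        _ = TensorProduct.tmul A c (φ a • ((X φ • (m : M) : M) : (restrict φ).obj M)) :=
          congrArg _ h
        _ = _ := by rw [← TensorProduct.smul_tmul, h', TensorProduct.smul_tmul'])

/-- Multiplication by `X` on `κ ⊗_A M`, as a natural transformation. -/
noncomputable def fiberXNat (hφ : ∀ a, residue A (φ a) = residue A a) : fiber φ ⟶ fiber φ where
  app M := ModuleCat.ofHom (fiberX hφ M)
  naturality M N f := by
    refine ModuleCat.hom_ext (TensorProduct.ext' fun c m => ?_)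
    exact congrArg (TensorProduct.tmul A c) (f.hom.map_smul (X φ) m).symm

/-- `Tor_i^A(κ, M)`, where `κ` is the residue field of `A` and `M` is an `A[X]_φ`-module. -/
noncomputable abbrev residueTor (i : ℕ) (M : ModuleCat.{u} (TwistedPolynomial φ)) :
    ModuleCat.{u} A :=
  ((Tor (ModuleCat.{u} A) i).obj (residueModule A)).obj ((restrict φ).obj M)

/-- A projective resolution `P` of `M` over `A[X]_φ` is also a projective resolution over `A`; hence
the `i`-th left derived functor of `κ ⊗_A -` on `A[X]_φ`-modules is `Tor_i^A(κ, -)`. -/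
noncomputable def derivedFiberIso (i : ℕ) (M : ModuleCat.{u} (TwistedPolynomial φ)) :
    ((fiber φ).leftDerived i).obj M ≅ residueTor i M :=
  (projectiveResolution M).isoLeftDerivedObj (fiber φ) i ≪≫
    (((restrict φ).mapProjectiveResolution (projectiveResolution M)).isoLeftDerivedObj
      ((tensoringLeft (ModuleCat.{u} A)).obj (residueModule A)) i).symm

/-- The action of `X` on `Tor_i^A(κ, M)`: the endomorphism induced on homology by
`c ⊗ p ↦ c ⊗ X p` on `κ ⊗_A P`, for a projective resolution `P` of `M` over `A[X]_φ`. -/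
noncomputable def torX (hφ : ∀ a, residue A (φ a) = residue A a) (i : ℕ)
    (M : ModuleCat.{u} (TwistedPolynomial φ)) : residueTor i M ⟶ residueTor i M :=
  (derivedFiberIso i M).inv ≫ (NatTrans.leftDerived (fiberXNat hφ) i).app M ≫
    (derivedFiberIso i M).hom

variable (k : Type u) [Field k] [Algebra k A]

/-- `Tor_i^A(κ, M)` as a `k[X]`-module, for a `k`-algebra `A` (in the application, `k` maps
isomorphically to the residue field `κ`): scalars act through `k → A`, and `X` acts by `torX`. -/
noncomputable def torModule (hφ : ∀ a, residue A (φ a) = residue A a) (i : ℕ)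
    (M : ModuleCat.{u} (TwistedPolynomial φ)) : ModuleCat.{u} (Polynomial k) :=
  ModuleCat.of (Polynomial k) <|
    Module.AEval' ((ModuleCat.restrictScalars (algebraMap k A)).map (torX hφ i M)).hom

/-- `h_i(M)`, the dimension over `k(X)` of `k(X) ⊗_{k[X]} Tor_i^A(κ, M)`. -/
noncomputable def torRank (hφ : ∀ a, residue A (φ a) = residue A a) (i : ℕ)
    (M : ModuleCat.{u} (TwistedPolynomial φ)) : ℕ :=
  Module.finrank (RatFunc k) (TensorProduct (Polynomial k) (RatFunc k) (torModule k hφ i M))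

/-- The Euler-Poincaré characteristic `χ(M) = ∑_{i ≥ 0} (-1)^i h_i(M)`. -/
noncomputable def eulerPoincare (hφ : ∀ a, residue A (φ a) = residue A a)
    (M : ModuleCat.{u} (TwistedPolynomial φ)) : ℤ :=
  ∑ᶠ i : ℕ, (-1) ^ i * (torRank k hφ i M : ℤ)

variable {k}

/-- Every `k`-algebra endomorphism of `A ≅ k[[X_1, …, X_d]]` induces the identity on the residue
field. -/
theorem residue_algHom_apply {d : ℕ} (e : A ≃ₐ[k] MvPowerSeries (Fin d) k) (φ : A →ₐ[k] A)
    (a : A) : residue A ((φ : A →+* A) a) = residue A a := by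
  let ε : A →+* k := (MvPowerSeries.constantCoeff).comp (e : A →+* MvPowerSeries (Fin d) k)
  have hεc (c : k) : ε (algebraMap k A c) = c := by
    change MvPowerSeries.constantCoeff (e (algebraMap k A c)) = c
    rw [AlgEquiv.commutes, MvPowerSeries.algebraMap_apply]
    simp
  have hunit (x : A) : IsUnit x ↔ ε x ≠ 0 := by
    rw [← isUnit_iff_ne_zero]
    change _ ↔ IsUnit (MvPowerSeries.constantCoeff (e x))
    rw [← MvPowerSeries.isUnit_iff_constantCoeff, MulEquiv.isUnit_map e]
  have hres (x : A) : residue A x = residue A (algebraMap k A (ε x)) := by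
    rw [← sub_eq_zero, ← map_sub, residue_eq_zero_iff, mem_maximalIdeal, mem_nonunits_iff, hunit,
      map_sub, hεc, sub_self]
    simp
  have hε : ε (φ a) = ε a := by
    have h : ¬ IsUnit (φ (a - algebraMap k A (ε (φ a)))) := by
      rw [hunit, map_sub, AlgHom.commutes, map_sub, hεc, sub_self]
      simp
    have h' : ¬ IsUnit (a - algebraMap k A (ε (φ a))) := fun hu => h (hu.map φ)
    rw [hunit, not_not, map_sub, hεc, sub_eq_zero] at h'
    exact h'.symm
  change residue A (φ a) = _
  rw [hres, hε, ← hres]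

end Tor

/-!
Write `R = A[X]_φ` and let `κ` be the residue field of `A ≅ k[[X_1, …, X_d]]`.  The vanishing of
`χ` is deduced from the case of the induced modules `R ⊗_A N` with `N` finite dimensional over `k`,
by means of a resolution of length one of `M` by such modules.

*Induced modules.*  Since `A` is free over itself through `X_j ↦ X_j^q` (`flat_frobTwist`), the ring
`R` is flat as a right `A`-module (`TwistedPolynomial.flat_right`), so that `N ↦ R ⊗_A N` is exact
and preserves projectives.  Moreover `κ ⊗_A (R ⊗_A N) = k[X] ⊗_k (κ ⊗_A N)` (`fiberInducedIso`),
hence `Tor_i^A(κ, R ⊗_A N) = k[X] ⊗_k Tor_i^A(κ, N)` as a `k[X]`-module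
(`nonempty_leftDerived_fiberPoly_induced`).  If `N` is finite dimensional, then so is
`Tor_i^A(κ, N)`, and `∑ (-1)^i dim_k Tor_i^A(κ, N) = 0` as `d ≥ 1`
(`altRank_leftDerived_residue`): killing the variables one at a time gives exact sequences
`0 → A/(X_1, …, X_{j-1}) → A/(X_1, …, X_{j-1}) → A/(X_1, …, X_j) → 0` in which the first two terms
have the same Euler characteristic.

*The resolution.*  A finitely presented `M` is presented by a finitely generated `A`-submodule `M₀`
together with the relations `X m = m'` which hold between elements of `M₀`
(`TwistedPolynomial.exists_fg_presenting`).  Let `N` be the `A`-module of those elements `z` of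
degree one of `R ⊗_A M₀` whose image `μ(z)` in `M` lies in `M₀`.  Then
`0 → R ⊗_A N → R ⊗_A M₀ → M → 0` is exact, the first map being `r ⊗ z ↦ r z - r ⊗ μ(z)`
(`TwistedPolynomial.exists_fg_shortExact_relationsComplex`); it is injective because `r ⊗ z ↦ r z`
is injective and raises the degree by one, whereas `r ⊗ z ↦ r ⊗ μ(z)` preserves it.  If `M` is
smooth, then `M₀` is artinian, hence killed by a power of the maximal ideal; so are the elements of
degree one of `R ⊗_A M₀`, and both `M₀` and `N` are finite dimensional over `k`.

*Conclusion.*  As `R` is an algebra over the field `k`, a short exact sequence of `R`-modules has a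
functorial short exact sequence of projective resolutions (`exists_shortExact_leftDerived`).  The
`k[X]`-modules `Tor_i^A(κ, M)` are the derived functors of `M ↦ κ ⊗_A M`, regarded as a functor to
`k[X]`-modules (`nonempty_torModule_equiv`), so the long exact sequence over the noetherian domain
`k[X]` gives finiteness and the additivity of the alternating sum of the ranks.
-/

/-! ### Long exact sequences and Euler characteristics -/

section Euler

variable {D : Type u} [CommRing D]

theorem ModuleCat.finite_of_exact [IsNoetherianRing D] {S : ShortComplex (ModuleCat.{u} D)}
    (hS : S.Exact) [Module.Finite D S.X₁] [Module.Finite D S.X₃] : Module.Finite D S.X₂ := by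
  have h : Function.Exact S.f.hom S.g.hom := fun x =>
    ((ShortComplex.ShortExact.moduleCat_exact_iff_function_exact S).1 hS x)
  have : IsNoetherian D S.X₂ := isNoetherian_of_range_eq_ker S.f.hom S.g.hom
    (LinearMap.exact_iff.1 h).symm
  infer_instance

theorem ModuleCat.finrank_of_exact [IsDomain D] {X Y Z : ModuleCat.{u} D} {f : X ⟶ Y} {g : Y ⟶ Z}
    {w : f ≫ g = 0} (hS : (ShortComplex.mk f g w).Exact) [Module.Finite D Y] :
    Module.finrank D Y =
      Module.finrank D (LinearMap.range f.hom) + Module.finrank D (LinearMap.range g.hom) := by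
  have h : Function.Exact f.hom g.hom := fun x =>
    (ShortComplex.ShortExact.moduleCat_exact_iff_function_exact (.mk f g w)).1 hS x
  rw [← LinearMap.exact_iff.1 h, add_comm, ← g.hom.quotKerEquivRange.finrank_eq]
  exact (Submodule.finrank_quotient_add_finrank _).symm

/-- The long exact homology sequence ends in degree zero. -/
theorem ShortComplex.ShortExact.epi_homologyMap_zero
    {S : ShortComplex (ChainComplex (ModuleCat.{u} D) ℕ)} (hS : S.ShortExact) :
    Epi (HomologicalComplex.homologyMap S.g 0) := by
  have := hS.epi_g
  have h0 : Epi (S.g.f 0) := inferInstance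
  have h1 : Epi (HomologicalComplex.opcyclesMap S.g 0) := by
    have : Epi (S.X₂.pOpcycles 0 ≫ HomologicalComplex.opcyclesMap S.g 0) := by
      rw [HomologicalComplex.p_opcyclesMap]
      infer_instance
    exact epi_of_epi (S.X₂.pOpcycles 0) _
  have h2 := HomologicalComplex.homologyι_naturality S.g 0
  have e2 : IsIso (S.X₂.homologyι 0) := inferInstanceAs (IsIso (ChainComplex.isoHomologyι₀ _).hom)
  have e3 : IsIso (S.X₃.homologyι 0) := inferInstanceAs (IsIso (ChainComplex.isoHomologyι₀ _).hom)
  have h3 : Epi (HomologicalComplex.homologyMap S.g 0 ≫ S.X₃.homologyι 0) := by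
    rw [h2]; infer_instance
  have : HomologicalComplex.homologyMap S.g 0 =
    (HomologicalComplex.homologyMap S.g 0 ≫ S.X₃.homologyι 0) ≫ inv (S.X₃.homologyι 0) := by
    rw [Category.assoc, IsIso.hom_inv_id, Category.comp_id]
  rw [this]; infer_instance

theorem ShortComplex.ShortExact.finite_homology [IsNoetherianRing D]
    {S : ShortComplex (ChainComplex (ModuleCat.{u} D) ℕ)} (hS : S.ShortExact)
    (h₁ : ∀ i, Module.Finite D (S.X₁.homology i)) (h₂ : ∀ i, Module.Finite D (S.X₂.homology i))
    (i : ℕ) : Module.Finite D (S.X₃.homology i) := by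
  cases i with
  | zero =>
    have := ShortComplex.ShortExact.epi_homologyMap_zero hS
    have := h₂ 0
    exact Module.Finite.of_surjective (HomologicalComplex.homologyMap S.g 0).hom
      ((ModuleCat.epi_iff_surjective _).1 ‹_›)
  | succ i =>
    have := h₂ (i + 1)
    have := h₁ i
    have h := hS.homology_exact₃ (i + 1) i rfl
    exact ModuleCat.finite_of_exact h

theorem ShortComplex.ShortExact.isZero_homology
    {S : ShortComplex (ChainComplex (ModuleCat.{u} D) ℕ)} (hS : S.ShortExact) {i : ℕ}
    (h₁ : Limits.IsZero (S.X₁.homology i)) (h₂ : Limits.IsZero (S.X₂.homology (i + 1))) :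
    Limits.IsZero (S.X₃.homology (i + 1)) :=
  (hS.homology_exact₃ (i + 1) i rfl).isZero_X₂ (h₂.eq_of_src _ _) (h₁.eq_of_tgt _ _)

/-- The Euler characteristic of the graded module `H`, truncated to the degrees `< n`. -/
noncomputable def altRank (D : Type u) [CommRing D] (H : ℕ → ModuleCat.{u} D) (n : ℕ) : ℤ :=
  ∑ i ∈ Finset.range n, (-1) ^ i * (Module.finrank D (H i) : ℤ)

theorem altRank_congr {D' : Type u} [CommRing D'] {H : ℕ → ModuleCat.{u} D}
    {H' : ℕ → ModuleCat.{u} D'}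
    (h : ∀ i, Module.finrank D (H i) = Module.finrank D' (H' i)) (n : ℕ) :
    altRank D H n = altRank D' H' n := by
  simp only [altRank, h]

/-- Additivity of the Euler characteristic.  The truncation does no harm: it only leaves the rank of
the connecting homomorphism out of `H_n(X₃)`, which vanishes. -/
theorem ShortComplex.ShortExact.altRank_homology [IsDomain D] [IsNoetherianRing D]
    {S : ShortComplex (ChainComplex (ModuleCat.{u} D) ℕ)} (hS : S.ShortExact)
    (h₁ : ∀ i, Module.Finite D (S.X₁.homology i)) (h₂ : ∀ i, Module.Finite D (S.X₂.homology i))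
    {n : ℕ} (hn : Limits.IsZero (S.X₃.homology n)) :
    altRank D (fun i => S.X₂.homology i) n =
      altRank D (fun i => S.X₁.homology i) n + altRank D (fun i => S.X₃.homology i) n := by
  have h₃ := ShortComplex.ShortExact.finite_homology hS h₁ h₂
  -- `a i` is the rank of the connecting homomorphism out of `H_i(X₃)`
  let a : ℕ → ℤ := fun i => match i with
    | 0 => 0
    | i + 1 => Module.finrank D (LinearMap.range (hS.δ (i + 1) i rfl).hom)
  have key (i : ℕ) : (Module.finrank D (S.X₂.homology i) : ℤ) =
      Module.finrank D (S.X₁.homology i) - a (i + 1) + (Module.finrank D (S.X₃.homology i) - a i)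
      := by
    have e2 := ModuleCat.finrank_of_exact (hS.homology_exact₂ i)
    have e1 := ModuleCat.finrank_of_exact (hS.homology_exact₁ (i + 1) i rfl)
    have e3 : (Module.finrank D (S.X₃.homology i) : ℤ) =
        Module.finrank D (LinearMap.range (HomologicalComplex.homologyMap S.g i).hom) + a i := by
      cases i with
      | zero =>
        have := ShortComplex.ShortExact.epi_homologyMap_zero hS
        rw [LinearMap.range_eq_top.2 ((ModuleCat.epi_iff_surjective _).1 this)]
        simp [a]
      | succ i =>
        rw [ModuleCat.finrank_of_exact (hS.homology_exact₃ (i + 1) i rfl), Nat.cast_add]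
    rw [e3]
    have e1' : (Module.finrank D (S.X₁.homology i) : ℤ) = a (i + 1) +
      Module.finrank D (LinearMap.range (HomologicalComplex.homologyMap S.f i).hom) := by
      rw [e1, Nat.cast_add]
    have e2' : (Module.finrank D (S.X₂.homology i) : ℤ) =
      Module.finrank D (LinearMap.range (HomologicalComplex.homologyMap S.f i).hom) +
      Module.finrank D (LinearMap.range (HomologicalComplex.homologyMap S.g i).hom) := by
      rw [e2, Nat.cast_add]
    rw [e1', e2']
    ring
  -- the partial alternating sums telescope
  have tele (m : ℕ) : altRank D (fun i => S.X₂.homology i) m -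
      altRank D (fun i => S.X₁.homology i) m - altRank D (fun i => S.X₃.homology i) m =
      (-1) ^ m * a m := by
    induction m with
    | zero => simp [altRank, a]
    | succ m ih =>
      simp only [altRank, Finset.sum_range_succ] at ih ⊢
      rw [key m, pow_succ]
      linear_combination ih
  have han : a n = 0 := by
    cases n with
    | zero => rfl
    | succ n =>
      have : Subsingleton (S.X₃.homology (n + 1)) := ModuleCat.subsingleton_of_isZero hn
      have h0 : LinearMap.range (hS.δ (n + 1) n rfl).hom = ⊥ := by
        rw [LinearMap.range_eq_bot]
        exact LinearMap.ext fun x => by rw [Subsingleton.elim x 0, map_zero, map_zero]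
      change (Module.finrank D (LinearMap.range (hS.δ (n + 1) n rfl).hom) : ℤ) = 0
      rw [h0, finrank_bot, Nat.cast_zero]
  have := tele n
  rw [han] at this
  linarith

end Euler

/-! ### Short exact sequences of functorial resolutions -/

section FunctorialResolution

open Limits

variable {R : Type u} [Ring R] (G : ModuleCat.{u} R ⥤ ModuleCat.{u} R) (π : G ⟶ 𝟭 (ModuleCat.{u} R))

/-- The kernel of a natural transformation `G ⟶ 𝟭`, as a functor. -/
noncomputable def syzygy : ModuleCat.{u} R ⥤ ModuleCat.{u} R where
  obj M := ModuleCat.of R (LinearMap.ker (π.app M).hom)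
  map {M N} f := ModuleCat.ofHom ((G.map f).hom.restrict (p := LinearMap.ker (π.app M).hom)
    (q := LinearMap.ker (π.app N).hom) (fun x hx => by
      have h := ConcreteCategory.congr_hom (π.naturality f) x
      have hx' : (π.app M).hom x = 0 := hx
      change (π.app N).hom ((G.map f).hom x) = f.hom ((π.app M).hom x) at h
      rw [LinearMap.mem_ker, h, hx', map_zero]))
  map_id M := by
    refine ModuleCat.hom_ext (LinearMap.ext fun x => Subtype.ext ?_)
    exact ConcreteCategory.congr_hom (G.map_id M) x.1
  map_comp f g := by
    refine ModuleCat.hom_ext (LinearMap.ext fun x => Subtype.ext ?_)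
    exact ConcreteCategory.congr_hom (G.map_comp f g) x.1

/-- The inclusion of the kernel. -/
noncomputable def syzygyι : syzygy G π ⟶ G where
  app M := ModuleCat.ofHom (LinearMap.ker (π.app M).hom).subtype
  naturality _ _ _ := rfl

/-- The iterated syzygies. -/
noncomputable def iterSyzygy : ℕ → (ModuleCat.{u} R ⥤ ModuleCat.{u} R)
  | 0 => 𝟭 _
  | n + 1 => iterSyzygy n ⋙ syzygy G π

/-- The differential `G(Ωⁿ⁺¹M) → Ωⁿ⁺¹M → G(ΩⁿM)`. -/
noncomputable def syzygyD (n : ℕ) : iterSyzygy G π (n + 1) ⋙ G ⟶ iterSyzygy G π n ⋙ G :=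
  Functor.whiskerLeft (iterSyzygy G π (n + 1)) π ≫
    (show iterSyzygy G π (n + 1) ⋙ 𝟭 _ ⟶ iterSyzygy G π n ⋙ G from
      Functor.whiskerLeft (iterSyzygy G π n) (syzygyι G π))

theorem syzygyD_exact (hπ : ∀ M, Epi (π.app M)) (M : ModuleCat.{u} R) (n : ℕ) :
    Function.Exact ((syzygyD G π (n + 1)).app M).hom ((syzygyD G π n).app M).hom := by
  intro x
  have hd (m : ℕ) (y : G.obj ((iterSyzygy G π (m + 1)).obj M)) :
      ((syzygyD G π m).app M).hom y =
        ((π.app ((iterSyzygy G π (m + 1)).obj M)).hom y :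
          LinearMap.ker (π.app ((iterSyzygy G π m).obj M)).hom).1 := rfl
  constructor
  · intro hx
    have hx' : x ∈ LinearMap.ker (π.app ((iterSyzygy G π (n + 1)).obj M)).hom := by
      rw [LinearMap.mem_ker]
      refine Subtype.ext ?_
      exact (hd n x).symm.trans hx
    obtain ⟨y, hy⟩ := (ModuleCat.epi_iff_surjective _).1
      (hπ ((iterSyzygy G π (n + 2)).obj M)) ⟨x, hx'⟩
    exact ⟨y, (hd (n + 1) y).trans (congrArg Subtype.val hy)⟩
  · rintro ⟨y, rfl⟩
    have h := ((π.app ((iterSyzygy G π (n + 2)).obj M)).hom y :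
          LinearMap.ker (π.app ((iterSyzygy G π (n + 1)).obj M)).hom).2
    exact congrArg (Subtype.val (p := fun z => z ∈
      LinearMap.ker (π.app ((iterSyzygy G π n).obj M)).hom)) h

theorem syzygyD_exact_zero (hπ : ∀ M, Epi (π.app M)) (M : ModuleCat.{u} R) :
    Function.Exact ((syzygyD G π 0).app M).hom (π.app M).hom := by
  intro x
  constructor
  · intro hx
    obtain ⟨y, hy⟩ := (ModuleCat.epi_iff_surjective _).1
      (hπ ((iterSyzygy G π 1).obj M)) ⟨x, hx⟩
    exact ⟨y, congrArg Subtype.val hy⟩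
  · rintro ⟨y, rfl⟩
    exact ((π.app ((iterSyzygy G π 1).obj M)).hom y : LinearMap.ker (π.app M).hom).2

/-- The functorial resolution `⋯ → G(Ω²M) → G(ΩM) → G(M)`, where `ΩM = ker (G M → M)`. -/
noncomputable def syzygyComplex (hπ : ∀ M, Epi (π.app M)) :
    ModuleCat.{u} R ⥤ ChainComplex (ModuleCat.{u} R) ℕ where
  obj M := ChainComplex.of (fun n => (iterSyzygy G π n ⋙ G).obj M) (fun n => (syzygyD G π n).app M)
    (fun n => ModuleCat.hom_ext (LinearMap.ext fun x =>
      (syzygyD_exact G π hπ M n).apply_apply_eq_zero x))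
  map f := ChainComplex.ofHom (fun n => (iterSyzygy G π n ⋙ G).map f) (fun n => by
    simp only [ChainComplex.of_d]
    exact (syzygyD G π n).naturality f)
  map_id M := by ext1 n; exact (iterSyzygy G π n ⋙ G).map_id M
  map_comp f g := by ext1 n; exact (iterSyzygy G π n ⋙ G).map_comp f g

theorem syzygyComplex_d (hπ : ∀ M, Epi (π.app M)) (M : ModuleCat.{u} R) (n : ℕ) :
    ((syzygyComplex G π hπ).obj M).d (n + 1) n = (syzygyD G π n).app M :=
  ChainComplex.of_d (fun n => (iterSyzygy G π n ⋙ G).obj M) (fun n => (syzygyD G π n).app M) n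

theorem syzygyComplex_d_comp (hπ : ∀ M, Epi (π.app M)) (M : ModuleCat.{u} R) :
    ((syzygyComplex G π hπ).obj M).d 1 0 ≫ π.app M = 0 :=
  (congrArg (· ≫ π.app M) (syzygyComplex_d G π hπ M 0)).trans <|
    ModuleCat.hom_ext (LinearMap.ext fun x =>
      (syzygyD_exact_zero G π hπ M).apply_apply_eq_zero x)

/-- If `G` has projective values and `G ⟶ 𝟭` is epi, then `syzygyComplex` is a resolution. -/
noncomputable def syzygyResolution (hπ : ∀ M, Epi (π.app M)) (hG : ∀ M, Projective (G.obj M))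
    (M : ModuleCat.{u} R) : ProjectiveResolution M where
  complex := (syzygyComplex G π hπ).obj M
  projective n := hG _
  π := (ChainComplex.toSingle₀Equiv _ _).symm ⟨π.app M, syzygyComplex_d_comp G π hπ M⟩
  quasiIso := ⟨fun n => by
    cases n
    · rw [ChainComplex.quasiIsoAt₀_iff, ShortComplex.quasiIso_iff_of_zeros']
      · have hw : (syzygyD G π 0).app M ≫ π.app M = 0 :=
          ModuleCat.hom_ext (LinearMap.ext fun x =>
            (syzygyD_exact_zero G π hπ M).apply_apply_eq_zero x)
        refine (ShortComplex.exact_and_epi_g_iff_of_iso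
          (S₂ := ShortComplex.mk ((syzygyD G π 0).app M) (π.app M) hw) ?_).2
          ⟨(ShortComplex.ShortExact.moduleCat_exact_iff_function_exact _).2
            (syzygyD_exact_zero G π hπ M), hπ M⟩
        refine ShortComplex.isoMk (Iso.refl _) (Iso.refl _) (Iso.refl _) ?_ ?_
        · refine (Category.id_comp _).trans (Eq.trans ?_ (Category.comp_id _).symm)
          exact (syzygyComplex_d G π hπ M 0).symm
        · refine (Category.id_comp _).trans (Eq.trans ?_ (Category.comp_id _).symm)
          exact (ChainComplex.toSingle₀Equiv_symm_apply_f_zero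
            (C := (syzygyComplex G π hπ).obj M) (X := M) (π.app M)
            (syzygyComplex_d_comp G π hπ M)).symm
      all_goals rfl
    · rw [quasiIsoAt_iff_exactAt']
      · rename_i n
        rw [HomologicalComplex.exactAt_iff' _ (n + 1 + 1) (n + 1) n (by simp) (by simp)]
        rw [ShortComplex.ShortExact.moduleCat_exact_iff_function_exact]
        change Function.Exact (((syzygyComplex G π hπ).obj M).d (n + 1 + 1) (n + 1)).hom
          (((syzygyComplex G π hπ).obj M).d (n + 1) n).hom
        rw [syzygyComplex_d, syzygyComplex_d]
        exact syzygyD_exact G π hπ M n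
      · apply ChainComplex.exactAt_succ_single_obj⟩

variable {G π}

/-- If `G` is exact, then so is the functor of syzygies, by the snake lemma. -/
theorem syzygy_shortExact [G.PreservesZeroMorphisms] (hπ : ∀ M, Epi (π.app M))
    (hG : ∀ S : ShortComplex (ModuleCat.{u} R), S.ShortExact → (S.map G).ShortExact)
    {S : ShortComplex (ModuleCat.{u} R)} (hS : S.ShortExact) {w} :
    (ShortComplex.mk ((syzygy G π).map S.f) ((syzygy G π).map S.g) w).ShortExact := by
  have hGS := hG S hS
  have hex := (ShortComplex.ShortExact.moduleCat_exact_iff_function_exact _).1 hS.exact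
  have hGex := (ShortComplex.ShortExact.moduleCat_exact_iff_function_exact _).1 hGS.exact
  have nat {M N : ModuleCat.{u} R} (f : M ⟶ N) (x : G.obj M) :
      π.app N (G.map f x) = f (π.app M x) := ConcreteCategory.congr_hom (π.naturality f) x
  refine ShortComplex.ShortExact.mk' ?_ ?_ ?_
  · rw [ShortComplex.ShortExact.moduleCat_exact_iff_function_exact]
    intro x
    constructor
    · intro hx
      obtain ⟨y, hy'⟩ : ∃ y : G.obj S.X₁, G.map S.f y = x.1 :=
        (hGex x.1).1 (congrArg Subtype.val hx)
      refine ⟨⟨y, ?_⟩, Subtype.ext hy'⟩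
      apply hS.moduleCat_injective_f
      have h := nat S.f y
      have hx2 : π.app S.X₂ x.1 = 0 := x.2
      rw [hy', hx2] at h
      exact h.symm.trans (map_zero S.f.hom).symm
    · rintro ⟨y, rfl⟩
      exact Subtype.ext ((hGex _).2 ⟨y.1, rfl⟩)
  · rw [ModuleCat.mono_iff_injective]
    intro x y hxy
    exact Subtype.ext (hGS.moduleCat_injective_f (congrArg Subtype.val hxy))
  · rw [ModuleCat.epi_iff_surjective]
    intro z
    obtain ⟨y, hy'⟩ : ∃ y : G.obj S.X₂, G.map S.g y = z.1 := hGS.moduleCat_surjective_g z.1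
    have hz : π.app S.X₃ z.1 = 0 := z.2
    have h0 : S.g (π.app S.X₂ y) = 0 := by rw [← nat, hy', hz]
    obtain ⟨m, hm'⟩ := (hex _).1 h0
    obtain ⟨t, ht'⟩ : ∃ t : G.obj S.X₁, π.app S.X₁ t = m :=
      (ModuleCat.epi_iff_surjective _).1 (hπ S.X₁) m
    refine ⟨⟨y - G.map S.f t, ?_⟩, Subtype.ext ?_⟩
    · change π.app S.X₂ (y - G.map S.f t) = 0
      rw [map_sub, nat, ht', hm', sub_self]
    · change G.map S.g (y - G.map S.f t) = z.1
      have : G.map S.g (G.map S.f t) = 0 := (hGex _).2 ⟨t, rfl⟩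
      rw [map_sub, hy', this, sub_zero]

instance [G.PreservesZeroMorphisms] : (syzygy G π).PreservesZeroMorphisms where
  map_zero M N := by
    refine ModuleCat.hom_ext (LinearMap.ext fun x => Subtype.ext ?_)
    exact ConcreteCategory.congr_hom (G.map_zero M N) x.1

instance [G.PreservesZeroMorphisms] (n : ℕ) : (iterSyzygy G π n).PreservesZeroMorphisms := by
  induction n with
  | zero => exact inferInstanceAs (𝟭 _ : ModuleCat.{u} R ⥤ _).PreservesZeroMorphisms
  | succ n ih => exact inferInstanceAs (iterSyzygy G π n ⋙ syzygy G π).PreservesZeroMorphisms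

theorem iterSyzygy_shortExact [G.PreservesZeroMorphisms] (hπ : ∀ M, Epi (π.app M))
    (hG : ∀ S : ShortComplex (ModuleCat.{u} R), S.ShortExact → (S.map G).ShortExact)
    {S : ShortComplex (ModuleCat.{u} R)} (hS : S.ShortExact) (n : ℕ) :
    (S.map (iterSyzygy G π n)).ShortExact := by
  induction n with
  | zero => exact hS
  | succ n ih => exact syzygy_shortExact hπ hG ih

/-- A functorial projective resolution with exact terms turns a short exact sequence of modules into
a short exact sequence of resolutions.  It splits in each degree, so any additive functor preserves
its exactness. -/
theorem exists_shortExact_map_resolution [G.PreservesZeroMorphisms] (hπ : ∀ M, Epi (π.app M))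
    (hP : ∀ M, Projective (G.obj M))
    (hG : ∀ S : ShortComplex (ModuleCat.{u} R), S.ShortExact → (S.map G).ShortExact)
    {S : ShortComplex (ModuleCat.{u} R)} (hS : S.ShortExact) {D : Type u} [CommRing D]
    (F : ModuleCat.{u} R ⥤ ModuleCat.{u} D) [F.Additive] :
    ∃ T : ShortComplex (ChainComplex (ModuleCat.{u} D) ℕ), T.ShortExact ∧
      (∀ i, Nonempty (T.X₁.homology i ≅ (F.leftDerived i).obj S.X₁)) ∧
      (∀ i, Nonempty (T.X₂.homology i ≅ (F.leftDerived i).obj S.X₂)) ∧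
      (∀ i, Nonempty (T.X₃.homology i ≅ (F.leftDerived i).obj S.X₃)) := by
  have w : (syzygyComplex G π hπ).map S.f ≫ (syzygyComplex G π hπ).map S.g = 0 := by
    rw [← Functor.map_comp, S.zero]
    ext1 n
    exact (iterSyzygy G π n ⋙ G).map_zero _ _
  refine ⟨(ShortComplex.mk _ _ w).map (F.mapHomologicalComplex _), ?_, ?_, ?_, ?_⟩
  · refine HomologicalComplex.shortExact_of_degreewise_shortExact _ fun n => ?_
    have h := hG _ (iterSyzygy_shortExact hπ hG hS n)
    have : Projective ((S.map (iterSyzygy G π n)).map G).X₃ := hP _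
    exact (h.splittingOfProjective.map F).shortExact
  · exact fun i => ⟨((syzygyResolution G π hπ hP S.X₁).isoLeftDerivedObj F i).symm⟩
  · exact fun i => ⟨((syzygyResolution G π hπ hP S.X₂).isoLeftDerivedObj F i).symm⟩
  · exact fun i => ⟨((syzygyResolution G π hπ hP S.X₃).isoLeftDerivedObj F i).symm⟩

end FunctorialResolution

/-! ### The functorial free cover over an algebra over a field -/

section FreeCover

open scoped TensorProduct ModuleCat

variable (k : Type u) [Field k] (R : Type u) [Ring R] [Algebra k R]

/-- The functor `M ↦ R ⊗_k M` on modules over a `k`-algebra `R`. -/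
noncomputable def freeCover : ModuleCat.{u} R ⥤ ModuleCat.{u} R where
  obj M := ModuleCat.of R (R ⊗[k] M)
  map f := ModuleCat.ofHom ((f.hom.restrictScalars k).baseChange R)
  map_id M := by
    refine ModuleCat.hom_ext (LinearMap.restrictScalars_injective k ?_)
    exact TensorProduct.ext' fun r m => rfl
  map_comp f g := by
    refine ModuleCat.hom_ext (LinearMap.restrictScalars_injective k ?_)
    exact TensorProduct.ext' fun r m => rfl

/-- The action map `R ⊗_k M → M`. -/
noncomputable def freeCoverπ : freeCover k R ⟶ 𝟭 (ModuleCat.{u} R) where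
  app M := ModuleCat.ofHom (TensorProduct.AlgebraTensorModule.lift
    (LinearMap.toSpanSingleton R (M →ₗ[k] M) LinearMap.id))
  naturality M N f := by
    refine ModuleCat.hom_ext (LinearMap.ext fun z => ?_)
    induction z using TensorProduct.induction_on with
    | zero => exact (map_zero _).trans (map_zero _).symm
    | tmul r m => exact (f.hom.map_smul r m).symm
    | add x y hx hy => exact (map_add _ x y).trans ((congrArg₂ (· + ·) hx hy).trans
        (map_add _ x y).symm)

instance : (freeCover k R).PreservesZeroMorphisms where
  map_zero M N := by
    refine ModuleCat.hom_ext (LinearMap.ext fun z => ?_)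
    induction z using TensorProduct.induction_on with
    | zero => exact map_zero _
    | tmul r m => exact TensorProduct.tmul_zero (R := k) N r
    | add x y hx hy => exact (map_add _ x y).trans ((congrArg₂ (· + ·) hx hy).trans (add_zero _))

theorem epi_freeCoverπ (M : ModuleCat.{u} R) : Epi ((freeCoverπ k R).app M) := by
  rw [ModuleCat.epi_iff_surjective]
  intro m
  exact ⟨(1 : R) ⊗ₜ[k] m, one_smul R m⟩

theorem projective_freeCover (M : ModuleCat.{u} R) : Projective ((freeCover k R).obj M) := by
  have : Module.Projective R (R ⊗[k] M) :=
    Module.Projective.of_basis ((Module.Basis.ofVectorSpace k M).baseChange R)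
  exact (IsProjective.iff_projective (R ⊗[k] M)).1 this

theorem freeCover_shortExact (S : ShortComplex (ModuleCat.{u} R)) (hS : S.ShortExact) :
    (S.map (freeCover k R)).ShortExact := by
  have hex := (ShortComplex.ShortExact.moduleCat_exact_iff_function_exact _).1 hS.exact
  refine ShortComplex.ShortExact.mk' ?_ ?_ ?_
  · rw [ShortComplex.ShortExact.moduleCat_exact_iff_function_exact]
    exact lTensor_exact (f := S.f.hom.restrictScalars k) (g := S.g.hom.restrictScalars k) R hex
      hS.moduleCat_surjective_g
  · rw [ModuleCat.mono_iff_injective]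
    exact Module.Flat.lTensor_preserves_injective_linearMap (M := R) (S.f.hom.restrictScalars k)
      hS.moduleCat_injective_f
  · rw [ModuleCat.epi_iff_surjective]
    exact LinearMap.lTensor_surjective R (g := S.g.hom.restrictScalars k)
      hS.moduleCat_surjective_g

/-- A short exact sequence of modules over a `k`-algebra has a short exact sequence of projective
resolutions, which stays exact under any additive functor. -/
theorem exists_shortExact_leftDerived {R : Type u} [Ring R] [Algebra k R]
    {S : ShortComplex (ModuleCat.{u} R)} (hS : S.ShortExact) {D : Type u} [CommRing D]
    (F : ModuleCat.{u} R ⥤ ModuleCat.{u} D) [F.Additive] :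
    ∃ T : ShortComplex (ChainComplex (ModuleCat.{u} D) ℕ), T.ShortExact ∧
      (∀ i, Nonempty (T.X₁.homology i ≅ (F.leftDerived i).obj S.X₁)) ∧
      (∀ i, Nonempty (T.X₂.homology i ≅ (F.leftDerived i).obj S.X₂)) ∧
      (∀ i, Nonempty (T.X₃.homology i ≅ (F.leftDerived i).obj S.X₃)) :=
  exists_shortExact_map_resolution (epi_freeCoverπ k R) (projective_freeCover k R)
    (freeCover_shortExact k R) hS F

end FreeCover

/-! ### The ideals generated by the first variables of a power series ring -/

section PowerSeries

open IsLocalRing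

variable {k : Type u} [Field k] {d : ℕ} {A : Type u} [CommRing A] [Algebra k A]
  (e : A ≃ₐ[k] MvPowerSeries (Fin d) k)

/-- The ideal `(X_0, …, X_{j-1})` of `A ≅ k[[X_0, …, X_{d-1}]]`, described as the set of power
series without monomials in the variables `X_i`, `i ≥ j`, alone. -/
def coordIdeal (j : ℕ) : Ideal A where
  carrier := {f | ∀ n : Fin d →₀ ℕ, (∀ i : Fin d, i.val < j → n i = 0) →
    MvPowerSeries.coeff n (e f) = 0}
  add_mem' {f g} hf hg n hn := by rw [map_add, map_add, hf n hn, hg n hn, add_zero]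
  zero_mem' n _ := by rw [map_zero, map_zero]
  smul_mem' c f hf n hn := by
    classical
    rw [smul_eq_mul, map_mul, MvPowerSeries.coeff_mul]
    refine Finset.sum_eq_zero fun p hp => ?_
    rw [hf p.2, mul_zero]
    intro i hi
    have h := hn i hi
    rw [← Finset.HasAntidiagonal.mem_antidiagonal.1 hp] at h
    simp only [Finsupp.add_apply] at h
    omega

theorem mem_coordIdeal {j : ℕ} {f : A} : f ∈ coordIdeal e j ↔
    ∀ n : Fin d →₀ ℕ, (∀ i : Fin d, i.val < j → n i = 0) → MvPowerSeries.coeff n (e f) = 0 :=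
  Iff.rfl

theorem coordIdeal_zero : coordIdeal e 0 = ⊥ := by
  refine (Submodule.eq_bot_iff _).2 fun f hf => ?_
  apply e.injective
  rw [map_zero]
  exact MvPowerSeries.ext fun n => by
    rw [hf n (fun i hi => absurd hi (Nat.not_lt_zero _)), map_zero]

theorem mem_coordIdeal_d {f : A} :
    f ∈ coordIdeal e d ↔ MvPowerSeries.constantCoeff (e f) = 0 := by
  rw [mem_coordIdeal]
  constructor
  · intro h
    exact h 0 (fun _ _ => rfl)
  · intro h n hn
    have : n = 0 := Finsupp.ext fun i => hn i i.2
    rw [this]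
    exact h

theorem coordIdeal_d [IsLocalRing A] : coordIdeal e d = maximalIdeal A := by
  ext f
  rw [mem_coordIdeal_d, mem_maximalIdeal, mem_nonunits_iff, ← MulEquiv.isUnit_map e,
    MvPowerSeries.isUnit_iff_constantCoeff, isUnit_iff_ne_zero, not_not]

theorem coeff_add_single_X_mul (j : Fin d) (f : A) (n : Fin d →₀ ℕ) :
    MvPowerSeries.coeff (n + Finsupp.single j 1) (e (e.symm (MvPowerSeries.X j) * f)) =
      MvPowerSeries.coeff n (e f) := by
  rw [map_mul, AlgEquiv.apply_symm_apply, mul_comm]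
  have := MvPowerSeries.coeff_add_mul_monomial n (Finsupp.single j 1) (e f) (1 : k)
  rwa [mul_one] at this

theorem coeff_X_mul_of_eq_zero (j : Fin d) (f : A) {n : Fin d →₀ ℕ} (hn : n j = 0) :
    MvPowerSeries.coeff n (e (e.symm (MvPowerSeries.X j) * f)) = 0 := by
  classical
  rw [map_mul, AlgEquiv.apply_symm_apply]
  have := MvPowerSeries.coeff_monomial_mul n (Finsupp.single j 1) (e f) (1 : k)
  rw [if_neg] at this
  · exact this
  · intro h
    have := h j
    simp [hn] at this

theorem mem_coordIdeal_of_X_mul_mem (j : Fin d) {f : A}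
    (hf : e.symm (MvPowerSeries.X j) * f ∈ coordIdeal e j) : f ∈ coordIdeal e j := by
  intro n hn
  rw [← coeff_add_single_X_mul e j]
  refine hf _ fun i hi => ?_
  have : j ≠ i := by rintro rfl; exact lt_irrefl _ hi
  simp [hn i hi, this]

theorem coordIdeal_mono {i j : ℕ} (h : i ≤ j) : coordIdeal e i ≤ coordIdeal e j :=
  fun _ hf n hn => hf n fun l hl => hn l (hl.trans_le h)

theorem X_mem_coordIdeal (j : Fin d) :
    e.symm (MvPowerSeries.X j) ∈ coordIdeal e (j + 1) := by
  intro n hn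
  have := coeff_X_mul_of_eq_zero e j 1 (hn j (Nat.lt_succ_self _))
  rwa [mul_one] at this

theorem exists_of_mem_coordIdeal_succ (j : Fin d) {f : A} (hf : f ∈ coordIdeal e (j + 1)) :
    ∃ g, f - e.symm (MvPowerSeries.X j) * g ∈ coordIdeal e j := by
  -- `g` collects the monomials of `f` divisible by `X_j`, divided by `X_j`
  let g : MvPowerSeries (Fin d) k := fun n => MvPowerSeries.coeff (n + Finsupp.single j 1) (e f)
  have hg (n) : MvPowerSeries.coeff n g = MvPowerSeries.coeff (n + Finsupp.single j 1) (e f) := rfl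
  refine ⟨e.symm g, fun n hn => ?_⟩
  rw [map_sub, map_sub]
  by_cases hj : n j = 0
  · rw [coeff_X_mul_of_eq_zero e j _ hj, sub_zero]
    refine hf n fun i hi => ?_
    rcases Nat.lt_succ_iff_lt_or_eq.1 hi with h | h
    · exact hn i h
    · rwa [Fin.ext h]
  · obtain ⟨m, rfl⟩ : ∃ m, n = m + Finsupp.single j 1 := by
      refine ⟨n - Finsupp.single j 1, (tsub_add_cancel_of_le ?_).symm⟩
      rw [Finsupp.single_le_iff]
      omega
    rw [coeff_add_single_X_mul, AlgEquiv.apply_symm_apply, hg, sub_self]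

theorem coordIdeal_succ (j : Fin d) :
    coordIdeal e (j + 1) = coordIdeal e j ⊔ Ideal.span {e.symm (MvPowerSeries.X j)} := by
  apply le_antisymm
  · intro f hf
    obtain ⟨g, hg⟩ := exists_of_mem_coordIdeal_succ e j hf
    rw [← sub_add_cancel f (e.symm (MvPowerSeries.X j) * g)]
    exact Submodule.add_mem_sup hg (Ideal.mul_mem_right _ _ (Ideal.mem_span_singleton_self _))
  · refine sup_le (coordIdeal_mono e (Nat.le_succ _)) ?_
    rw [Ideal.span_singleton_le_iff_mem]
    exact X_mem_coordIdeal e j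

theorem coordIdeal_eq_span {j : ℕ} (hj : j ≤ d) :
    coordIdeal e j = Ideal.span ((fun i => e.symm (MvPowerSeries.X i)) '' {i : Fin d | i.val < j})
    := by
  induction j with
  | zero => simp [coordIdeal_zero]
  | succ j ih =>
    have : {i : Fin d | i.val < j + 1} = {i : Fin d | i.val < j} ∪ {⟨j, hj⟩} := by
      ext i
      simp only [Set.mem_ofPred_eq, Set.mem_union, Set.mem_singleton_iff, Fin.ext_iff]
      omega
    rw [this, Set.image_union, Ideal.span_union, ← ih (Nat.le_of_succ_le hj), Set.image_singleton]
    exact coordIdeal_succ e ⟨j, hj⟩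

theorem coordIdeal_d_eq_span :
    coordIdeal e d = Ideal.span (Set.range fun i => e.symm (MvPowerSeries.X i)) := by
  rw [coordIdeal_eq_span e le_rfl, ← Set.image_univ]
  congr 2
  ext i
  simp

theorem maximalIdeal_eq_span [IsLocalRing A] :
    maximalIdeal A = Ideal.span (Set.range fun i => e.symm (MvPowerSeries.X i)) := by
  rw [← coordIdeal_d e, coordIdeal_d_eq_span]

theorem maximalIdeal_fg [IsLocalRing A] (e : A ≃ₐ[k] MvPowerSeries (Fin d) k) :
    (maximalIdeal A).FG := by
  rw [maximalIdeal_eq_span e]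
  exact Submodule.fg_span (Set.finite_range _)

theorem exists_sub_algebraMap_mem [IsLocalRing A] (e : A ≃ₐ[k] MvPowerSeries (Fin d) k) (a : A) :
    ∃ c : k, a - algebraMap k A c ∈ maximalIdeal A := by
  refine ⟨MvPowerSeries.constantCoeff (e a), ?_⟩
  rw [← coordIdeal_d e, mem_coordIdeal_d, map_sub, AlgEquiv.commutes, map_sub,
    MvPowerSeries.algebraMap_apply]
  simp

end PowerSeries

/-! ### Tensor products with values in vector spaces -/

section FirstVariable

open IsLocalRing MonoidalCategory

variable (k : Type u) [Field k] {A : Type u} [CommRing A] [Algebra k A]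

/-- The functor `N ↦ L ⊗_A N`, with values in vector spaces over `k`. -/
noncomputable abbrev tensorFunctor (L : ModuleCat.{u} A) : ModuleCat.{u} A ⥤ ModuleCat.{u} k :=
  (tensoringLeft (ModuleCat.{u} A)).obj L ⋙ ModuleCat.restrictScalars (algebraMap k A)

/-- The natural transformation `L ⊗_A - ⟶ L' ⊗_A -` induced by `L ⟶ L'`. -/
noncomputable abbrev tensorFunctorMap {L L' : ModuleCat.{u} A} (f : L ⟶ L') :
    tensorFunctor k L ⟶ tensorFunctor k L' :=
  Functor.whiskerRight ((tensoringLeft (ModuleCat.{u} A)).map f)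
    (ModuleCat.restrictScalars (algebraMap k A))

theorem tensorFunctorMap_shortExact {S : ShortComplex (ModuleCat.{u} A)} (hS : S.ShortExact)
    (P : ModuleCat.{u} A) [Module.Flat A P] {w} :
    (ShortComplex.mk ((tensorFunctorMap k S.f).app P) ((tensorFunctorMap k S.g).app P)
      w).ShortExact := by
  have hex := (ShortComplex.ShortExact.moduleCat_exact_iff_function_exact _).1 hS.exact
  refine ShortComplex.ShortExact.mk' ?_ ?_ ?_
  · rw [ShortComplex.ShortExact.moduleCat_exact_iff_function_exact]
    exact rTensor_exact (f := S.f.hom) (g := S.g.hom) P hex hS.moduleCat_surjective_g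
  · rw [ModuleCat.mono_iff_injective]
    exact Module.Flat.rTensor_preserves_injective_linearMap (M := P) S.f.hom
      hS.moduleCat_injective_f
  · rw [ModuleCat.epi_iff_surjective]
    exact LinearMap.rTensor_surjective P (g := S.g.hom) hS.moduleCat_surjective_g

/-- The long exact sequence of `Tor_i^A(-, N)` in the first variable comes from a short exact
sequence of complexes, obtained by tensoring with a projective resolution of `N`. -/
theorem exists_shortExact_tensorFunctor {S : ShortComplex (ModuleCat.{u} A)} (hS : S.ShortExact)
    (N : ModuleCat.{u} A) :
    ∃ T : ShortComplex (ChainComplex (ModuleCat.{u} k) ℕ), T.ShortExact ∧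
      (∀ i, Nonempty (T.X₁.homology i ≅ ((tensorFunctor k S.X₁).leftDerived i).obj N)) ∧
      (∀ i, Nonempty (T.X₂.homology i ≅ ((tensorFunctor k S.X₂).leftDerived i).obj N)) ∧
      (∀ i, Nonempty (T.X₃.homology i ≅ ((tensorFunctor k S.X₃).leftDerived i).obj N)) := by
  let P := projectiveResolution N
  have w : (NatTrans.mapHomologicalComplex (tensorFunctorMap k S.f) _).app P.complex ≫
      (NatTrans.mapHomologicalComplex (tensorFunctorMap k S.g) _).app P.complex = 0 := by
    ext1 n
    change (tensorFunctorMap k S.f).app (P.complex.X n) ≫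
      (tensorFunctorMap k S.g).app (P.complex.X n) = 0
    rw [← NatTrans.comp_app, ← Functor.whiskerRight_comp, ← Functor.map_comp, S.zero]
    rw [Functor.map_zero]
    rw [Functor.whiskerRight_app, Limits.zero_app, Functor.map_zero]
  refine ⟨ShortComplex.mk _ _ w, ?_, fun i => ⟨(P.isoLeftDerivedObj _ i).symm⟩,
    fun i => ⟨(P.isoLeftDerivedObj _ i).symm⟩, fun i => ⟨(P.isoLeftDerivedObj _ i).symm⟩⟩
  refine HomologicalComplex.shortExact_of_degreewise_shortExact _ fun n => ?_
  have : Module.Projective A (P.complex.X n) := (IsProjective.iff_projective _).2 (P.projective n)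
  exact tensorFunctorMap_shortExact k hS (P.complex.X n)

end FirstVariable

/-! ### Tor of the residue field and modules of finite dimension -/

section LeftDerivedIso

variable {C : Type*} [Category* C] [Abelian C] [EnoughProjectives C]
  {B : Type*} [Category* B] [Abelian B]

/-- Isomorphic functors have isomorphic left derived functors. -/
noncomputable def leftDerivedIsoOfIso {F G : C ⥤ B} [F.Additive] [G.Additive] (α : F ≅ G) (i : ℕ)
    (M : C) : (F.leftDerived i).obj M ≅ (G.leftDerived i).obj M where
  hom := (NatTrans.leftDerived α.hom i).app M
  inv := (NatTrans.leftDerived α.inv i).app M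
  hom_inv_id := by
    rw [← NatTrans.comp_app, ← NatTrans.leftDerived_comp, Iso.hom_inv_id,
      NatTrans.leftDerived_id, NatTrans.id_app]
  inv_hom_id := by
    rw [← NatTrans.comp_app, ← NatTrans.leftDerived_comp, Iso.inv_hom_id,
      NatTrans.leftDerived_id, NatTrans.id_app]

end LeftDerivedIso

section ExactFunctor

theorem ModuleCat.finite_of_iso {D : Type u} [Ring D] {X Y : ModuleCat.{u} D} (i : X ≅ Y)
    (h : Module.Finite D X) : Module.Finite D Y :=
  Module.Finite.equiv i.toLinearEquiv

variable {R : Type u} [Ring R] {D : Type u} [Ring D]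

theorem isZero_leftDerived_succ_of_exact (F : ModuleCat.{u} R ⥤ ModuleCat.{u} D) [F.Additive]
    [F.PreservesHomology] (N : ModuleCat.{u} R) (i : ℕ) :
    Limits.IsZero ((F.leftDerived (i + 1)).obj N) := by
  let P := projectiveResolution N
  refine Limits.IsZero.of_iso ?_ (P.isoLeftDerivedObj F (i + 1))
  refine Limits.IsZero.of_iso (F.map_isZero ?_) ((P.complex.sc (i + 1)).mapHomologyIso F)
  exact (P.complex.exactAt_iff_isZero_homology (i + 1)).1 (P.complex_exactAt_succ i)

theorem nonempty_leftDerived_zero_iso_of_exact (F : ModuleCat.{u} R ⥤ ModuleCat.{u} D) [F.Additive]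
    [F.PreservesHomology] (N : ModuleCat.{u} R) :
    Nonempty ((F.leftDerived 0).obj N ≅ F.obj N) := by
  have h : F.PreservesHomology ↔
      Limits.PreservesFiniteLimits F ∧ Limits.PreservesFiniteColimits F :=
    (Functor.exact_tfae F).out 2 3
  have := (h.1 inferInstance).2
  exact ⟨F.leftDerivedZeroIsoSelf.app N⟩

end ExactFunctor

section Coord

open IsLocalRing MonoidalCategory

variable {k : Type u} [Field k] {d : ℕ} {A : Type u} [CommRing A] [Algebra k A]
  (e : A ≃ₐ[k] MvPowerSeries (Fin d) k)

/-- The sequence `0 → A/(X_0,…,X_{j-1}) → A/(X_0,…,X_{j-1}) → A/(X_0,…,X_j) → 0`, whose first map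
is multiplication by `X_j`. -/
noncomputable def coordSequence (j : Fin d) : ShortComplex (ModuleCat.{u} A) where
  X₁ := ModuleCat.of A (A ⧸ coordIdeal e j)
  X₂ := ModuleCat.of A (A ⧸ coordIdeal e j)
  X₃ := ModuleCat.of A (A ⧸ coordIdeal e (j + 1))
  f := ModuleCat.ofHom (LinearMap.lsmul A (A ⧸ coordIdeal e j) (e.symm (MvPowerSeries.X j)))
  g := ModuleCat.ofHom (Submodule.factor (coordIdeal_mono e (Nat.le_succ j)))
  zero := by
    refine ModuleCat.hom_ext (LinearMap.ext fun x => ?_)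
    obtain ⟨a, rfl⟩ := Submodule.Quotient.mk_surjective _ x
    change (Submodule.Quotient.mk (e.symm (MvPowerSeries.X j) • a) : A ⧸ coordIdeal e (j + 1)) = 0
    rw [Submodule.Quotient.mk_eq_zero]
    exact Ideal.mul_mem_right _ _ (X_mem_coordIdeal e j)

theorem coordSequence_shortExact (j : Fin d) : (coordSequence e j).ShortExact := by
  refine ShortComplex.ShortExact.mk' ?_ ?_ ?_
  · rw [ShortComplex.ShortExact.moduleCat_exact_iff_function_exact]
    intro x
    obtain ⟨a, rfl⟩ := Submodule.Quotient.mk_surjective (coordIdeal e j) x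
    constructor
    · intro h
      have h' : a ∈ coordIdeal e (j + 1) := (Submodule.Quotient.mk_eq_zero _).1 h
      obtain ⟨g, hg⟩ := exists_of_mem_coordIdeal_succ e j h'
      exact ⟨Submodule.Quotient.mk g, ((Submodule.Quotient.eq _).2 hg).symm⟩
    · rintro ⟨y, hy⟩
      rw [← hy]
      exact ConcreteCategory.congr_hom (coordSequence e j).zero y
  · rw [ModuleCat.mono_iff_injective]
    refine (injective_iff_map_eq_zero (coordSequence e j).f.hom).2 fun x hx => ?_
    obtain ⟨a, rfl⟩ := Submodule.Quotient.mk_surjective (coordIdeal e j) x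
    refine (Submodule.Quotient.mk_eq_zero _).2 (mem_coordIdeal_of_X_mul_mem e j ?_)
    exact (Submodule.Quotient.mk_eq_zero _).1 hx
  · rw [ModuleCat.epi_iff_surjective]
    intro x
    obtain ⟨a, rfl⟩ := Submodule.Quotient.mk_surjective (coordIdeal e (j + 1)) x
    exact ⟨Submodule.Quotient.mk a, rfl⟩

theorem preservesHomology_tensorFunctor (k : Type u) [Field k] [Algebra k A] (L : ModuleCat.{u} A)
    [Module.Flat A L] : (tensorFunctor k L).PreservesHomology := by
  refine ((Functor.exact_tfae (tensorFunctor k L)).out 1 2).1 fun S hS => ?_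
  rw [ShortComplex.ShortExact.moduleCat_exact_iff_function_exact] at hS ⊢
  exact Module.Flat.lTensor_exact (f := S.f.hom) (g := S.g.hom) L hS

theorem flat_quotient_coordIdeal_zero : Module.Flat A (A ⧸ coordIdeal e 0) := by
  rw [coordIdeal_zero]
  exact Module.Flat.of_linearEquiv (Submodule.quotEquivOfEqBot (⊥ : Ideal A) rfl)

/-- Each variable that is killed raises the projective dimension of the quotient by at most one. -/
theorem isZero_leftDerived_coord {j : ℕ} (hj : j ≤ d) (N : ModuleCat.{u} A) {i : ℕ} (hi : j < i) :
    Limits.IsZero (((tensorFunctor k (ModuleCat.of A (A ⧸ coordIdeal e j))).leftDerived i).obj N)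
    := by
  induction j generalizing i with
  | zero =>
    obtain ⟨i, rfl⟩ := Nat.exists_eq_succ_of_ne_zero hi.ne'
    have := flat_quotient_coordIdeal_zero e
    have := preservesHomology_tensorFunctor k (ModuleCat.of A (A ⧸ coordIdeal e 0))
    exact isZero_leftDerived_succ_of_exact _ N i
  | succ j ih =>
    obtain ⟨i, rfl⟩ := Nat.exists_eq_succ_of_ne_zero (Nat.ne_of_gt (Nat.zero_lt_of_lt hi))
    obtain ⟨T, hT, h₁, h₂, h₃⟩ := exists_shortExact_tensorFunctor k
      (coordSequence_shortExact e ⟨j, hj⟩) N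
    have hij : j < i := Nat.lt_of_succ_lt_succ hi
    refine Limits.IsZero.of_iso ?_ (h₃ (i + 1)).some.symm
    exact ShortComplex.ShortExact.isZero_homology hT
      (.of_iso (ih (Nat.le_of_succ_le hj) hij) (h₁ i).some)
      (.of_iso (ih (Nat.le_of_succ_le hj) (Nat.lt_succ_of_lt hij)) (h₂ (i + 1)).some)

theorem finite_leftDerived_coord {j : ℕ} (hj : j ≤ d) (N : ModuleCat.{u} A)
    (hN : Module.Finite k ((ModuleCat.restrictScalars (algebraMap k A)).obj N)) (i : ℕ) :
    Module.Finite k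
      (((tensorFunctor k (ModuleCat.of A (A ⧸ coordIdeal e j))).leftDerived i).obj N) := by
  induction j generalizing i with
  | zero =>
    have := flat_quotient_coordIdeal_zero e
    have := preservesHomology_tensorFunctor k (ModuleCat.of A (A ⧸ coordIdeal e 0))
    cases i with
    | zero =>
      have e₀ := (nonempty_leftDerived_zero_iso_of_exact
        (tensorFunctor k (ModuleCat.of A (A ⧸ coordIdeal e 0))) N).some
      -- `A/0 ⊗ N` is a quotient of `N`
      have hs : Function.Surjective
          (TensorProduct.mk A (A ⧸ coordIdeal e 0) N (Submodule.Quotient.mk 1)) := by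
        intro z
        induction z using TensorProduct.induction_on with
        | zero => exact ⟨0, map_zero _⟩
        | tmul a n =>
          obtain ⟨a, rfl⟩ := Submodule.Quotient.mk_surjective _ a
          refine ⟨a • n, ?_⟩
          rw [TensorProduct.mk_apply, ← TensorProduct.smul_tmul, ← Submodule.Quotient.mk_smul,
            smul_eq_mul, mul_one]
        | add x y hx hy =>
          obtain ⟨x, rfl⟩ := hx
          obtain ⟨y, rfl⟩ := hy
          exact ⟨x + y, map_add _ _ _⟩
      have := Module.Finite.of_surjective ((ModuleCat.restrictScalars (algebraMap k A)).map
        (ModuleCat.ofHom (TensorProduct.mk A (A ⧸ coordIdeal e 0) N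
          (Submodule.Quotient.mk 1)))).hom hs
      exact ModuleCat.finite_of_iso e₀.symm this
    | succ i =>
      have := ModuleCat.subsingleton_of_isZero (isZero_leftDerived_succ_of_exact
        (tensorFunctor k (ModuleCat.of A (A ⧸ coordIdeal e 0))) N i)
      infer_instance
  | succ j ih =>
    obtain ⟨T, hT, h₁, h₂, h₃⟩ := exists_shortExact_tensorFunctor k
      (coordSequence_shortExact e ⟨j, hj⟩) N
    have hf := ih (Nat.le_of_succ_le hj)
    have := ShortComplex.ShortExact.finite_homology hT
      (fun i => ModuleCat.finite_of_iso (h₁ i).some.symm (hf i))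
      (fun i => ModuleCat.finite_of_iso (h₂ i).some.symm (hf i)) i
    exact Module.Finite.equiv (h₃ i).some.toLinearEquiv

/-- The first two terms of `coordSequence` coincide, so the Euler characteristic of the third one
vanishes. -/
theorem altRank_leftDerived_coord {j : ℕ} (hj : j + 1 ≤ d) (N : ModuleCat.{u} A)
    (hN : Module.Finite k ((ModuleCat.restrictScalars (algebraMap k A)).obj N)) {n : ℕ}
    (hn : j + 1 < n) :
    altRank k (fun i => ((tensorFunctor k
      (ModuleCat.of A (A ⧸ coordIdeal e (j + 1)))).leftDerived i).obj N) n = 0 := by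
  obtain ⟨T, hT, h₁, h₂, h₃⟩ := exists_shortExact_tensorFunctor k
    (coordSequence_shortExact e ⟨j, hj⟩) N
  have hf := finite_leftDerived_coord e (Nat.le_of_succ_le hj) N hN
  have h := ShortComplex.ShortExact.altRank_homology hT
    (fun i => ModuleCat.finite_of_iso (h₁ i).some.symm (hf i))
    (fun i => ModuleCat.finite_of_iso (h₂ i).some.symm (hf i))
    (.of_iso (isZero_leftDerived_coord e hj N hn) (h₃ n).some)
  rw [altRank_congr (fun i => (h₁ i).some.toLinearEquiv.finrank_eq),
    altRank_congr (fun i => (h₂ i).some.toLinearEquiv.finrank_eq),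
    altRank_congr (fun i => (h₃ i).some.toLinearEquiv.finrank_eq)] at h
  exact left_eq_add.1 h

variable [IsLocalRing A]

/-- The residue field is the quotient by all the variables. -/
noncomputable def residueIso :
    ModuleCat.of A (A ⧸ coordIdeal e d) ≅ residueModule A :=
  (Submodule.quotEquivOfEq _ _ (coordIdeal_d e)).toModuleIso

/-- Base change along `residueIso`, on derived functors. -/
noncomputable def leftDerivedResidueIso (N : ModuleCat.{u} A) (i : ℕ) :
    ((tensorFunctor k (ModuleCat.of A (A ⧸ coordIdeal e d))).leftDerived i).obj N ≅
      ((tensorFunctor k (residueModule A)).leftDerived i).obj N :=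
  leftDerivedIsoOfIso (Functor.isoWhiskerRight
    ((tensoringLeft (ModuleCat.{u} A)).mapIso (residueIso e))
    (ModuleCat.restrictScalars (algebraMap k A))) i N

theorem isZero_leftDerived_residue (e : A ≃ₐ[k] MvPowerSeries (Fin d) k) (N : ModuleCat.{u} A)
    {i : ℕ} (hi : d < i) :
    Limits.IsZero (((tensorFunctor k (residueModule A)).leftDerived i).obj N) :=
  .of_iso (isZero_leftDerived_coord e le_rfl N hi) (leftDerivedResidueIso e N i).symm

theorem finite_leftDerived_residue (e : A ≃ₐ[k] MvPowerSeries (Fin d) k) (N : ModuleCat.{u} A)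
    (hN : Module.Finite k ((ModuleCat.restrictScalars (algebraMap k A)).obj N)) (i : ℕ) :
    Module.Finite k (((tensorFunctor k (residueModule A)).leftDerived i).obj N) := by
  have := finite_leftDerived_coord e le_rfl N hN i
  exact Module.Finite.equiv (leftDerivedResidueIso e N i).toLinearEquiv

theorem altRank_leftDerived_residue (e : A ≃ₐ[k] MvPowerSeries (Fin d) k) (hd : 1 ≤ d)
    (N : ModuleCat.{u} A)
    (hN : Module.Finite k ((ModuleCat.restrictScalars (algebraMap k A)).obj N)) {n : ℕ}
    (hn : d < n) :
    altRank k (fun i => ((tensorFunctor k (residueModule A)).leftDerived i).obj N) n = 0 := by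
  rw [← altRank_congr (fun i =>
    (leftDerivedResidueIso e N i).toLinearEquiv.finrank_eq)]
  obtain ⟨j, rfl⟩ := Nat.exists_eq_add_of_le' hd
  exact altRank_leftDerived_coord e le_rfl N hN hn

end Coord

/-! ### Flatness of the endomorphism raising the variables to a power -/

section FrobeniusFlat

variable {A : Type u} [CommRing A]

/-- The ring `A`, viewed as an `A`-module through the endomorphism `ψ`. -/
def FrobTwist (_ψ : A →+* A) : Type u := A

variable (ψ : A →+* A)

instance : AddCommGroup (FrobTwist ψ) := inferInstanceAs (AddCommGroup A)

instance : Module A (FrobTwist ψ) := Module.compHom A ψ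

/-- The identity `A → FrobTwist ψ`. -/
def FrobTwist.of : A ≃+ FrobTwist ψ := AddEquiv.refl A

theorem FrobTwist.of_mul (a x : A) : FrobTwist.of ψ (ψ a * x) = a • FrobTwist.of ψ x := rfl

theorem flat_frobTwist_iff : Module.Flat A (FrobTwist ψ) ↔ RingHom.Flat ψ := Iff.rfl

theorem flat_frobTwist_pow (h : Module.Flat A (FrobTwist ψ)) (n : ℕ) :
    Module.Flat A (FrobTwist (ψ ^ n)) := by
  rw [flat_frobTwist_iff] at h ⊢
  induction n with
  | zero => exact RingHom.Flat.id A
  | succ n ih =>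
    rw [pow_succ]
    exact RingHom.Flat.comp h ih

variable {k : Type u} [Field k] {d : ℕ} [Algebra k A]
  (e : A ≃ₐ[k] MvPowerSeries (Fin d) k)

theorem coeff_add_X_pow_mul (j : Fin d) (f : A) (q : ℕ) (n : Fin d →₀ ℕ) :
    MvPowerSeries.coeff (n + Finsupp.single j q) (e (e.symm (MvPowerSeries.X j) ^ q * f)) =
      MvPowerSeries.coeff n (e f) := by
  rw [map_mul, map_pow, AlgEquiv.apply_symm_apply, mul_comm, MvPowerSeries.X_pow_eq]
  have := MvPowerSeries.coeff_add_mul_monomial n (Finsupp.single j q) (e f) (1 : k)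
  rwa [mul_one] at this

theorem coeff_X_pow_mul_of_lt (j : Fin d) (f : A) {q : ℕ} {n : Fin d →₀ ℕ} (hn : n j < q) :
    MvPowerSeries.coeff n (e (e.symm (MvPowerSeries.X j) ^ q * f)) = 0 := by
  classical
  rw [map_mul, map_pow, AlgEquiv.apply_symm_apply, MvPowerSeries.X_pow_eq]
  have := MvPowerSeries.coeff_monomial_mul n (Finsupp.single j q) (e f) (1 : k)
  rw [if_neg] at this
  · exact this
  · intro h
    have := h j
    simp only [Finsupp.single_eq_same] at this
    omega

theorem exists_eq_algebraMap_add_sum (f : A) :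
    ∃ (c : k) (g : Fin d → A), f = algebraMap k A c + ∑ i, e.symm (MvPowerSeries.X i) * g i := by
  refine ⟨MvPowerSeries.constantCoeff (e f), ?_⟩
  have h : f - algebraMap k A (MvPowerSeries.constantCoeff (e f)) ∈ coordIdeal e d := by
    rw [mem_coordIdeal_d, map_sub, AlgEquiv.commutes, map_sub, MvPowerSeries.algebraMap_apply]
    simp
  rw [coordIdeal_d_eq_span, Ideal.mem_span_range_iff_exists_fun] at h
  obtain ⟨g, hg⟩ := h
  refine ⟨g, ?_⟩
  rw [Finset.sum_congr rfl fun i _ => mul_comm (e.symm (MvPowerSeries.X i)) (g i), hg]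
  ring

/-- The exponent vector divided by `q`, rounded down. -/
noncomputable def divExp (q : ℕ) (m : Fin d →₀ ℕ) : Fin d →₀ ℕ :=
  m.mapRange (· / q) (Nat.zero_div q)

variable {φ : A →ₐ[k] A} {q : ℕ}

theorem divExp_apply (m : Fin d →₀ ℕ) (i : Fin d) : divExp q m i = m i / q := rfl

theorem divExp_add_single (hq : 0 < q) (n : Fin d →₀ ℕ) (i : Fin d) :
    divExp q (n + Finsupp.single i q) = divExp q n + Finsupp.single i 1 := by
  classical
  ext j
  simp only [divExp_apply, Finsupp.add_apply, Finsupp.single_apply]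
  split_ifs with h
  · rw [Nat.add_div_right _ hq]
  · simp

theorem dvd_add_single_iff (n : Fin d →₀ ℕ) (i : Fin d) :
    (∀ j, q ∣ (n + Finsupp.single i q) j) ↔ ∀ j, q ∣ n j := by
  classical
  refine forall_congr' fun j => ?_
  simp only [Finsupp.add_apply, Finsupp.single_apply]
  split_ifs with h
  · exact Nat.dvd_add_self_right
  · simp

open Classical in
/-- The endomorphism with `X_j ↦ X_j^q` is `∑ c_n X^n ↦ ∑ c_n X^{qn}`. No continuity is assumed:
it follows from `f = f(0) + ∑ X_j g_j` by induction on the degree. -/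
theorem coeff_frobenius (hq : 0 < q)
    (hφ : ∀ j : Fin d, φ (e.symm (MvPowerSeries.X j)) = e.symm (MvPowerSeries.X j) ^ q)
    (f : A) (m : Fin d →₀ ℕ) : MvPowerSeries.coeff m (e (φ f)) =
      if ∀ i, q ∣ m i then MvPowerSeries.coeff (divExp q m) (e f) else 0 := by
  induction hN : m.degree using Nat.strong_induction_on generalizing f m with
  | _ N ih =>
    obtain ⟨c, g, rfl⟩ := exists_eq_algebraMap_add_sum e f
    have hc : MvPowerSeries.coeff m (e (algebraMap k A c)) = if ∀ i, q ∣ m i then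
        MvPowerSeries.coeff (divExp q m) (e (algebraMap k A c)) else 0 := by
      simp only [AlgEquiv.commutes, MvPowerSeries.algebraMap_apply, Algebra.algebraMap_self_apply,
        MvPowerSeries.coeff_C]
      by_cases hm : m = 0
      · subst hm
        have : divExp q (0 : Fin d →₀ ℕ) = 0 := by ext; simp [divExp_apply]
        simp [this]
      · rw [if_neg hm]
        split_ifs with h1 h2
        · exfalso
          apply hm
          ext i
          have h3 := DFunLike.congr_fun h2 i
          rw [divExp_apply] at h3
          rw [← Nat.div_mul_cancel (h1 i), h3]
          simp
        · rfl
        · rfl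
    have ht (i : Fin d) : MvPowerSeries.coeff m (e (e.symm (MvPowerSeries.X i) ^ q * φ (g i))) =
        if ∀ i, q ∣ m i then
          MvPowerSeries.coeff (divExp q m) (e (e.symm (MvPowerSeries.X i) * g i)) else 0 := by
      by_cases hm : m i < q
      · rw [coeff_X_pow_mul_of_lt e i _ hm, coeff_X_mul_of_eq_zero e i, ite_self]
        rw [divExp_apply, Nat.div_eq_of_lt hm]
      · obtain ⟨n, rfl⟩ : ∃ n, m = n + Finsupp.single i q := by
          refine ⟨m - Finsupp.single i q, (tsub_add_cancel_of_le ?_).symm⟩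
          rw [Finsupp.single_le_iff]
          omega
        rw [coeff_add_X_pow_mul, divExp_add_single hq, coeff_add_single_X_mul,
          ih n.degree (by rw [← hN, map_add, Finsupp.degree_single]; omega) (g i) n rfl]
        simp only [dvd_add_single_iff]
    simp only [map_add, map_sum, map_mul φ, AlgHom.commutes, hφ, hc, ht]
    split_ifs
    · rfl
    · simp

/-- The exponent vector with entries `ε_i < q`. -/
noncomputable def smallExp (ε : Fin d → Fin q) : Fin d →₀ ℕ :=
  Finsupp.equivFunOnFinite.symm fun i => (ε i : ℕ)

theorem smallExp_apply (ε : Fin d → Fin q) (i : Fin d) : smallExp ε i = ε i := rfl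

theorem coeff_monomial_mul_frobenius (hq : 0 < q)
    (hφ : ∀ j : Fin d, φ (e.symm (MvPowerSeries.X j)) = e.symm (MvPowerSeries.X j) ^ q)
    (f : A) (ε ε' : Fin d → Fin q) (n : Fin d →₀ ℕ) :
    MvPowerSeries.coeff (q • n + smallExp ε)
      (e (φ f * e.symm (MvPowerSeries.monomial (smallExp ε') 1))) =
      if ε' = ε then MvPowerSeries.coeff n (e f) else 0 := by
  classical
  rw [map_mul, AlgEquiv.apply_symm_apply, MvPowerSeries.coeff_mul_monomial, mul_one,
    coeff_frobenius e hq hφ]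
  split_ifs with h1 h2 h3 h3 h3
  · subst h3
    congr 2
    ext i
    rw [divExp_apply, add_tsub_cancel_right, Finsupp.smul_apply, smul_eq_mul,
      Nat.mul_div_cancel_left _ hq]
  · exfalso
    apply h3
    ext i
    have hle : smallExp ε' i ≤ (q • n + smallExp ε) i := h1 i
    obtain ⟨t, ht⟩ := h2 i
    simp only [Finsupp.tsub_apply, Finsupp.add_apply, Finsupp.smul_apply, smul_eq_mul,
      smallExp_apply] at hle ht
    have h4 : q * n i + ε i = q * t + ε' i := by omega
    have h5 := congrArg (· % q) h4
    simp only [Nat.mul_add_mod, Nat.mod_eq_of_lt (ε i).2, Nat.mod_eq_of_lt (ε' i).2] at h5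
    exact h5.symm
  · subst h3
    exfalso
    apply h2
    intro i
    rw [add_tsub_cancel_right, Finsupp.smul_apply, smul_eq_mul]
    exact dvd_mul_right _ _
  · rfl
  · subst h3
    exact absurd le_add_self h1
  · rfl

theorem exists_smallExp (hq : 0 < q) (m : Fin d →₀ ℕ) :
    ∃ (n : Fin d →₀ ℕ) (ε : Fin d → Fin q), m = q • n + smallExp ε := by
  refine ⟨divExp q m, fun i => ⟨m i % q, Nat.mod_lt _ hq⟩, ?_⟩
  ext i
  simp only [Finsupp.add_apply, Finsupp.smul_apply, smul_eq_mul, divExp_apply, smallExp_apply]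
  exact (Nat.div_add_mod _ _).symm

/-- `k[[X]]` is free over `k[[X^q]]`, on the monomials with all exponents less than `q`. -/
theorem flat_frobTwist (hq : 0 < q)
    (hφ : ∀ j : Fin d, φ (e.symm (MvPowerSeries.X j)) = e.symm (MvPowerSeries.X j) ^ q) :
    Module.Flat A (FrobTwist (φ : A →+* A)) := by
  classical
  let Ψ : ((Fin d → Fin q) → A) →ₗ[A] FrobTwist (φ : A →+* A) :=
    { toFun := fun g => FrobTwist.of _
        (∑ ε, φ (g ε) * e.symm (MvPowerSeries.monomial (smallExp ε) 1))
      map_add' := fun g g' => by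
        simp only [Pi.add_apply, map_add, add_mul, Finset.sum_add_distrib]
      map_smul' := fun a g => by
        rw [RingHom.id_apply, ← FrobTwist.of_mul, Finset.mul_sum]
        simp only [Pi.smul_apply, smul_eq_mul, map_mul, mul_assoc]
        rfl }
  have hΨ (g : (Fin d → Fin q) → A) (n : Fin d →₀ ℕ) (ε : Fin d → Fin q) :
      MvPowerSeries.coeff (q • n + smallExp ε) (e ((FrobTwist.of _).symm (Ψ g))) =
        MvPowerSeries.coeff n (e (g ε)) := by
    change MvPowerSeries.coeff (q • n + smallExp ε)
      (e (∑ ε, φ (g ε) * e.symm (MvPowerSeries.monomial (smallExp ε) 1))) = _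
    rw [map_sum, map_sum, Finset.sum_congr rfl fun ε' _ =>
      coeff_monomial_mul_frobenius e hq hφ (g ε') ε ε' n]
    simp
  -- `Ψ` only sorts the coefficients according to the residues of the exponents modulo `q`
  refine Module.Flat.of_linearEquiv (LinearEquiv.ofBijective Ψ ⟨?_, ?_⟩).symm
  · refine (injective_iff_map_eq_zero Ψ).2 fun g hg => funext fun ε => e.injective ?_
    rw [Pi.zero_apply, map_zero]
    refine MvPowerSeries.ext fun n => ?_
    rw [← hΨ, hg]
    simp
  · intro f
    let c : (Fin d → Fin q) → MvPowerSeries (Fin d) k := fun ε n =>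
      MvPowerSeries.coeff (q • n + smallExp ε) (e ((FrobTwist.of _).symm f))
    refine ⟨fun ε => e.symm (c ε), (FrobTwist.of _).symm.injective (e.injective
      (MvPowerSeries.ext fun m => ?_))⟩
    obtain ⟨n, ε, rfl⟩ := exists_smallExp hq m
    rw [hΨ, AlgEquiv.apply_symm_apply]
    rfl

end FrobeniusFlat

/-! ### Modules of finite length -/

section FiniteLength

open IsLocalRing

variable {A : Type u} [CommRing A] [IsLocalRing A]

/-- A finitely generated artinian module is killed by a power of the maximal ideal, if that ideal is
finitely generated (the ring itself need not be noetherian). -/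
theorem exists_maximalIdeal_pow_smul_eq_bot (hm : (maximalIdeal A).FG) (N : Type u)
    [AddCommGroup N] [Module A N] [Module.Finite A N] [IsArtinian A N] :
    ∃ n : ℕ, (maximalIdeal A ^ n • ⊤ : Submodule A N) = ⊥ := by
  obtain ⟨n, hn⟩ := IsArtinian.monotone_stabilizes (R := A) (M := N)
    ⟨fun n => OrderDual.toDual (maximalIdeal A ^ n • ⊤ : Submodule A N), fun i j hij =>
      Submodule.smul_mono_left (Ideal.pow_le_pow_right hij)⟩
  refine ⟨n, ?_⟩
  have h : (maximalIdeal A ^ n • ⊤ : Submodule A N) = maximalIdeal A ^ (n + 1) • ⊤ :=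
    hn (n + 1) (Nat.le_succ n)
  refine Submodule.eq_bot_of_le_smul_of_le_jacobson_bot (maximalIdeal A) _
    (Submodule.FG.smul (Submodule.FG.pow hm n) Module.Finite.fg_top) ?_
    (IsLocalRing.maximalIdeal_le_jacobson ⊥)
  conv_lhs => rw [h]
  rw [pow_succ', Submodule.mul_smul]

variable {k : Type u} [Field k] [Algebra k A]

/-- A finitely generated module killed by a power of the maximal ideal is finite dimensional over
a coefficient field. -/
theorem finite_of_maximalIdeal_pow_smul_eq_bot (hm : (maximalIdeal A).FG)
    (hk : ∀ a : A, ∃ c : k, a - algebraMap k A c ∈ maximalIdeal A) {n : ℕ} (N : Type u)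
    [AddCommGroup N] [Module A N] [Module k N] [IsScalarTower k A N] [Module.Finite A N]
    (hN : (maximalIdeal A ^ n • ⊤ : Submodule A N) = ⊥) : Module.Finite k N := by
  induction n generalizing N with
  | zero =>
    have : Subsingleton N := by
      rw [pow_zero, Ideal.one_eq_top, Submodule.top_smul] at hN
      exact (Submodule.subsingleton_iff A).1 (subsingleton_of_bot_eq_top hN.symm)
    infer_instance
  | succ n ih =>
    let N' : Submodule A N := maximalIdeal A • ⊤
    have hfg : N'.FG := Submodule.FG.smul hm Module.Finite.fg_top
    have : Module.Finite A N' := Module.Finite.iff_fg.2 hfg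
    have h1 : Module.Finite k N' := by
      refine ih N' ?_
      rw [eq_bot_iff, ← Submodule.map_le_map_iff_of_injective N'.subtype_injective,
        Submodule.map_smul'', Submodule.map_top, Submodule.range_subtype, Submodule.map_bot,
        ← Submodule.mul_smul, ← pow_succ, hN]
    have h2 : Module.Finite k (N ⧸ N') := by
      obtain ⟨s, hs⟩ := (Module.Finite.fg_top : (⊤ : Submodule A (N ⧸ N')).FG)
      refine ⟨⟨s, eq_top_iff.2 fun x _ => ?_⟩⟩
      have hx : x ∈ Submodule.span A (s : Set (N ⧸ N')) := by rw [hs]; trivial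
      induction hx using Submodule.span_induction with
      | mem x hx => exact Submodule.subset_span hx
      | zero => exact Submodule.zero_mem _
      | add x y _ _ hx hy => exact Submodule.add_mem _ (hx trivial) (hy trivial)
      | smul a x _ hx =>
        obtain ⟨c, hc⟩ := hk a
        have h0 : (a - algebraMap k A c) • x = 0 := by
          obtain ⟨y, rfl⟩ := Submodule.Quotient.mk_surjective _ x
          rw [← Submodule.Quotient.mk_smul, Submodule.Quotient.mk_eq_zero]
          exact Submodule.smul_mem_smul hc trivial
        rw [sub_smul, sub_eq_zero, algebraMap_smul] at h0
        rw [h0]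
        exact Submodule.smul_mem _ c (hx trivial)
    have h1' : Module.Finite k (N'.restrictScalars k) := h1
    have h2' : Module.Finite k (N ⧸ N'.restrictScalars k) := h2
    exact Module.Finite.of_submodule_quotient (N'.restrictScalars k)

variable {d : ℕ} (e : A ≃ₐ[k] MvPowerSeries (Fin d) k)

/-- The ideal generated by the image of a power of the maximal ideal under `X_j ↦ X_j^q` contains
a power of the maximal ideal. -/
theorem exists_maximalIdeal_pow_le_map {φ : A →ₐ[k] A} {q : ℕ}
    (hφ : ∀ j : Fin d, φ (e.symm (MvPowerSeries.X j)) = e.symm (MvPowerSeries.X j) ^ q) (n : ℕ) :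
    ∃ N : ℕ, maximalIdeal A ^ N ≤ (maximalIdeal A ^ n).map (φ : A →+* A) := by
  refine Ideal.exists_pow_le_of_le_radical_of_fg ?_ (maximalIdeal_fg e)
  rw [maximalIdeal_eq_span e, Ideal.span_le]
  rintro _ ⟨j, rfl⟩
  refine ⟨q * n, ?_⟩
  change e.symm (MvPowerSeries.X j) ^ (q * n) ∈ _
  rw [pow_mul, ← hφ, Ideal.map_pow]
  exact Ideal.pow_mem_pow (Ideal.mem_map_of_mem (φ : A →+* A)
    (Ideal.subset_span (Set.mem_range_self j))) n

end FiniteLength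

/-! ### Twisted polynomials as a right module -/

namespace TwistedPolynomial

section Coefficients

variable {A : Type u} [CommRing A] (φ : A →+* A)

/-- The monomial `a Xⁿ`. -/
noncomputable def monomial (n : ℕ) : A →+ TwistedPolynomial φ :=
  (SkewPolynomial.monomial n : A →ₗ[A] SkewPolynomial A).toAddMonoidHom

theorem monomial_eq (n : ℕ) (a : A) : monomial φ n a = C φ a * X φ ^ n := by
  let _ := action φ
  exact (SkewPolynomial.C_mul_X_pow_eq_monomial (R := A) (n := n) (a := a)).symm

/-- The additive isomorphism sending a twisted polynomial to its coefficients. -/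
noncomputable def coeffEquiv : TwistedPolynomial φ ≃+ (ℕ →₀ A) :=
  (SkewMonoidAlgebra.coeffAddEquiv (k := A) (G := Multiplicative ℕ)).trans
    (Finsupp.domCongr Multiplicative.toAdd)

theorem coeffEquiv_monomial (n : ℕ) (a : A) :
    coeffEquiv φ (monomial φ n a) = Finsupp.single n a := by
  change Finsupp.equivMapDomain Multiplicative.toAdd
    (Finsupp.single (Multiplicative.ofAdd n) a) = _
  rw [Finsupp.equivMapDomain_single]
  rfl

variable {φ} in
theorem addHom_ext {Y : Type*} [AddCommGroup Y] {f g : TwistedPolynomial φ →+ Y}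
    (h : ∀ n a, f (monomial φ n a) = g (monomial φ n a)) : f = g := by
  have : f.comp (coeffEquiv φ).symm.toAddMonoidHom = g.comp (coeffEquiv φ).symm.toAddMonoidHom := by
    refine Finsupp.addHom_ext fun n a => ?_
    have h' : (coeffEquiv φ).symm (Finsupp.single n a) = monomial φ n a := by
      rw [AddEquiv.symm_apply_eq, coeffEquiv_monomial]
    change f ((coeffEquiv φ).symm (Finsupp.single n a)) = g ((coeffEquiv φ).symm _)
    rw [h', h]
  refine AddMonoidHom.ext fun r => ?_
  have := DFunLike.congr_fun this (coeffEquiv φ r)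
  simpa using this

/-- The additive map out of `A[X]_φ` with prescribed values on the monomials. -/
noncomputable def liftAdd {Y : Type*} [AddCommGroup Y] (g : ℕ → A →+ Y) :
    TwistedPolynomial φ →+ Y :=
  (Finsupp.liftAddHom g).comp (coeffEquiv φ).toAddMonoidHom

@[simp]
theorem liftAdd_monomial {Y : Type*} [AddCommGroup Y] (g : ℕ → A →+ Y) (n : ℕ) (a : A) :
    liftAdd φ g (monomial φ n a) = g n a := by
  change Finsupp.liftAddHom g (coeffEquiv φ (monomial φ n a)) = _
  rw [coeffEquiv_monomial, Finsupp.liftAddHom_apply_single]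

theorem X_pow_mul_C (n : ℕ) (a : A) : X φ ^ n * C φ a = C φ ((φ ^ n) a) * X φ ^ n := by
  induction n generalizing a with
  | zero => simp
  | succ n ih =>
    rw [pow_succ, mul_assoc, X_mul_C, ← mul_assoc, ih, mul_assoc, ← pow_succ]
    congr 2

@[simp]
theorem monomial_mul_C (n : ℕ) (a b : A) :
    monomial φ n a * C φ b = monomial φ n (a * (φ ^ n) b) := by
  rw [monomial_eq, monomial_eq, mul_assoc, X_pow_mul_C, map_mul, mul_assoc]

theorem C_mul_monomial (n : ℕ) (a b : A) : C φ a * monomial φ n b = monomial φ n (a * b) := by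
  rw [monomial_eq, monomial_eq, map_mul, mul_assoc]

theorem monomial_mul_X (n : ℕ) (a : A) : monomial φ n a * X φ = monomial φ (n + 1) a := by
  rw [monomial_eq, monomial_eq, mul_assoc, pow_succ]

/-- The structure of right `A`-module on `A[X]_φ`; as `A` is commutative, this is recorded as a
`Module` instance. -/
@[reducible]
noncomputable def rightModule : Module A (TwistedPolynomial φ) where
  smul a r := r * C φ a
  one_smul r := by change r * C φ 1 = r; rw [map_one, mul_one]
  mul_smul a b r := by
    change r * C φ (a * b) = r * C φ b * C φ a
    rw [mul_comm a, map_mul, mul_assoc]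
  smul_zero a := zero_mul _
  smul_add a r s := add_mul _ _ _
  add_smul a b r := by
    change r * C φ (a + b) = r * C φ a + r * C φ b
    rw [map_add, mul_add]
  zero_smul r := by change r * C φ 0 = 0; rw [map_zero, mul_zero]

attribute [local instance] rightModule

theorem right_smul_def (a : A) (r : TwistedPolynomial φ) : a • r = r * C φ a := rfl

theorem smulCommClass_right : SMulCommClass A (TwistedPolynomial φ) (TwistedPolynomial φ) where
  smul_comm a r s := mul_assoc r s (C φ a)

/-- A right `A`-linear map out of `A[X]_φ`, from an additive map which is linear on monomials. -/
noncomputable def rightLinearMk {Y : Type*} [AddCommGroup Y] [Module A Y]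
    (f : TwistedPolynomial φ →+ Y)
    (h : ∀ n a b, f (monomial φ n (a * (φ ^ n) b)) = b • f (monomial φ n a)) :
    TwistedPolynomial φ →ₗ[A] Y where
  toFun := f
  map_add' := map_add f
  map_smul' b r := by
    have : f.comp (AddMonoidHom.mulRight (C φ b)) = (DistribSMul.toAddMonoidHom Y b).comp f :=
      addHom_ext fun n a => by
        change f (monomial φ n a * C φ b) = b • f (monomial φ n a)
        rw [monomial_mul_C, h]
    exact DFunLike.congr_fun this r

/-- The projection of `A[X]_φ` onto the monomials of degree `i`. -/
noncomputable def proj (i : ℕ) : TwistedPolynomial φ →ₗ[A] TwistedPolynomial φ :=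
  rightLinearMk φ (liftAdd φ fun n => if n = i then monomial φ n else 0) fun n a b => by
    simp only [liftAdd_monomial]
    split_ifs
    · rw [right_smul_def, monomial_mul_C]
    · simp

theorem proj_monomial (i n : ℕ) (a : A) :
    proj φ i (monomial φ n a) = if n = i then monomial φ n a else 0 := by
  refine (liftAdd_monomial φ _ n a).trans ?_
  split_ifs <;> rfl

/-- Right division by `X`, dropping the constant coefficient. -/
noncomputable def divX : TwistedPolynomial φ →+ TwistedPolynomial φ :=
  liftAdd φ fun n => match n with
    | 0 => 0
    | n + 1 => monomial φ n

theorem divX_monomial_zero (a : A) : divX φ (monomial φ 0 a) = 0 :=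
  liftAdd_monomial φ _ 0 a

theorem divX_monomial_succ (n : ℕ) (a : A) : divX φ (monomial φ (n + 1) a) = monomial φ n a :=
  liftAdd_monomial φ _ (n + 1) a

/-- Division by `X` is semilinear for the right action of `A`, as `X a = φ(a) X`. -/
theorem divX_mul_C (r : TwistedPolynomial φ) (a : A) :
    divX φ (r * C φ a) = divX φ r * C φ (φ a) := by
  have : (divX φ).comp (AddMonoidHom.mulRight (C φ a)) =
      (AddMonoidHom.mulRight (C φ (φ a))).comp (divX φ) := addHom_ext fun n b => by
    change divX φ (monomial φ n b * C φ a) = divX φ (monomial φ n b) * C φ (φ a)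
    cases n with
    | zero => rw [monomial_mul_C, divX_monomial_zero, divX_monomial_zero, zero_mul]
    | succ n =>
      rw [monomial_mul_C, divX_monomial_succ, divX_monomial_succ, monomial_mul_C, pow_succ]
      rfl
  exact DFunLike.congr_fun this r

theorem divX_mul_C_mul_X (r : TwistedPolynomial φ) (a : A) :
    divX φ (r * (C φ a * X φ)) = r * C φ a := by
  have : (divX φ).comp (AddMonoidHom.mulRight (C φ a * X φ)) = AddMonoidHom.mulRight (C φ a) :=
    addHom_ext fun n b => by
      change divX φ (monomial φ n b * (C φ a * X φ)) = monomial φ n b * C φ a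
      rw [← mul_assoc, monomial_mul_C, monomial_mul_X, divX_monomial_succ]
  exact DFunLike.congr_fun this r

theorem exists_eq_sum_proj (r : TwistedPolynomial φ) :
    ∃ n : ℕ, ∀ m, n ≤ m → r = ∑ i ∈ Finset.range m, proj φ i r := by
  obtain ⟨c, rfl⟩ := (coeffEquiv φ).symm.surjective r
  induction c using Finsupp.induction_linear with
  | zero => exact ⟨0, fun m _ => by simp⟩
  | add f g hf hg =>
    obtain ⟨n₁, h₁⟩ := hf
    obtain ⟨n₂, h₂⟩ := hg
    refine ⟨max n₁ n₂, fun m hm => ?_⟩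
    simp only [map_add, Finset.sum_add_distrib]
    rw [← h₁ m (le_of_max_le_left hm), ← h₂ m (le_of_max_le_right hm)]
  | single n a =>
    have h' : (coeffEquiv φ).symm (Finsupp.single n a) = monomial φ n a := by
      rw [AddEquiv.symm_apply_eq, coeffEquiv_monomial]
    rw [h']
    refine ⟨n + 1, fun m hm => ?_⟩
    simp only [proj_monomial]
    rw [Finset.sum_ite_eq, if_pos (Finset.mem_range.2 hm)]

/-- As a right `A`-module, `A[X]_φ` is the direct sum of the twists of `A` by the powers of `φ`. -/
theorem flat_right (h : Module.Flat A (FrobTwist φ)) : Module.Flat A (TwistedPolynomial φ) := by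
  classical
  let Y := DirectSum ℕ fun n => FrobTwist (φ ^ n)
  let f : TwistedPolynomial φ →ₗ[A] Y := rightLinearMk φ
    (liftAdd φ fun n => (DirectSum.of (fun n => FrobTwist (φ ^ n)) n).comp
      (FrobTwist.of (φ ^ n)).toAddMonoidHom) fun n a b => by
    simp only [liftAdd_monomial]
    rw [mul_comm]
    exact (DirectSum.lof A ℕ (fun n => FrobTwist (φ ^ n)) n).map_smul b (FrobTwist.of (φ ^ n) a)
  let g : Y →+ TwistedPolynomial φ := DirectSum.toAddMonoid fun n =>
    (monomial φ n).comp (FrobTwist.of (φ ^ n)).symm.toAddMonoidHom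
  have hf (n a) : f (monomial φ n a) = DirectSum.of (fun n => FrobTwist (φ ^ n)) n
      (FrobTwist.of (φ ^ n) a) := liftAdd_monomial φ _ n a
  have hgf : g.comp f.toAddMonoidHom = AddMonoidHom.id _ := addHom_ext fun n a => by
    change g (f (monomial φ n a)) = monomial φ n a
    rw [hf]
    exact DirectSum.toAddMonoid_of _ _ _
  have hfg : f.toAddMonoidHom.comp g = AddMonoidHom.id _ := by
    refine DirectSum.addHom_ext fun n a => ?_
    change f (g (DirectSum.of _ n a)) = DirectSum.of _ n a
    have : g (DirectSum.of _ n a) = monomial φ n ((FrobTwist.of (φ ^ n)).symm a) :=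
      DirectSum.toAddMonoid_of _ _ _
    rw [this, hf, AddEquiv.apply_symm_apply]
  let E : TwistedPolynomial φ ≃ₗ[A] Y :=
    { f with
      invFun := g
      left_inv := DFunLike.congr_fun hgf
      right_inv := DFunLike.congr_fun hfg }
  have (n : ℕ) : Module.Flat A (FrobTwist (φ ^ n)) := flat_frobTwist_pow φ h n
  exact Module.Flat.of_linearEquiv E

end Coefficients

end TwistedPolynomial

/-! ### Induced modules -/

namespace TwistedPolynomial

section Induced

attribute [local instance] rightModule smulCommClass_right

open scoped TensorProduct

variable {A : Type u} [CommRing A] (φ : A →+* A)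

/-- The `A[X]_φ`-linear map `r ⊗ n ↦ r l(n)` extending an `A`-linear map `l`. -/
noncomputable def inducedLift {N : Type u} [AddCommGroup N] [Module A N]
    (M : ModuleCat.{u} (TwistedPolynomial φ)) (l : N →ₗ[A] (restrict φ).obj M) :
    TwistedPolynomial φ ⊗[A] N →ₗ[TwistedPolynomial φ] M :=
  let f : TwistedPolynomial φ ⊗[A] N →+ M :=
    TensorProduct.liftAddHom
      (AddMonoidHom.mk' (fun r => (DistribSMul.toAddMonoidHom M r).comp
        (l.toAddMonoidHom : N →+ M)) fun r s => AddMonoidHom.ext fun n => add_smul r s (l n : M))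
      fun a r n => by
        change (r * C φ a) • (l n : M) = r • (l (a • n) : M)
        rw [mul_smul, l.map_smul]
        rfl
  { f with
    map_smul' r z := by
      change f (r • z) = r • f z
      induction z using TensorProduct.induction_on with
      | zero => rw [smul_zero, map_zero, smul_zero]
      | add x y hx hy => rw [smul_add, map_add, hx, hy, map_add, smul_add]
      | tmul s n =>
        rw [TensorProduct.smul_tmul']
        exact mul_smul r s (l n : M) }

variable {φ} in
theorem induced_hom_ext {N : Type u} [AddCommGroup N] [Module A N] {M : Type*} [AddCommGroup M]
    [Module (TwistedPolynomial φ) M]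
    {f g : TwistedPolynomial φ ⊗[A] N →ₗ[TwistedPolynomial φ] M}
    (h : ∀ n : N, f (1 ⊗ₜ n) = g (1 ⊗ₜ n)) : f = g := by
  refine LinearMap.ext fun z => ?_
  induction z using TensorProduct.induction_on with
  | zero => rw [map_zero, map_zero]
  | add x y hx hy => rw [map_add, map_add, hx, hy]
  | tmul r n =>
    have : r ⊗ₜ[A] n = r • ((1 : TwistedPolynomial φ) ⊗ₜ[A] n) := by
      rw [TensorProduct.smul_tmul', smul_eq_mul, mul_one]
    rw [this, map_smul, map_smul, h]

/-- The map `n ↦ 1 ⊗ n`. -/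
noncomputable def inducedUnit (N : Type u) [AddCommGroup N] [Module A N] :
    N →ₗ[A] (restrict φ).obj (ModuleCat.of (TwistedPolynomial φ) (TwistedPolynomial φ ⊗[A] N)) where
  toFun n := (1 : TwistedPolynomial φ) ⊗ₜ[A] n
  map_add' := TensorProduct.tmul_add _
  map_smul' a n := by
    change _ = C φ a • ((1 : TwistedPolynomial φ) ⊗ₜ[A] n)
    rw [TensorProduct.smul_tmul', ← TensorProduct.smul_tmul, right_smul_def, smul_eq_mul,
      one_mul, mul_one]

/-- The `A[X]_φ`-linear map `r ⊗ n ↦ r ⊗ f(n)`. -/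
noncomputable def inducedMap {N N' : Type u} [AddCommGroup N] [Module A N] [AddCommGroup N']
    [Module A N'] (f : N →ₗ[A] N') :
    TwistedPolynomial φ ⊗[A] N →ₗ[TwistedPolynomial φ] TwistedPolynomial φ ⊗[A] N' :=
  inducedLift φ (ModuleCat.of (TwistedPolynomial φ) (TwistedPolynomial φ ⊗[A] N'))
    (inducedUnit φ N' ∘ₗ f)

@[simp]
theorem inducedMap_tmul {N N' : Type u} [AddCommGroup N] [Module A N] [AddCommGroup N']
    [Module A N'] (f : N →ₗ[A] N') (r : TwistedPolynomial φ) (n : N) :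
    inducedMap φ f (r ⊗ₜ n) = r ⊗ₜ f n := by
  change r • ((1 : TwistedPolynomial φ) ⊗ₜ[A] f n) = _
  rw [TensorProduct.smul_tmul', smul_eq_mul, mul_one]

theorem inducedMap_apply {N N' : Type u} [AddCommGroup N] [Module A N] [AddCommGroup N']
    [Module A N'] (f : N →ₗ[A] N') (z : TwistedPolynomial φ ⊗[A] N) :
    inducedMap φ f z = f.lTensor (TwistedPolynomial φ) z := by
  induction z using TensorProduct.induction_on with
  | zero => rw [map_zero, map_zero]
  | add x y hx hy => rw [map_add, hx, hy, map_add]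
  | tmul r n => exact inducedMap_tmul φ f r n

/-- The functor `N ↦ A[X]_φ ⊗_A N` from `A`-modules to `A[X]_φ`-modules. -/
noncomputable def induced : ModuleCat.{u} A ⥤ ModuleCat.{u} (TwistedPolynomial φ) where
  obj N := ModuleCat.of (TwistedPolynomial φ) (TwistedPolynomial φ ⊗[A] N)
  map f := ModuleCat.ofHom (inducedMap φ f.hom)
  map_id _ := ModuleCat.hom_ext (induced_hom_ext fun n => inducedMap_tmul φ _ 1 n)
  map_comp f g := ModuleCat.hom_ext (induced_hom_ext fun n =>
    (inducedMap_tmul φ _ 1 n).trans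
      ((congrArg (inducedMap φ g.hom) (inducedMap_tmul φ f.hom 1 n)).trans
        (inducedMap_tmul φ g.hom 1 _)).symm)

instance : (induced φ).Additive where
  map_add {_ _ f g} := ModuleCat.hom_ext (induced_hom_ext fun n =>
    (inducedMap_tmul φ _ 1 n).trans ((TensorProduct.tmul_add _ _ _).trans
      (congrArg₂ (· + ·) (inducedMap_tmul φ f.hom 1 n) (inducedMap_tmul φ g.hom 1 n)).symm))

/-- If `A` is flat over itself through `φ`, then `A[X]_φ` is flat as a right `A`-module, so that
`N ↦ A[X]_φ ⊗_A N` is exact. -/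
theorem preservesHomology_induced (h : Module.Flat A (FrobTwist φ)) :
    (induced φ).PreservesHomology := by
  have := flat_right φ h
  have key : ∀ S : ShortComplex (ModuleCat.{u} A), S.Exact → (S.map (induced φ)).Exact :=
    fun S h => by
      rw [ShortComplex.ShortExact.moduleCat_exact_iff_function_exact] at h ⊢
      have h' := Module.Flat.lTensor_exact (TwistedPolynomial φ) h
      change Function.Exact (inducedMap φ S.f.hom) (inducedMap φ S.g.hom)
      rwa [funext (inducedMap_apply φ S.f.hom), funext (inducedMap_apply φ S.g.hom)]
  have h' : (∀ S : ShortComplex (ModuleCat.{u} A), S.Exact → (S.map (induced φ)).Exact) ↔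
      (induced φ).PreservesHomology := (Functor.exact_tfae (induced φ)).out 1 2
  exact h'.1 key

instance : (induced φ).PreservesProjectiveObjects where
  projective_obj {N} hN := by
    refine ⟨fun {E Y} f g hg => ?_⟩
    have hg' : Function.Surjective g.hom := (ModuleCat.epi_iff_surjective g).1 hg
    have : Epi ((restrict φ).map g) := (ModuleCat.epi_iff_surjective _).2 hg'
    -- by adjunction, the lift is the extension of a lift of `A`-modules
    let η : N ⟶ (restrict φ).obj ((induced φ).obj N) := 
      ModuleCat.ofHom (Y := (restrict φ).obj ((induced φ).obj N)) (inducedUnit φ N)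
    let l : N ⟶ (restrict φ).obj E :=
      Projective.factorThru (η ≫ (restrict φ).map f) ((restrict φ).map g)
    have hl : l ≫ (restrict φ).map g = η ≫ (restrict φ).map f :=
      Projective.factorThru_comp _ _
    refine ⟨ModuleCat.ofHom (inducedLift φ E l.hom),
      ModuleCat.hom_ext (induced_hom_ext fun n => ?_)⟩
    have h1 : (l ≫ (restrict φ).map g).hom n = (η ≫ (restrict φ).map f).hom n := by rw [hl]
    refine Eq.trans (congrArg g.hom ?_) h1
    exact one_smul _ _

variable {φ} in
theorem induced_addHom_ext {N : Type u} [AddCommGroup N] [Module A N] {Y : Type*} [AddCommGroup Y]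
    {f g : TwistedPolynomial φ ⊗[A] N →+ Y}
    (h : ∀ n a (m : N), f (monomial φ n a ⊗ₜ m) = g (monomial φ n a ⊗ₜ m)) : f = g := by
  refine AddMonoidHom.ext fun z => ?_
  induction z using TensorProduct.induction_on with
  | zero => rw [map_zero, map_zero]
  | add x y hx hy => rw [map_add, map_add, hx, hy]
  | tmul r m =>
    have : f.comp ((TensorProduct.mk A (TwistedPolynomial φ) N).flip m).toAddMonoidHom =
        g.comp ((TensorProduct.mk A (TwistedPolynomial φ) N).flip m).toAddMonoidHom :=
      addHom_ext fun n a => h n a m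
    exact DFunLike.congr_fun this r

end Induced

end TwistedPolynomial

/-! ### Deriving a functor together with an endomorphism -/

section DerivedComp

open Limits

variable {C : Type*} [Category* C] [Abelian C] [EnoughProjectives C]
  {B : Type*} [Category* B] [Abelian B] {B' : Type*} [Category* B'] [Abelian B']

/-- Deriving commutes with the composition with an exact functor, compatibly with the natural
endomorphisms of the derived functor. -/
theorem exists_iso_leftDerived_comp (F : C ⥤ B) [F.Additive] (G : B ⥤ B') [G.Additive]
    [G.PreservesHomology] (i : ℕ) (M : C) :
    ∃ j : ((F ⋙ G).leftDerived i).obj M ≅ G.obj ((F.leftDerived i).obj M), ∀ α : F ⟶ F,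
      (NatTrans.leftDerived (Functor.whiskerRight α G) i).app M ≫ j.hom =
        j.hom ≫ G.map ((NatTrans.leftDerived α i).app M) := by
  let P := projectiveResolution M
  let K := (F.mapHomologicalComplex (ComplexShape.down ℕ)).obj P.complex
  let m : (HomologicalComplex.homologyFunctor B' (ComplexShape.down ℕ) i).obj
      (((F ⋙ G).mapHomologicalComplex (ComplexShape.down ℕ)).obj P.complex) ≅
    G.obj ((HomologicalComplex.homologyFunctor B (ComplexShape.down ℕ) i).obj K) :=
    (K.sc i).mapHomologyIso G
  refine ⟨P.isoLeftDerivedObj (F ⋙ G) i ≪≫ m ≪≫ G.mapIso (P.isoLeftDerivedObj F i).symm,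
    fun α => ?_⟩
  have hm : (HomologicalComplex.homologyFunctor B' (ComplexShape.down ℕ) i).map
      ((NatTrans.mapHomologicalComplex (Functor.whiskerRight α G) _).app P.complex) ≫ m.hom =
      m.hom ≫ G.map ((HomologicalComplex.homologyFunctor B (ComplexShape.down ℕ) i).map
        ((NatTrans.mapHomologicalComplex α _).app P.complex)) :=
    ShortComplex.mapHomologyIso_hom_naturality
      ((HomologicalComplex.shortComplexFunctor B (ComplexShape.down ℕ) i).map
        ((NatTrans.mapHomologicalComplex α _).app P.complex)) G
  rw [P.leftDerived_app_eq, P.leftDerived_app_eq]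
  simp only [Iso.trans_hom, Functor.mapIso_hom, Iso.symm_hom, Category.assoc, Functor.map_comp,
    Iso.inv_hom_id_assoc]
  rw [← Functor.map_comp_assoc, Iso.inv_hom_id, CategoryTheory.Functor.map_id, Category.id_comp,
    reassoc_of% hm]

end DerivedComp

section AevalFunctor

open Polynomial

variable {C : Type*} [Category* C] {k : Type u} [Field k]

/-- For an endomorphism `τ` of a functor `F` to `k`-vector spaces, the functor `F` with values in
`k[X]`-modules, the variable acting through `τ`. -/
noncomputable def aevalFunctor {F : C ⥤ ModuleCat.{u} k} (τ : F ⟶ F) : C ⥤ ModuleCat.{u} k[X] where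
  obj M := ModuleCat.of k[X] (Module.AEval' (τ.app M).hom)
  map {M N} f := ModuleCat.ofHom <| LinearMap.ofAEval (τ.app M).hom
    ((Module.AEval'.of (τ.app N).hom).toLinearMap ∘ₗ (F.map f).hom) fun m => by
      change Module.AEval'.of _ ((F.map f).hom ((τ.app M).hom m)) =
        (X : k[X]) • Module.AEval'.of (τ.app N).hom ((F.map f).hom m)
      rw [Module.AEval'.X_smul_of]
      exact congrArg _ (LinearMap.congr_fun (congrArg ModuleCat.Hom.hom (τ.naturality f)) m).symm
  map_id M := ModuleCat.hom_ext (LinearMap.ext fun z =>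
    LinearMap.congr_fun (congrArg ModuleCat.Hom.hom (F.map_id M)) z)
  map_comp f g := ModuleCat.hom_ext (LinearMap.ext fun z =>
    LinearMap.congr_fun (congrArg ModuleCat.Hom.hom (F.map_comp f g)) z)

variable {F : C ⥤ ModuleCat.{u} k} (τ : F ⟶ F)

instance [Preadditive C] [F.Additive] : (aevalFunctor τ).Additive where
  map_add {_ _ f g} := ModuleCat.hom_ext (LinearMap.ext fun z =>
    LinearMap.congr_fun (congrArg ModuleCat.Hom.hom (F.map_add (f := f) (g := g))) z)

theorem Module.AEval'.of_symm_C_smul {V : Type*} [AddCommGroup V] [Module k V] (t : V →ₗ[k] V)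
    (c : k) (z : Module.AEval' t) :
    (Module.AEval'.of t).symm ((Polynomial.C c : k[X]) • z) =
      c • (Module.AEval'.of t).symm z := by
  rw [Module.AEval.C_smul, map_smul]

/-- Forgetting the action of the variable on `aevalFunctor τ` gives back `F`. -/
noncomputable def aevalFunctorIso :
    aevalFunctor τ ⋙ ModuleCat.restrictScalars.{u} (Polynomial.C : k →+* k[X]) ≅ F :=
  NatIso.ofComponents
    (fun M =>
      { hom := ModuleCat.ofHom
          (X := (aevalFunctor τ ⋙ ModuleCat.restrictScalars.{u} (Polynomial.C : k →+* k[X])).obj M)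
          (Y := F.obj M)
          { toFun := fun z => (Module.AEval'.of (τ.app M).hom).symm z
            map_add' := fun _ _ => rfl
            map_smul' := fun c z => Module.AEval'.of_symm_C_smul (τ.app M).hom c z }
        inv := ModuleCat.ofHom (X := F.obj M)
          (Y := (aevalFunctor τ ⋙ ModuleCat.restrictScalars.{u} (Polynomial.C : k →+* k[X])).obj M)
          { toFun := fun z => Module.AEval'.of (τ.app M).hom z
            map_add' := fun _ _ => rfl
            map_smul' := fun c z => (Module.AEval.C_smul (R := k) (τ.app M).hom c
              (Module.AEval'.of (τ.app M).hom z)).symm }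
        hom_inv_id := ModuleCat.hom_ext (LinearMap.ext fun _ => rfl)
        inv_hom_id := ModuleCat.hom_ext (LinearMap.ext fun _ => rfl) })
    fun _ => ModuleCat.hom_ext (LinearMap.ext fun _ => rfl)

theorem whiskerRight_comp_aevalFunctorIso :
    Functor.whiskerRight ((X : k[X]) • 𝟙 (aevalFunctor τ))
      (ModuleCat.restrictScalars.{u} (Polynomial.C : k →+* k[X])) ≫ (aevalFunctorIso τ).hom =
    (aevalFunctorIso τ).hom ≫ τ := by
  ext M z
  have h (z : Module.AEval' (τ.app M).hom) :
      (((X : k[X]) • 𝟙 (aevalFunctor τ)).app M).hom z = ((X : k[X]) • z) := rfl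
  exact (congrArg (Module.AEval'.of (τ.app M).hom).symm (h z)).trans
    (Module.AEval'.of_symm_X_smul (τ.app M).hom z)

end AevalFunctor

section AevalFunctorDerived

open Polynomial Limits

variable {C : Type*} [Category* C] [Abelian C] [EnoughProjectives C] {k : Type u} [Field k]
  {F : C ⥤ ModuleCat.{u} k} [F.Additive] (τ : F ⟶ F)

theorem homologyFunctor_map_smul_id {D : Type u} [CommRing D] (x : D)
    (K : ChainComplex (ModuleCat.{u} D) ℕ) (i : ℕ) :
    (HomologicalComplex.homologyFunctor (ModuleCat.{u} D) (ComplexShape.down ℕ) i).map (x • 𝟙 K) =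
      x • 𝟙 _ := by
  refine (ShortComplex.homologyMap_smul (a := x)
    (φ := 𝟙 (K.sc i))).trans ?_
  rw [ShortComplex.homologyMap_id]
  rfl

theorem leftDerived_smul_id {D : Type u} [CommRing D] (G : C ⥤ ModuleCat.{u} D) [G.Additive]
    (x : D) (i : ℕ) (M : C) :
    (NatTrans.leftDerived (x • 𝟙 G) i).app M = x • 𝟙 ((G.leftDerived i).obj M) := by
  have h : (NatTrans.mapHomologicalComplex (x • 𝟙 G) (ComplexShape.down ℕ)).app
      (projectiveResolution M).complex =
      x • 𝟙 ((G.mapHomologicalComplex (ComplexShape.down ℕ)).obj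
        (projectiveResolution M).complex) := by
    ext n : 1
    rfl
  rw [(projectiveResolution M).leftDerived_app_eq, h, homologyFunctor_map_smul_id,
    Linear.smul_comp, Category.id_comp, Linear.comp_smul, Iso.hom_inv_id]

/-- Deriving `aevalFunctor τ` amounts to deriving `F` and `τ`. -/
theorem nonempty_leftDerived_aevalFunctor (i : ℕ) (M : C) :
    Nonempty (Module.AEval' ((NatTrans.leftDerived τ i).app M).hom ≃ₗ[k[X]]
      ((aevalFunctor τ).leftDerived i).obj M) := by
  let G := ModuleCat.restrictScalars.{u} (Polynomial.C : k →+* k[X])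
  obtain ⟨j, hj⟩ := exists_iso_leftDerived_comp (aevalFunctor τ) G i M
  let α := aevalFunctorIso τ
  let E := (leftDerivedIsoOfIso α i M).symm ≪≫ j
  have hE : (NatTrans.leftDerived τ i).app M ≫ E.hom =
      E.hom ≫ G.map ((X : k[X]) • 𝟙 (((aevalFunctor τ).leftDerived i).obj M)) := by
    have h1 : τ ≫ α.inv = α.inv ≫ Functor.whiskerRight ((X : k[X]) • 𝟙 (aevalFunctor τ)) G := by
      rw [Iso.eq_inv_comp, ← Category.assoc, ← whiskerRight_comp_aevalFunctorIso, Category.assoc,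
        Iso.hom_inv_id, Category.comp_id]
    change _ ≫ (NatTrans.leftDerived α.inv i).app M ≫ j.hom =
      ((NatTrans.leftDerived α.inv i).app M ≫ j.hom) ≫ _
    rw [← leftDerived_smul_id, Category.assoc, ← hj, ← NatTrans.comp_app_assoc,
      ← NatTrans.comp_app_assoc, ← NatTrans.leftDerived_comp, ← NatTrans.leftDerived_comp, h1]
  let _ : Module k (((aevalFunctor τ).leftDerived i).obj M) :=
    Module.compHom _ (Polynomial.C : k →+* k[X])
  have : IsScalarTower k k[X] (((aevalFunctor τ).leftDerived i).obj M) :=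
    ⟨fun a p z => by rw [Polynomial.smul_eq_C_mul, mul_smul]; rfl⟩
  let E' : (F.leftDerived i).obj M ≃ₗ[k] ((aevalFunctor τ).leftDerived i).obj M := E.toLinearEquiv
  exact ⟨LinearEquiv.ofAEval _ E' fun m =>
    LinearMap.congr_fun (congrArg ModuleCat.Hom.hom hE) m⟩

end AevalFunctorDerived

/-! ### The action of the variable on Tor -/

theorem Module.AEval'.nonempty_linearEquiv {k V W : Type*} [Field k] [AddCommGroup V] [Module k V]
    [AddCommGroup W] [Module k W] {f : V →ₗ[k] V} {g : W →ₗ[k] W} (e : V ≃ₗ[k] W)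
    (h : ∀ v, e (f v) = g (e v)) :
    Nonempty (Module.AEval' f ≃ₗ[Polynomial k] Module.AEval' g) :=
  ⟨LinearEquiv.ofAEval f (e.trans (Module.AEval'.of g)) fun v =>
    (congrArg (Module.AEval'.of g) (h v)).trans (Module.AEval'.X_smul_of g (e v)).symm⟩

section FiberPoly

open TwistedPolynomial IsLocalRing MonoidalCategory

variable {A : Type u} [CommRing A] [IsLocalRing A] {φ : A →+* A} (k : Type u) [Field k]
  [Algebra k A]

/-- Multiplication by `X` on `κ ⊗_A M`, seen as a `k`-vector space. -/
noncomputable abbrev fiberXVect (hφ : ∀ a, residue A (φ a) = residue A a) :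
    fiber φ ⋙ ModuleCat.restrictScalars (algebraMap k A) ⟶
      fiber φ ⋙ ModuleCat.restrictScalars (algebraMap k A) :=
  Functor.whiskerRight (fiberXNat hφ) (ModuleCat.restrictScalars (algebraMap k A))

/-- The functor `M ↦ κ ⊗_A M` from `A[X]_φ`-modules to `k[X]`-modules. -/
noncomputable abbrev fiberPoly (hφ : ∀ a, residue A (φ a) = residue A a) :
    ModuleCat.{u} (TwistedPolynomial φ) ⥤ ModuleCat.{u} (Polynomial k) :=
  aevalFunctor (fiberXVect k hφ)

/-- The `k[X]`-modules `Tor_i^A(κ, M)` are the derived functors of `M ↦ κ ⊗_A M` with values in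
`k[X]`-modules. -/
theorem nonempty_torModule_equiv (hφ : ∀ a, residue A (φ a) = residue A a) (i : ℕ)
    (M : ModuleCat.{u} (TwistedPolynomial φ)) :
    Nonempty (torModule k hφ i M ≃ₗ[Polynomial k] ((fiberPoly k hφ).leftDerived i).obj M) := by
  let G := ModuleCat.restrictScalars.{u} (algebraMap k A)
  obtain ⟨j, hj⟩ := exists_iso_leftDerived_comp (fiber φ) G i M
  obtain ⟨E⟩ := nonempty_leftDerived_aevalFunctor (fiberXVect k hφ) i M
  let e := G.mapIso (derivedFiberIso i M).symm ≪≫ j.symm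
  have he : G.map (torX hφ i M) ≫ e.hom =
      e.hom ≫ (NatTrans.leftDerived (fiberXVect k hφ) i).app M := by
    have hj' : j.inv ≫ (NatTrans.leftDerived (fiberXVect k hφ) i).app M =
        G.map ((NatTrans.leftDerived (fiberXNat hφ) i).app M) ≫ j.inv := by
      rw [Iso.inv_comp_eq, ← Category.assoc, ← hj, Category.assoc, Iso.hom_inv_id,
        Category.comp_id]
    change G.map (torX hφ i M) ≫ G.map (derivedFiberIso i M).inv ≫ j.inv =
      (G.map (derivedFiberIso i M).inv ≫ j.inv) ≫ _
    rw [Category.assoc, hj', ← Functor.map_comp_assoc, ← Functor.map_comp_assoc, torX]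
    simp only [Category.assoc, Iso.hom_inv_id, Category.comp_id]
  obtain ⟨E'⟩ := Module.AEval'.nonempty_linearEquiv (f := (G.map (torX hφ i M)).hom)
    (g := ((NatTrans.leftDerived (fiberXVect k hφ) i).app M).hom) e.toLinearEquiv fun v =>
    LinearMap.congr_fun (congrArg ModuleCat.Hom.hom he) v
  exact ⟨E'.trans E⟩

theorem subsingleton_torModule {d : ℕ} (e : A ≃ₐ[k] MvPowerSeries (Fin d) k)
    (hφ : ∀ a, residue A (φ a) = residue A a) {i : ℕ} (hi : d < i)
    (M : ModuleCat.{u} (TwistedPolynomial φ)) : Subsingleton (torModule k hφ i M) := by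
  obtain ⟨j, -⟩ := exists_iso_leftDerived_comp
    ((tensoringLeft (ModuleCat.{u} A)).obj (residueModule A))
    (ModuleCat.restrictScalars.{u} (algebraMap k A)) i ((restrict φ).obj M)
  have h := ModuleCat.subsingleton_of_isZero
    ((isZero_leftDerived_residue e ((restrict φ).obj M) hi).of_iso j.symm)
  exact h

end FiberPoly

section PolyExtension

open scoped TensorProduct

variable (k : Type u) [Field k]

/-- The functor `V ↦ k[X] ⊗_k V`. -/
noncomputable def polyExtension : ModuleCat.{u} k ⥤ ModuleCat.{u} (Polynomial k) where
  obj V := ModuleCat.of (Polynomial k) (Polynomial k ⊗[k] V)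
  map f := ModuleCat.ofHom (f.hom.baseChange (Polynomial k))
  map_id _ := ModuleCat.hom_ext (LinearMap.baseChange_id ..)
  map_comp _ _ := ModuleCat.hom_ext (LinearMap.baseChange_comp ..)

instance : (polyExtension k).Additive where
  map_add := ModuleCat.hom_ext (LinearMap.baseChange_add ..)

instance : (polyExtension k).PreservesHomology := by
  have key : ∀ S : ShortComplex (ModuleCat.{u} k), S.Exact → (S.map (polyExtension k)).Exact :=
    fun S h => by
      rw [ShortComplex.ShortExact.moduleCat_exact_iff_function_exact] at h ⊢
      exact Module.Flat.lTensor_exact (Polynomial k) h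
  have h' : (∀ S : ShortComplex (ModuleCat.{u} k), S.Exact → (S.map (polyExtension k)).Exact) ↔
      (polyExtension k).PreservesHomology := (Functor.exact_tfae (polyExtension k)).out 1 2
  exact h'.1 key

end PolyExtension

/-! ### The fiber of an induced module -/

section FiberInduced

open TwistedPolynomial IsLocalRing MonoidalCategory

open scoped TensorProduct

attribute [local instance] rightModule smulCommClass_right

variable {A : Type u} [CommRing A] [IsLocalRing A] {φ : A →+* A} (k : Type u) [Field k]
  [Algebra k A]

theorem residue_pow (hφ : ∀ a, residue A (φ a) = residue A a) (n : ℕ) (a : A) :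
    residue A ((φ ^ n) a) = residue A a := by
  induction n generalizing a with
  | zero => rfl
  | succ n ih => rw [pow_succ, RingHom.mul_def, RingHom.comp_apply, ih, hφ]

theorem smul_eq_smul_of_residue_eq {a b : A} (h : residue A a = residue A b)
    (c : ResidueField A) : a • c = b • c := by
  rw [Algebra.smul_def, Algebra.smul_def]
  exact congrArg (· * c) h

/-- The pure tensor `c ⊗ n`, as an element of the vector space `κ ⊗_A N` over `k`. -/
noncomputable def fiberTmul (N : ModuleCat.{u} A) :
    ResidueField A →+ N →+ (tensorFunctor k (residueModule A)).obj N :=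
  AddMonoidHom.mk' (fun c => AddMonoidHom.mk' (fun m => (c ⊗ₜ[A] m : ResidueField A ⊗[A] N))
    (TensorProduct.tmul_add c)) fun c c' => AddMonoidHom.ext (TensorProduct.add_tmul c c')

theorem fiberTmul_smul (N : ModuleCat.{u} A) (a : A) (c : ResidueField A) (m : N) :
    fiberTmul k N (a • c) m = fiberTmul k N c (a • m) :=
  TensorProduct.smul_tmul a c m

/-- The biadditive map `(r, n) ↦ ∑ Xⁱ ⊗ (c rᵢ ⊗ n)`, where `rᵢ` are the coefficients of `r`. -/
noncomputable def fiberCoeffLift (N : ModuleCat.{u} A) (c : ResidueField A) :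
    TwistedPolynomial φ →+ N →+ Polynomial k ⊗[k] ((tensorFunctor k (residueModule A)).obj N) :=
  liftAdd φ fun n => AddMonoidHom.mk' (fun a =>
    (TensorProduct.mk k (Polynomial k) ((tensorFunctor k (residueModule A)).obj N)
      (Polynomial.X ^ n)).toAddMonoidHom.comp (fiberTmul k N (a • c)))
    fun a b => by rw [add_smul, map_add, AddMonoidHom.comp_add]

theorem fiberCoeffLift_monomial (N : ModuleCat.{u} A) (c : ResidueField A) (n : ℕ) (a : A)
    (m : N) : fiberCoeffLift (φ := φ) k N c (monomial φ n a) m =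
      ((Polynomial.X : Polynomial k) ^ n) ⊗ₜ[k] fiberTmul k N (a • c) m := by
  rw [fiberCoeffLift, liftAdd_monomial]
  rfl

/-- The map `r ⊗ n ↦ ∑ Xⁱ ⊗ (c rᵢ ⊗ n)`, where `rᵢ` are the coefficients of `r`. -/
noncomputable def fiberCoeffAux (hφ : ∀ a, residue A (φ a) = residue A a) (N : ModuleCat.{u} A)
    (c : ResidueField A) :
    TwistedPolynomial φ ⊗[A] N →+
      Polynomial k ⊗[k] ((tensorFunctor k (residueModule A)).obj N) :=
  TensorProduct.liftAddHom (fiberCoeffLift k N c) fun b r m => by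
    have h : (((AddMonoidHom.eval m).comp (fiberCoeffLift k N c)).comp
          (AddMonoidHom.mulRight (C φ b))) =
        ((AddMonoidHom.eval (b • m)).comp (fiberCoeffLift k N c)) := addHom_ext fun n a => by
      change fiberCoeffLift k N c (monomial φ n a * C φ b) m =
        fiberCoeffLift k N c (monomial φ n a) (b • m)
      rw [monomial_mul_C, fiberCoeffLift_monomial, fiberCoeffLift_monomial, mul_smul,
        smul_eq_smul_of_residue_eq (residue_pow hφ n b), smul_comm, fiberTmul_smul]
    exact DFunLike.congr_fun h r

theorem fiberCoeffAux_monomial (hφ : ∀ a, residue A (φ a) = residue A a) (N : ModuleCat.{u} A)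
    (c : ResidueField A) (n : ℕ) (a : A) (m : N) :
    fiberCoeffAux k hφ N c (monomial φ n a ⊗ₜ m) =
      ((Polynomial.X : Polynomial k) ^ n) ⊗ₜ[k] fiberTmul k N (a • c) m :=
  fiberCoeffLift_monomial k N c n a m

/-- The map `c ⊗ (r ⊗ n) ↦ ∑ Xⁱ ⊗ (c rᵢ ⊗ n)`, where `rᵢ` are the coefficients of `r`. -/
noncomputable def fiberCoeff (hφ : ∀ a, residue A (φ a) = residue A a) (N : ModuleCat.{u} A) :
    (ResidueField A ⊗[A] (restrict φ).obj ((induced φ).obj N)) →+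
      Polynomial k ⊗[k] ((tensorFunctor k (residueModule A)).obj N) :=
  let g : ResidueField A →+ (TwistedPolynomial φ ⊗[A] N) →+
      Polynomial k ⊗[k] ((tensorFunctor k (residueModule A)).obj N) :=
    AddMonoidHom.mk' (fiberCoeffAux k hφ N) fun c c' => induced_addHom_ext fun n a m => by
      rw [AddMonoidHom.add_apply, fiberCoeffAux_monomial, fiberCoeffAux_monomial,
        fiberCoeffAux_monomial, smul_add, map_add]
      exact TensorProduct.tmul_add _ _ _
  TensorProduct.liftAddHom g fun b c z => by
    have h : fiberCoeffAux k hφ N (b • c) =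
        (fiberCoeffAux k hφ N c).comp (DistribSMul.toAddMonoidHom _ (C φ b)) :=
      induced_addHom_ext fun n a m => by
        change _ = fiberCoeffAux k hφ N c (C φ b • (monomial φ n a ⊗ₜ[A] m))
        rw [TensorProduct.smul_tmul', smul_eq_mul, C_mul_monomial, fiberCoeffAux_monomial,
          fiberCoeffAux_monomial, mul_comm, mul_smul]
    exact DFunLike.congr_fun h z

theorem fiberCoeff_tmul (hφ : ∀ a, residue A (φ a) = residue A a) (N : ModuleCat.{u} A)
    (c : ResidueField A) (n : ℕ) (m : N) :
    fiberCoeff k hφ N (c ⊗ₜ[A] ((X φ ^ n) ⊗ₜ[A] m : TwistedPolynomial φ ⊗[A] N)) =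
      ((Polynomial.X : Polynomial k) ^ n) ⊗ₜ[k] fiberTmul k N c m := by
  have h := fiberCoeffAux_monomial k hφ N c n 1 m
  rw [monomial_eq, map_one, one_mul, one_smul] at h
  exact h

end FiberInduced

section FiberInducedIso

open TwistedPolynomial IsLocalRing MonoidalCategory

open scoped TensorProduct

attribute [local instance] rightModule smulCommClass_right

variable {A : Type u} [CommRing A] [IsLocalRing A] {φ : A →+* A} (k : Type u) [Field k]
  [Algebra k A]

/-- To prove an additive property of the elements of `k[X] ⊗_k (κ ⊗_A N)`, it suffices to consider
those of the form `Xⁿ ⊗ (c ⊗ m)`. -/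
theorem polynomial_tmul_fiberTmul_induction (N : ModuleCat.{u} A)
    {motive : Polynomial k ⊗[k] ((tensorFunctor k (residueModule A)).obj N) → Prop}
    (zero : motive 0) (add : ∀ x y, motive x → motive y → motive (x + y))
    (tmul : ∀ n c m, motive (((Polynomial.X : Polynomial k) ^ n) ⊗ₜ[k] fiberTmul k N c m)) (z) :
    motive z := by
  induction z using TensorProduct.induction_on with
  | zero => exact zero
  | add x y hx hy => exact add x y hx hy
  | tmul p v =>
    induction p using Polynomial.induction_on' with
    | add p q hp hq => rw [TensorProduct.add_tmul]; exact add _ _ hp hq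
    | monomial n a =>
      have h (v : ResidueField A ⊗[A] N) : motive (((Polynomial.X : Polynomial k) ^ n) ⊗ₜ[k]
          (show (tensorFunctor k (residueModule A)).obj N from v)) := by
        induction v using TensorProduct.induction_on with
        | zero =>
          exact (congrArg motive (TensorProduct.tmul_zero
            ((tensorFunctor k (residueModule A)).obj N) (Polynomial.X ^ n))).mpr zero
        | add x y hx hy =>
          exact (congrArg motive (TensorProduct.tmul_add (R := k)
            (N := (tensorFunctor k (residueModule A)).obj N) (Polynomial.X ^ n) x y)).mpr
            (add _ _ hx hy)
        | tmul c m => exact tmul n c m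
      rw [← Polynomial.smul_X_eq_monomial, TensorProduct.smul_tmul]
      exact h _

/-- The `k[X]`-module `κ ⊗_A (A[X]_φ ⊗_A N)`. -/
noncomputable abbrev FiberInduced (hφ : ∀ a, residue A (φ a) = residue A a) (N : ModuleCat.{u} A) :
    Type u :=
  Module.AEval' ((fiberXVect k hφ).app ((induced φ).obj N)).hom

/-- The element `c ⊗ (r ⊗ n)` of `κ ⊗_A (A[X]_φ ⊗_A N)`. -/
noncomputable def FiberInduced.tmul (hφ : ∀ a, residue A (φ a) = residue A a) {N : ModuleCat.{u} A}
    (c : ResidueField A) (z : TwistedPolynomial φ ⊗[A] N) : FiberInduced k hφ N :=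
  Module.AEval'.of ((fiberXVect k hφ).app ((induced φ).obj N)).hom
    (c ⊗ₜ[A] z : ResidueField A ⊗[A] (restrict φ).obj ((induced φ).obj N))

theorem FiberInduced.X_smul_tmul (hφ : ∀ a, residue A (φ a) = residue A a) {N : ModuleCat.{u} A}
    (c : ResidueField A) (z : TwistedPolynomial φ ⊗[A] N) :
    (Polynomial.X : Polynomial k) • FiberInduced.tmul k hφ c z =
      FiberInduced.tmul k hφ c (X φ • z) :=
  Module.AEval'.X_smul_of _ _

/-- The `k`-linear map `κ ⊗_A N → κ ⊗_A (A[X]_φ ⊗_A N)`, `c ⊗ n ↦ c ⊗ (1 ⊗ n)`. -/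
noncomputable def fiberUnit (hφ : ∀ a, residue A (φ a) = residue A a) (N : ModuleCat.{u} A) :
    (tensorFunctor k (residueModule A)).obj N →ₗ[k] FiberInduced k hφ N :=
  (Module.AEval'.of ((fiberXVect k hφ).app ((induced φ).obj N)).hom).toLinearMap ∘ₗ
    ((tensorFunctor k (residueModule A)).map (ModuleCat.ofHom
      (Y := (restrict φ).obj ((induced φ).obj N)) (inducedUnit φ N))).hom

theorem fiberUnit_fiberTmul (hφ : ∀ a, residue A (φ a) = residue A a) (N : ModuleCat.{u} A)
    (c : ResidueField A) (m : N) :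
    fiberUnit k hφ N (fiberTmul k N c m) = FiberInduced.tmul k hφ c (1 ⊗ₜ m) := rfl

/-- The canonical map `k[X] ⊗_k (κ ⊗_A N) → κ ⊗_A (A[X]_φ ⊗_A N)`. -/
noncomputable def fiberInducedMap (hφ : ∀ a, residue A (φ a) = residue A a) (N : ModuleCat.{u} A) :
    Polynomial k ⊗[k] ((tensorFunctor k (residueModule A)).obj N) →ₗ[Polynomial k]
      FiberInduced k hφ N :=
  LinearMap.liftBaseChange (Polynomial k) (fiberUnit k hφ N)

theorem fiberInducedMap_tmul (hφ : ∀ a, residue A (φ a) = residue A a) (N : ModuleCat.{u} A)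
    (n : ℕ) (c : ResidueField A) (m : N) :
    fiberInducedMap k hφ N (((Polynomial.X : Polynomial k) ^ n) ⊗ₜ[k] fiberTmul k N c m) =
      FiberInduced.tmul k hφ c ((X φ ^ n) ⊗ₜ m) := by
  rw [fiberInducedMap, LinearMap.liftBaseChange_tmul, fiberUnit_fiberTmul]
  induction n with
  | zero => rw [pow_zero, one_smul, pow_zero]
  | succ n ih =>
    rw [pow_succ', mul_smul, ih, FiberInduced.X_smul_tmul, TensorProduct.smul_tmul', smul_eq_mul,
      ← pow_succ']

theorem fiberInducedMap_injective (hφ : ∀ a, residue A (φ a) = residue A a)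
    (N : ModuleCat.{u} A) : Function.Injective (fiberInducedMap k hφ N) := by
  let ρ : FiberInduced k hφ N →+ Polynomial k ⊗[k] ((tensorFunctor k (residueModule A)).obj N) :=
    (fiberCoeff k hφ N).comp
      (Module.AEval'.of ((fiberXVect k hφ).app ((induced φ).obj N)).hom).symm.toAddMonoidHom
  refine Function.LeftInverse.injective (g := ρ) fun z => ?_
  induction z using polynomial_tmul_fiberTmul_induction with
  | zero => rw [map_zero, map_zero]
  | add x y hx hy => rw [map_add, map_add, hx, hy]
  | tmul n c m =>
    rw [fiberInducedMap_tmul]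
    exact fiberCoeff_tmul k hφ N c n m

theorem fiberInducedMap_surjective (hφ : ∀ a, residue A (φ a) = residue A a)
    (N : ModuleCat.{u} A) : Function.Surjective (fiberInducedMap k hφ N) := by
  rw [← LinearMap.range_eq_top, eq_top_iff]
  have h0 (c : ResidueField A) (n : ℕ) (m : N) :
      FiberInduced.tmul k hφ c ((X φ ^ n) ⊗ₜ m) ∈ LinearMap.range (fiberInducedMap k hφ N) :=
    ⟨_, fiberInducedMap_tmul k hφ N n c m⟩
  have h1 (c : ResidueField A) (z : TwistedPolynomial φ ⊗[A] N) :
      FiberInduced.tmul k hφ c z ∈ LinearMap.range (fiberInducedMap k hφ N) := by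
    let f : TwistedPolynomial φ ⊗[A] N →+
        FiberInduced k hφ N ⧸ LinearMap.range (fiberInducedMap k hφ N) :=
      (Submodule.mkQ _).toAddMonoidHom.comp (AddMonoidHom.mk' (FiberInduced.tmul k hφ c)
        fun z z' => congrArg _ (TensorProduct.tmul_add (R := A)
          (N := (restrict φ).obj ((induced φ).obj N)) c z z'))
    have hf : f = 0 := induced_addHom_ext fun n a m => by
      refine (Submodule.Quotient.mk_eq_zero _).2 ?_
      have : FiberInduced.tmul k hφ c (monomial φ n a ⊗ₜ m) =
          FiberInduced.tmul k hφ (a • c) ((X φ ^ n) ⊗ₜ m) := by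
        rw [monomial_eq, ← smul_eq_mul, ← TensorProduct.smul_tmul']
        exact congrArg _ (TensorProduct.smul_tmul (R := A)
          (N := (restrict φ).obj ((induced φ).obj N)) a c _).symm
      change FiberInduced.tmul k hφ c (monomial φ n a ⊗ₜ m) ∈ _
      rw [this]
      exact h0 _ _ _
    exact (Submodule.Quotient.mk_eq_zero _).1 (DFunLike.congr_fun hf z)
  rintro w -
  obtain ⟨w, rfl⟩ : ∃ w' : ResidueField A ⊗[A] (restrict φ).obj ((induced φ).obj N),
    Module.AEval'.of ((fiberXVect k hφ).app ((induced φ).obj N)).hom w' = w := ⟨w, rfl⟩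
  induction w using TensorProduct.induction_on with
  | zero => exact zero_mem _
  | add x y hx hy => exact add_mem hx hy
  | tmul c z => exact h1 c z

theorem fiberInducedMap_naturality (hφ : ∀ a, residue A (φ a) = residue A a)
    {N N' : ModuleCat.{u} A} (f : N ⟶ N') :
    ((tensorFunctor k (residueModule A)) ⋙ polyExtension k).map f ≫
      ModuleCat.ofHom (fiberInducedMap k hφ N') =
    ModuleCat.ofHom (fiberInducedMap k hφ N) ≫ (induced φ ⋙ fiberPoly k hφ).map f := by
  refine ModuleCat.hom_ext (LinearMap.ext fun z => ?_)
  induction z using polynomial_tmul_fiberTmul_induction with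
  | zero => exact (map_zero _).trans (map_zero _).symm
  | add x y hx hy => exact (map_add _ _ _).trans ((congrArg₂ _ hx hy).trans (map_add _ _ _).symm)
  | tmul n c m =>
    have h1 : ((tensorFunctor k (residueModule A)) ⋙ polyExtension k).map f
        (((Polynomial.X : Polynomial k) ^ n) ⊗ₜ[k] fiberTmul k N c m) =
        ((Polynomial.X : Polynomial k) ^ n) ⊗ₜ[k] fiberTmul k N' c (f.hom m) := rfl
    have h2 : (induced φ ⋙ fiberPoly k hφ).map f (FiberInduced.tmul k hφ c ((X φ ^ n) ⊗ₜ m)) =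
        FiberInduced.tmul k hφ c (inducedMap φ f.hom ((X φ ^ n) ⊗ₜ m)) := rfl
    refine (congrArg (fiberInducedMap k hφ N') h1).trans ?_
    refine (fiberInducedMap_tmul k hφ N' n c (f.hom m)).trans ?_
    refine Eq.trans ?_ (congrArg ((induced φ ⋙ fiberPoly k hφ).map f).hom
      (fiberInducedMap_tmul k hφ N n c m)).symm
    refine Eq.trans ?_ h2.symm
    rw [inducedMap_tmul]

/-- For an induced module, `κ ⊗_A (A[X]_φ ⊗_A N)` is `k[X] ⊗_k (κ ⊗_A N)`. -/
noncomputable def fiberInducedIso (hφ : ∀ a, residue A (φ a) = residue A a) :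
    tensorFunctor k (residueModule A) ⋙ polyExtension k ≅ induced φ ⋙ fiberPoly k hφ :=
  NatIso.ofComponents
    (fun N => (LinearEquiv.ofBijective (fiberInducedMap k hφ N)
      ⟨fiberInducedMap_injective k hφ N, fiberInducedMap_surjective k hφ N⟩).toModuleIso)
    (fiberInducedMap_naturality k hφ)

/-- The induced modules of a projective resolution of `N` resolve `A[X]_φ ⊗_A N`, so that
`Tor_i^A(κ, A[X]_φ ⊗_A N) = k[X] ⊗_k Tor_i^A(κ, N)`. -/
theorem nonempty_leftDerived_fiberPoly_induced (hflat : Module.Flat A (FrobTwist φ))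
    (hφ : ∀ a, residue A (φ a) = residue A a) (N : ModuleCat.{u} A) (i : ℕ) :
    Nonempty (((fiberPoly k hφ).leftDerived i).obj ((induced φ).obj N) ≅
      (polyExtension k).obj (((tensorFunctor k (residueModule A)).leftDerived i).obj N)) := by
  have := preservesHomology_induced φ hflat
  obtain ⟨j, -⟩ := exists_iso_leftDerived_comp (tensorFunctor k (residueModule A))
    (polyExtension k) i N
  let P := projectiveResolution N
  let e₁ : ((induced φ ⋙ fiberPoly k hφ).leftDerived i).obj N ≅
      ((fiberPoly k hφ).leftDerived i).obj ((induced φ).obj N) :=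
    P.isoLeftDerivedObj (induced φ ⋙ fiberPoly k hφ) i ≪≫
      (((induced φ).mapProjectiveResolution P).isoLeftDerivedObj (fiberPoly k hφ) i).symm
  exact ⟨e₁.symm ≪≫ (leftDerivedIsoOfIso (fiberInducedIso k hφ) i N).symm ≪≫ j⟩

end FiberInducedIso

section InducedEuler

open TwistedPolynomial IsLocalRing

variable {A : Type u} [CommRing A] [IsLocalRing A] {φ : A →+* A} {k : Type u} [Field k]
  [Algebra k A] {d : ℕ}

theorem finite_leftDerived_fiberPoly_induced (e : A ≃ₐ[k] MvPowerSeries (Fin d) k)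
    (hflat : Module.Flat A (FrobTwist φ)) (hφ : ∀ a, residue A (φ a) = residue A a)
    (N : ModuleCat.{u} A)
    (hN : Module.Finite k ((ModuleCat.restrictScalars (algebraMap k A)).obj N)) (i : ℕ) :
    Module.Finite (Polynomial k) (((fiberPoly k hφ).leftDerived i).obj ((induced φ).obj N)) := by
  have := finite_leftDerived_residue e N hN i
  exact ModuleCat.finite_of_iso (nonempty_leftDerived_fiberPoly_induced k hflat hφ N i).some.symm
    (Module.Finite.base_change k (Polynomial k) _)

theorem altRank_leftDerived_fiberPoly_induced (e : A ≃ₐ[k] MvPowerSeries (Fin d) k) (hd : 1 ≤ d)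
    (hflat : Module.Flat A (FrobTwist φ)) (hφ : ∀ a, residue A (φ a) = residue A a)
    (N : ModuleCat.{u} A)
    (hN : Module.Finite k ((ModuleCat.restrictScalars (algebraMap k A)).obj N)) {n : ℕ}
    (hn : d < n) :
    altRank (Polynomial k)
      (fun i => ((fiberPoly k hφ).leftDerived i).obj ((induced φ).obj N)) n = 0 := by
  rw [← altRank_leftDerived_residue e hd N hN hn]
  exact altRank_congr (fun i =>
    (nonempty_leftDerived_fiberPoly_induced k hflat hφ N i).some.toLinearEquiv.finrank_eq.trans
      (Module.finrank_baseChange ..)) n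

end InducedEuler

/-! ### The grading of an induced module -/

namespace TwistedPolynomial

section Grading

attribute [local instance] rightModule smulCommClass_right

open scoped TensorProduct

variable {A : Type u} [CommRing A] (φ : A →+* A)

theorem monomial_mul_monomial (m n : ℕ) (a b : A) :
    monomial φ m a * monomial φ n b = monomial φ (m + n) (a * (φ ^ m) b) := by
  rw [monomial_eq φ n, ← mul_assoc, monomial_mul_C, monomial_eq, monomial_eq, mul_assoc, pow_add]

variable {N : Type u} [AddCommGroup N] [Module A N]

/-- The projection of `A[X]_φ ⊗_A N` onto its component of degree `i`. -/
noncomputable def gradedProj (N : Type u) [AddCommGroup N] [Module A N] (i : ℕ) :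
    TwistedPolynomial φ ⊗[A] N →+ TwistedPolynomial φ ⊗[A] N :=
  ((proj φ i).rTensor N).toAddMonoidHom

theorem gradedProj_tmul (i : ℕ) (r : TwistedPolynomial φ) (m : N) :
    gradedProj φ N i (r ⊗ₜ m) = proj φ i r ⊗ₜ m := rfl

theorem gradedProj_monomial_tmul (i n : ℕ) (a : A) (m : N) :
    gradedProj φ N i (monomial φ n a ⊗ₜ m) = if n = i then monomial φ n a ⊗ₜ m else 0 := by
  rw [gradedProj_tmul, proj_monomial]
  split_ifs
  · rfl
  · exact TensorProduct.zero_tmul _ _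

theorem exists_eq_sum_gradedProj (z : TwistedPolynomial φ ⊗[A] N) :
    ∃ n : ℕ, ∀ m, n ≤ m → z = ∑ i ∈ Finset.range m, gradedProj φ N i z := by
  induction z using TensorProduct.induction_on with
  | zero => exact ⟨0, fun m _ => by simp⟩
  | add x y hx hy =>
    obtain ⟨n₁, h₁⟩ := hx
    obtain ⟨n₂, h₂⟩ := hy
    refine ⟨max n₁ n₂, fun m hm => ?_⟩
    simp only [map_add, Finset.sum_add_distrib]
    rw [← h₁ m (le_of_max_le_left hm), ← h₂ m (le_of_max_le_right hm)]
  | tmul r x =>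
    obtain ⟨n, h⟩ := exists_eq_sum_proj φ r
    refine ⟨n, fun m hm => ?_⟩
    simp only [gradedProj_tmul]
    rw [← TensorProduct.sum_tmul, ← h m hm]

theorem exists_gradedProj_eq_zero (z : TwistedPolynomial φ ⊗[A] N) :
    ∃ n : ℕ, ∀ m, n ≤ m → gradedProj φ N m z = 0 := by
  obtain ⟨n, h⟩ := exists_eq_sum_gradedProj φ z
  refine ⟨n, fun m hm => ?_⟩
  have h' := h (m + 1) (Nat.le_succ_of_le hm)
  rw [Finset.sum_range_succ, ← h m hm] at h'
  exact left_eq_add.1 h'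

theorem eq_zero_of_gradedProj {z : TwistedPolynomial φ ⊗[A] N}
    (h : ∀ i, gradedProj φ N i z = 0) : z = 0 := by
  obtain ⟨n, hn⟩ := exists_eq_sum_gradedProj φ z
  rw [hn n le_rfl]
  exact Finset.sum_eq_zero fun i _ => h i

theorem gradedProj_C_smul (i : ℕ) (a : A) (z : TwistedPolynomial φ ⊗[A] N) :
    gradedProj φ N i (C φ a • z) = C φ a • gradedProj φ N i z := by
  have : (gradedProj φ N i).comp (DistribSMul.toAddMonoidHom _ (C φ a)) =
      (DistribSMul.toAddMonoidHom _ (C φ a)).comp (gradedProj φ N i) :=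
    induced_addHom_ext fun n b m => by
      change gradedProj φ N i (C φ a • (monomial φ n b ⊗ₜ m)) =
        C φ a • gradedProj φ N i (monomial φ n b ⊗ₜ m)
      rw [TensorProduct.smul_tmul', smul_eq_mul, C_mul_monomial, gradedProj_monomial_tmul,
        gradedProj_monomial_tmul]
      split_ifs
      · rw [TensorProduct.smul_tmul', smul_eq_mul, C_mul_monomial]
      · rw [smul_zero]
  exact DFunLike.congr_fun this z

theorem gradedProj_inducedMap {N' : Type u} [AddCommGroup N'] [Module A N'] (f : N →ₗ[A] N')
    (i : ℕ) (z : TwistedPolynomial φ ⊗[A] N) :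
    gradedProj φ N' i (inducedMap φ f z) = inducedMap φ f (gradedProj φ N i z) := by
  induction z using TensorProduct.induction_on with
  | zero => simp only [map_zero]
  | add x y hx hy => simp only [map_add, hx, hy]
  | tmul r m => rw [gradedProj_tmul, inducedMap_tmul, inducedMap_tmul, gradedProj_tmul]

/-- Multiplication by an element of degree one raises the degree by one. -/
theorem gradedProj_succ_smul (i : ℕ) (r : TwistedPolynomial φ) (z : TwistedPolynomial φ ⊗[A] N) :
    gradedProj φ N (i + 1) (r • gradedProj φ N 1 z) = proj φ i r • gradedProj φ N 1 z := by
  have (n : ℕ) (a b : A) (m : N) (l : ℕ) :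
      gradedProj φ N (i + 1) (monomial φ n a • gradedProj φ N 1 (monomial φ l b ⊗ₜ m)) =
        proj φ i (monomial φ n a) • gradedProj φ N 1 (monomial φ l b ⊗ₜ m) := by
    rw [gradedProj_monomial_tmul]
    split_ifs with h
    · subst h
      rw [TensorProduct.smul_tmul', TensorProduct.smul_tmul', smul_eq_mul, smul_eq_mul,
        monomial_mul_monomial, gradedProj_monomial_tmul, proj_monomial]
      by_cases hn : n = i
      · rw [if_pos hn, if_pos (by rw [hn]), monomial_mul_monomial]
      · rw [if_neg hn, if_neg (by omega), zero_mul, TensorProduct.zero_tmul]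
    · rw [smul_zero, smul_zero, map_zero]
  have h2 (n : ℕ) (a : A) : ((gradedProj φ N (i + 1)).comp
      (DistribSMul.toAddMonoidHom _ (monomial φ n a))).comp (gradedProj φ N 1) =
      (DistribSMul.toAddMonoidHom _ (proj φ i (monomial φ n a))).comp (gradedProj φ N 1) :=
    induced_addHom_ext fun l b m => this n a b m l
  have h3 : (gradedProj φ N (i + 1)).comp
      ((AddMonoidHom.smul : TwistedPolynomial φ →+ _).flip (gradedProj φ N 1 z)) =
      ((AddMonoidHom.smul : TwistedPolynomial φ →+ _).flip (gradedProj φ N 1 z)).comp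
        (proj φ i).toAddMonoidHom :=
    addHom_ext fun n a => DFunLike.congr_fun (h2 n a) z
  exact DFunLike.congr_fun h3 r

/-- The map `A[X]_φ ⊗_A N → A[X]_φ ⊗_A (A[X]_φ ⊗_A N)`, `r X ⊗ n ↦ r ⊗ (X ⊗ n)`. -/
noncomputable def unmulX (N : Type u) [AddCommGroup N] [Module A N] :
    TwistedPolynomial φ ⊗[A] N →+ TwistedPolynomial φ ⊗[A]
      (restrict φ).obj (ModuleCat.of (TwistedPolynomial φ) (TwistedPolynomial φ ⊗[A] N)) :=
  TensorProduct.liftAddHom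
    (AddMonoidHom.mk' (fun r => AddMonoidHom.mk' (fun m => divX φ r ⊗ₜ[A]
      (show (restrict φ).obj (ModuleCat.of (TwistedPolynomial φ) (TwistedPolynomial φ ⊗[A] N)) from
        X φ ⊗ₜ[A] m)) fun m m' => by
          rw [TensorProduct.tmul_add]; exact TensorProduct.tmul_add _ _ _) fun r s => by
      ext m
      exact (congrArg (· ⊗ₜ[A] _) (map_add _ _ _)).trans (TensorProduct.add_tmul _ _ _))
    fun a r m => by
      change divX φ (r * C φ a) ⊗ₜ[A] _ = _
      rw [divX_mul_C]
      refine (TensorProduct.smul_tmul (R := A) (φ a) (divX φ r) _).trans (congrArg _ ?_)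
      change C φ (φ a) • (X φ ⊗ₜ[A] m) = X φ ⊗ₜ[A] (a • m)
      rw [TensorProduct.smul_tmul', smul_eq_mul, ← X_mul_C, ← TensorProduct.smul_tmul]
      rfl

theorem unmulX_smul_gradedProj (r : TwistedPolynomial φ) (z : TwistedPolynomial φ ⊗[A] N) :
    unmulX φ N (r • gradedProj φ N 1 z) = r ⊗ₜ[A]
      (show (restrict φ).obj (ModuleCat.of (TwistedPolynomial φ) (TwistedPolynomial φ ⊗[A] N)) from
        gradedProj φ N 1 z) := by
  have : ((unmulX φ N).comp (DistribSMul.toAddMonoidHom _ r)).comp (gradedProj φ N 1) =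
      (TensorProduct.mk A (TwistedPolynomial φ) ((restrict φ).obj
        (ModuleCat.of (TwistedPolynomial φ) (TwistedPolynomial φ ⊗[A] N))) r).toAddMonoidHom.comp
        (gradedProj φ N 1) := induced_addHom_ext fun n a m => by
    change unmulX φ N (r • gradedProj φ N 1 (monomial φ n a ⊗ₜ m)) = r ⊗ₜ[A]
      (show (restrict φ).obj (ModuleCat.of (TwistedPolynomial φ) (TwistedPolynomial φ ⊗[A] N)) from
        gradedProj φ N 1 (monomial φ n a ⊗ₜ m))
    rw [gradedProj_monomial_tmul]
    split_ifs with h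
    · subst h
      rw [monomial_eq, pow_one, TensorProduct.smul_tmul', smul_eq_mul]
      change divX φ (r * (C φ a * X φ)) ⊗ₜ[A] _ = _
      rw [divX_mul_C_mul_X]
      refine (TensorProduct.smul_tmul (R := A) a r _).trans (congrArg _ ?_)
      change C φ a • (X φ ⊗ₜ[A] m) = _
      rw [TensorProduct.smul_tmul', smul_eq_mul]
    · rw [smul_zero, map_zero]
      exact (TensorProduct.tmul_zero _ _).symm
  exact DFunLike.congr_fun this z

end Grading

end TwistedPolynomial

/-! ### Elements of degree one and the relations of a submodule -/

namespace TwistedPolynomial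

section Presentation

attribute [local instance] rightModule smulCommClass_right

open scoped TensorProduct

variable {A : Type u} [CommRing A] (φ : A →+* A)

/-- The `A`-module underlying an `A[X]_φ`-module `M`. -/
abbrev Underlying (M : Type u) [AddCommGroup M] [Module (TwistedPolynomial φ) M] : Type u :=
  (restrict φ).obj (ModuleCat.of (TwistedPolynomial φ) M)

/-- The `A`-module underlying `A[X]_φ ⊗_A N`, for the action of `A` on the left factor. -/
noncomputable abbrev inducedRestrict (N : Type u) [AddCommGroup N] [Module A N] : ModuleCat.{u} A :=
  (restrict φ).obj (ModuleCat.of (TwistedPolynomial φ) (TwistedPolynomial φ ⊗[A] N))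

section Degree

variable {N : Type u} [AddCommGroup N] [Module A N]

/-- The component of degree one of `A[X]_φ ⊗_A N`. -/
noncomputable def degreeOne (N : Type u) [AddCommGroup N] [Module A N] :
    Submodule A (inducedRestrict φ N) where
  carrier := {z | gradedProj φ N 1 z = z}
  add_mem' {x y} hx hy := by
    change gradedProj φ N 1 _ = _ at hx hy
    exact (map_add (gradedProj φ N 1) x y).trans (congrArg₂ (· + ·) hx hy)
  zero_mem' := map_zero (gradedProj φ N 1)
  smul_mem' a x hx := by
    change gradedProj φ N 1 _ = _ at hx
    exact (gradedProj_C_smul φ 1 a x).trans (congrArg (C φ a • ·) hx)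

theorem mem_degreeOne {z : inducedRestrict φ N} :
    z ∈ degreeOne φ N ↔ gradedProj φ N 1 z = z := Iff.rfl

variable {φ} {E : Submodule A (inducedRestrict φ N)}

/-- The multiplication map `r ⊗ z ↦ r z`, for `z` in a submodule of `A[X]_φ ⊗_A N`. -/
noncomputable def mulMap (E : Submodule A (inducedRestrict φ N)) :
    TwistedPolynomial φ ⊗[A] E →ₗ[TwistedPolynomial φ] TwistedPolynomial φ ⊗[A] N :=
  inducedLift φ (ModuleCat.of (TwistedPolynomial φ) (TwistedPolynomial φ ⊗[A] N)) E.subtype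

theorem mulMap_tmul (r : TwistedPolynomial φ) (z : E) :
    mulMap E (r ⊗ₜ z) = r • (show TwistedPolynomial φ ⊗[A] N from (z : inducedRestrict φ N)) := rfl

/-- The map `unmulX` recovers `r ⊗ z` from `r z` for `z` of degree one, up to the inclusion of `E`,
which stays injective after tensoring with the flat right module `A[X]_φ`. -/
theorem mulMap_injective (h : Module.Flat A (FrobTwist φ)) (hE : E ≤ degreeOne φ N) :
    Function.Injective (mulMap E) := by
  have := flat_right φ h
  have key (y : TwistedPolynomial φ ⊗[A] E) :
      unmulX φ N (mulMap E y) = E.subtype.lTensor (TwistedPolynomial φ) y := by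
    induction y using TensorProduct.induction_on with
    | zero => rw [map_zero, map_zero, map_zero]
    | add x y hx hy => rw [map_add, map_add, map_add, hx, hy]
    | tmul r z =>
      have hz := hE z.2
      rw [mem_degreeOne] at hz
      have h' := unmulX_smul_gradedProj φ r (z : inducedRestrict φ N)
      rw [hz] at h'
      exact h'
  refine Function.Injective.of_comp (f := unmulX φ N) ?_
  rw [show (unmulX φ N) ∘ (mulMap E) = E.subtype.lTensor (TwistedPolynomial φ) from funext key]
  exact Module.Flat.lTensor_preserves_injective_linearMap _ E.subtype_injective

theorem gradedProj_succ_mulMap (hE : E ≤ degreeOne φ N) (i : ℕ) (y : TwistedPolynomial φ ⊗[A] E) :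
    gradedProj φ N (i + 1) (mulMap E y) = mulMap E (gradedProj φ E i y) := by
  induction y using TensorProduct.induction_on with
  | zero => simp only [map_zero]
  | add x y hx hy => simp only [map_add, hx, hy]
  | tmul r z =>
    have hz := hE z.2
    rw [mem_degreeOne] at hz
    have h' := gradedProj_succ_smul φ i r (z : inducedRestrict φ N)
    rw [hz] at h'
    rw [gradedProj_tmul, mulMap_tmul, mulMap_tmul]
    exact h'

/-- Since the multiplication map raises the degree by one, whereas `r ⊗ z ↦ r ⊗ ν z` preserves it,
the component of highest degree of an element of the kernel vanishes. -/
theorem mulMap_sub_inducedMap_injective (h : Module.Flat A (FrobTwist φ))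
    (hE : E ≤ degreeOne φ N) (ν : E →ₗ[A] N) :
    Function.Injective (mulMap E - inducedMap φ ν) := by
  rw [injective_iff_map_eq_zero]
  intro y hy
  have hy' : mulMap E y = inducedMap φ ν y := sub_eq_zero.1 hy
  have step (i : ℕ) (hi : gradedProj φ E (i + 1) y = 0) : gradedProj φ E i y = 0 := by
    refine mulMap_injective h hE ?_
    rw [map_zero, ← gradedProj_succ_mulMap hE, hy', gradedProj_inducedMap, hi, map_zero]
  obtain ⟨n, hn⟩ := exists_gradedProj_eq_zero φ y
  refine eq_zero_of_gradedProj φ fun i => ?_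
  obtain hi | hi := le_total n i
  · exact hn i hi
  · exact Nat.decreasingInduction (motive := fun j _ => gradedProj φ E j y = 0)
      (fun j _ hj => step j hj) (hn n le_rfl) hi

end Degree

section Relations

variable {φ} {M : Type u} [AddCommGroup M] [Module (TwistedPolynomial φ) M]

/-- The map `r ⊗ m ↦ r m`, for `m` in an `A`-submodule of `M`. -/
noncomputable def actionMap (M₀ : Submodule A (Underlying φ M)) :
    TwistedPolynomial φ ⊗[A] M₀ →ₗ[TwistedPolynomial φ] M :=
  inducedLift φ (ModuleCat.of (TwistedPolynomial φ) M) M₀.subtype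

theorem actionMap_tmul (M₀ : Submodule A (Underlying φ M)) (r : TwistedPolynomial φ) (m : M₀) :
    actionMap M₀ (r ⊗ₜ m) = r • (show M from m.1) := rfl

/-- The elements of degree one of `A[X]_φ ⊗_A M₀` whose image in `M` lies in `M₀`. -/
noncomputable def relations (M₀ : Submodule A (Underlying φ M)) :
    Submodule A (inducedRestrict φ M₀) :=
  degreeOne φ M₀ ⊓ M₀.comap ((restrict φ).map (ModuleCat.ofHom (actionMap M₀))).hom

/-- The image in `M₀` of an element of `relations M₀`. -/
noncomputable def relationsMap (M₀ : Submodule A (Underlying φ M)) : relations M₀ →ₗ[A] M₀ :=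
  (((restrict φ).map (ModuleCat.ofHom (actionMap M₀))).hom ∘ₗ (relations M₀).subtype).codRestrict M₀
    fun z => z.2.2

/-- The map `r ⊗ z ↦ r z - r ⊗ μ(z)`, where `μ(z)` is the image of `z` in `M₀`. -/
noncomputable def relationsLift (M₀ : Submodule A (Underlying φ M)) :
    TwistedPolynomial φ ⊗[A] relations M₀ →ₗ[TwistedPolynomial φ] TwistedPolynomial φ ⊗[A] M₀ :=
  mulMap (relations M₀) - inducedMap φ (relationsMap M₀)

theorem actionMap_comp_relationsLift (M₀ : Submodule A (Underlying φ M)) :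
    actionMap M₀ ∘ₗ relationsLift M₀ = 0 := induced_hom_ext fun z => by
  change actionMap M₀ (mulMap (relations M₀) (1 ⊗ₜ z) -
    inducedMap φ (relationsMap M₀) (1 ⊗ₜ z)) = 0
  rw [map_sub, inducedMap_tmul, actionMap_tmul, mulMap_tmul, one_smul, one_smul]
  exact sub_self _

/-- The relation `X m = m'` in `M` lies in the image of `relationsLift`. -/
theorem X_tmul_sub_mem_range (M₀ : Submodule A (Underlying φ M)) (m m' : M₀)
    (h : (show M from m'.1) = X φ • (show M from m.1)) :
    X φ ⊗ₜ[A] m - 1 ⊗ₜ[A] m' ∈ LinearMap.range (relationsLift M₀) := by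
  have hX : X φ = monomial φ 1 1 := by rw [monomial_eq, map_one, one_mul, pow_one]
  have hz : (show inducedRestrict φ M₀ from X φ ⊗ₜ[A] m) ∈ relations M₀ := by
    refine ⟨?_, ?_⟩
    · change gradedProj φ M₀ 1 (X φ ⊗ₜ[A] m) = X φ ⊗ₜ[A] m
      rw [hX, gradedProj_monomial_tmul, if_pos rfl]
    · change X φ • (show M from m.1) ∈ M₀
      exact h ▸ m'.2
  refine ⟨1 ⊗ₜ ⟨_, hz⟩, ?_⟩
  change mulMap (relations M₀) (1 ⊗ₜ _) - inducedMap φ (relationsMap M₀) (1 ⊗ₜ _) = _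
  rw [inducedMap_tmul, mulMap_tmul, one_smul]
  refine congrArg (X φ ⊗ₜ[A] m - 1 ⊗ₜ[A] ·) (Subtype.ext ?_)
  exact h.symm

end Relations

end Presentation

end TwistedPolynomial

/-! ### Presenting a finitely presented module -/

namespace TwistedPolynomial

section FinitePresentation

open scoped TensorProduct

variable {A : Type u} [CommRing A] {φ : A →+* A}

theorem closure_monomial :
    AddSubgroup.closure {r : TwistedPolynomial φ | ∃ n a, monomial φ n a = r} = ⊤ := by
  let H := AddSubgroup.closure {r : TwistedPolynomial φ | ∃ n a, monomial φ n a = r}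
  have h : QuotientAddGroup.mk' H = 0 := addHom_ext fun n a =>
    (QuotientAddGroup.eq_zero_iff _).2 (AddSubgroup.subset_closure ⟨n, a, rfl⟩)
  exact eq_top_iff.2 fun r _ => (QuotientAddGroup.eq_zero_iff r).1 (DFunLike.congr_fun h r)

variable (φ) in
/-- The twisted polynomials of degree at most `h`. -/
noncomputable def degreeLE (h : ℕ) : AddSubgroup (TwistedPolynomial φ) :=
  AddSubgroup.closure {r | ∃ n ≤ h, ∃ a, monomial φ n a = r}

theorem degreeLE_mono {h h' : ℕ} (hh : h ≤ h') : degreeLE φ h ≤ degreeLE φ h' :=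
  AddSubgroup.closure_mono <| by
    rintro _ ⟨n, hn, a, rfl⟩
    exact ⟨n, hn.trans hh, a, rfl⟩

theorem exists_mem_degreeLE (r : TwistedPolynomial φ) : ∃ h, r ∈ degreeLE φ h := by
  have hr : r ∈ AddSubgroup.closure {r : TwistedPolynomial φ | ∃ n a, monomial φ n a = r} :=
    (closure_monomial (φ := φ)) ▸ AddSubgroup.mem_top r
  induction hr using AddSubgroup.closure_induction with
  | mem r hr =>
    obtain ⟨n, a, rfl⟩ := hr
    exact ⟨n, AddSubgroup.subset_closure ⟨n, le_rfl, a, rfl⟩⟩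
  | zero => exact ⟨0, zero_mem _⟩
  | add r s _ _ hr hs =>
    obtain ⟨h, hr⟩ := hr
    obtain ⟨h', hs⟩ := hs
    exact ⟨max h h', add_mem (degreeLE_mono (le_max_left _ _) hr)
      (degreeLE_mono (le_max_right _ _) hs)⟩
  | neg r _ hr =>
    obtain ⟨h, hr⟩ := hr
    exact ⟨h, neg_mem hr⟩

variable {M : Type u} [AddCommGroup M] [Module (TwistedPolynomial φ) M]

/-- A finitely presented module `M` is presented by the elements of a finitely generated
`A`-submodule `M₀`, subject to the relations of `M₀` and to the relations `X m = m'` for those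
`m, m'` of `M₀` for which they hold in `M`. -/
theorem exists_fg_presenting (hM : Module.FinitePresentation (TwistedPolynomial φ) M) :
    ∃ M₀ : Submodule A (Underlying φ M), M₀.FG ∧
      Submodule.span (TwistedPolynomial φ) {m : M | (show Underlying φ M from m) ∈ M₀} = ⊤ ∧
      ∀ (Q : Type u) [AddCommGroup Q] [Module (TwistedPolynomial φ) Q]
        (f : M₀ →ₗ[A] (restrict φ).obj (ModuleCat.of (TwistedPolynomial φ) Q)),
        (∀ m m' : M₀, (show M from m'.1) = X φ • (show M from m.1) →
          (show Q from f m') = X φ • (show Q from f m)) →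
        ∃ g : M →ₗ[TwistedPolynomial φ] Q, ∀ m : M₀, g (show M from m.1) = f m := by
  obtain ⟨s, hs, t, ht⟩ := hM.out
  choose deg hdeg using exists_mem_degreeLE (φ := φ)
  -- a bound for the degrees of all the coefficients of the relations
  let h := (t ×ˢ (Finset.univ : Finset s)).sup fun x => deg (x.1 x.2)
  have hbound (c : s →₀ TwistedPolynomial φ) (hc : c ∈ t) (w : s) : c w ∈ degreeLE φ h :=
    degreeLE_mono (Finset.le_sup (f := fun x : (s →₀ TwistedPolynomial φ) × s => deg (x.1 x.2))
      (b := (c, w)) (Finset.mem_product.2 ⟨hc, Finset.mem_univ w⟩)) (hdeg _)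
  -- `M₀` is generated by the `X^i w`, for the generators `w` of `M` and `i ≤ h`
  let v : ℕ × s → (restrict φ).obj (ModuleCat.of (TwistedPolynomial φ) M) :=
    fun x => (X φ ^ x.1 • (x.2 : M) : M)
  let M₀ := Submodule.span A (v '' {x | x.1 ≤ h})
  have hfin : Set.Finite {x : ℕ × s | x.1 ≤ h} :=
    ((Set.finite_Iic h).prod (Set.finite_univ (α := s))).subset fun x hx => ⟨hx, Set.mem_univ _⟩
  have hv (i : ℕ) (hi : i ≤ h) (w : s) : v (i, w) ∈ M₀ :=
    Submodule.subset_span ⟨(i, w), hi, rfl⟩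
  have hv0 (w : s) : v (0, w) = (w : M) := by
    change X φ ^ 0 • (w : M) = w
    rw [pow_zero, one_smul]
  refine ⟨M₀, Submodule.fg_span (hfin.image v), ?_, ?_⟩
  · rw [eq_top_iff, ← hs, Submodule.span_le]
    intro w hw
    refine Submodule.subset_span ?_
    have := hv 0 (Nat.zero_le _) ⟨w, hw⟩
    rw [hv0] at this
    exact this
  intro Q _ _ f hf
  let F : M₀ → Q := fun m => f m
  let w₀ (w : s) : M₀ := ⟨v (0, w), hv 0 (Nat.zero_le _) w⟩
  have hpow (i : ℕ) (hi : i ≤ h) (w : s) :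
      F ⟨v (i, w), hv i hi w⟩ = X φ ^ i • F (w₀ w) := by
    induction i with
    | zero => rw [pow_zero, one_smul]
    | succ i ih =>
      rw [pow_succ', mul_smul, ← ih (Nat.le_of_succ_le hi)]
      refine hf ⟨v (i, w), hv i (Nat.le_of_succ_le hi) w⟩ ⟨v (i + 1, w), hv (i + 1) hi w⟩ ?_
      change X φ ^ (i + 1) • (w : M) = X φ • X φ ^ i • (w : M)
      rw [pow_succ', mul_smul]
  -- the action on the generators of the polynomials of degree at most `h` takes place inside `M₀`
  have hlow (r : TwistedPolynomial φ) (hr : r ∈ degreeLE φ h) (w : s) :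
      ∃ m : M₀, (show M from m.1) = r • (w : M) ∧
        F m = r • F (w₀ w) := by
    induction hr using AddSubgroup.closure_induction with
    | mem r hr =>
      obtain ⟨i, hi, a, rfl⟩ := hr
      refine ⟨a • ⟨v (i, w), hv i hi w⟩, ?_, ?_⟩
      · rw [monomial_eq, mul_smul]
        rfl
      · rw [monomial_eq, mul_smul, ← hpow i hi]
        exact f.map_smul a _
    | zero =>
      refine ⟨0, ?_, ?_⟩
      · rw [zero_smul]; rfl
      · rw [zero_smul]; exact f.map_zero
    | add r r' _ _ h1 h2 =>
      obtain ⟨m, hm, hm'⟩ := h1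
      obtain ⟨n, hn, hn'⟩ := h2
      refine ⟨m + n, ?_, ?_⟩
      · rw [add_smul, ← hm, ← hn]; rfl
      · rw [add_smul, ← hm', ← hn']; exact f.map_add m n
    | neg r _ h1 =>
      obtain ⟨m, hm, hm'⟩ := h1
      refine ⟨-m, ?_, ?_⟩
      · rw [neg_smul, ← hm]; rfl
      · rw [neg_smul, ← hm']; exact f.map_neg m
  let l := Finsupp.linearCombination (TwistedPolynomial φ) ((↑) : s → M)
  let l' := Finsupp.linearCombination (TwistedPolynomial φ) fun w => F (w₀ w)
  have hker : LinearMap.ker l ≤ LinearMap.ker l' := by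
    rw [← ht, Submodule.span_le]
    intro c hc
    have hc0 : l c = 0 := by
      have : c ∈ LinearMap.ker l := ht ▸ Submodule.subset_span hc
      exact this
    choose m hm hm' using fun w => hlow (c w) (hbound c hc w) w
    have hl : ∑ w, c w • (w : M) = 0 := by
      exact (Finsupp.sum_fintype c (fun w a => a • (w : M)) fun _ => zero_smul _ _).symm.trans hc0
    have hl' : l' c = ∑ w, c w • F (w₀ w) := 
      Finsupp.sum_fintype c (fun w a => a • F (w₀ w)) fun _ => zero_smul _ _
    have h1 : ∑ w, m w = 0 := by
      refine Subtype.ext ?_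
      rw [Submodule.coe_sum]
      exact (Finset.sum_congr rfl fun w _ => hm w).trans hl
    have h2 : l' c = f (∑ w, m w) := by
      rw [map_sum, hl']
      exact Finset.sum_congr rfl fun w _ => (hm' w).symm
    change l' c = 0
    rw [h2, h1]
    exact f.map_zero
  have hsurj : LinearMap.range l = ⊤ := by
    rw [Finsupp.range_linearCombination, Subtype.range_coe]
    exact hs
  let g : M →ₗ[TwistedPolynomial φ] Q := (LinearMap.ker l).liftQ l' hker ∘ₗ
    (l.quotKerEquivOfSurjective (LinearMap.range_eq_top.1 hsurj)).symm.toLinearMap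
  have hg (c) : g (l c) = l' c := by
    have : (l.quotKerEquivOfSurjective (LinearMap.range_eq_top.1 hsurj)).symm (l c) =
        (LinearMap.ker l).mkQ c := by
      rw [LinearEquiv.symm_apply_eq]
      rfl
    change (LinearMap.ker l).liftQ l' hker _ = _
    erw [this]
    exact Submodule.liftQ_apply _ _ _
  have hgw (w : s) : g (w : M) = F (w₀ w) := by
    have := hg (Finsupp.single w 1)
    rw [Finsupp.linearCombination_single, Finsupp.linearCombination_single, one_smul,
      one_smul] at this
    exact this
  refine ⟨g, fun m => ?_⟩
  obtain ⟨m, hm⟩ := m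
  induction hm using Submodule.span_induction with
  | mem x hx =>
    obtain ⟨⟨i, w⟩, hi, rfl⟩ := hx
    refine Eq.trans ?_ (hpow i hi w).symm
    change g (X φ ^ i • (w : M)) = _
    rw [g.map_smul, hgw]
  | zero => exact (map_zero g).trans f.map_zero.symm
  | add x y hx hy h1 h2 =>
    exact (map_add g _ _).trans ((congrArg₂ (· + ·) h1 h2).trans (f.map_add ⟨x, hx⟩ ⟨y, hy⟩).symm)
  | smul a x hx h1 =>
    exact (g.map_smul (C φ a) x).trans ((congrArg (C φ a • ·) h1).trans (f.map_smul a ⟨x, hx⟩).symm)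

end FinitePresentation

end TwistedPolynomial

/-! ### The resolution of length one by induced modules -/

namespace TwistedPolynomial

attribute [local instance] rightModule smulCommClass_right

open scoped TensorProduct

section Sequence

variable {A : Type u} [CommRing A] {φ : A →+* A}
  {M : Type u} [AddCommGroup M] [Module (TwistedPolynomial φ) M]

/-- The sequence `A[X]_φ ⊗_A N → A[X]_φ ⊗_A M₀ → M`, for the submodule `N = relations M₀`. -/
noncomputable def relationsComplex
    (M₀ : Submodule A (Underlying φ M)) :
    ShortComplex (ModuleCat.{u} (TwistedPolynomial φ)) where
  X₁ := (induced φ).obj (ModuleCat.of A (relations M₀))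
  X₂ := (induced φ).obj (ModuleCat.of A M₀)
  X₃ := ModuleCat.of (TwistedPolynomial φ) M
  f := ModuleCat.ofHom (relationsLift M₀)
  g := ModuleCat.ofHom (actionMap M₀)
  zero := ModuleCat.hom_ext (actionMap_comp_relationsLift M₀)

/-- A finitely presented module is the cokernel of an injective map between induced modules, whose
target comes from a finitely generated `A`-submodule. -/
theorem exists_fg_shortExact_relationsComplex (h : Module.Flat A (FrobTwist φ))
    (hM : Module.FinitePresentation (TwistedPolynomial φ) M) :
    ∃ M₀ : Submodule A (Underlying φ M),
      M₀.FG ∧ (relationsComplex M₀).ShortExact := by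
  obtain ⟨M₀, hfg, hspan, hext⟩ := exists_fg_presenting hM
  refine ⟨M₀, hfg, ShortComplex.ShortExact.mk' ?_ ?_ ?_⟩
  · rw [ShortComplex.moduleCat_exact_iff_ker_sub_range]
    let I := LinearMap.range (relationsLift M₀)
    change LinearMap.ker (actionMap M₀) ≤ I
    let f : M₀ →ₗ[A] (restrict φ).obj
        (ModuleCat.of (TwistedPolynomial φ) ((TwistedPolynomial φ ⊗[A] M₀) ⧸ I)) :=
      ((restrict φ).map (ModuleCat.ofHom I.mkQ)).hom ∘ₗ inducedUnit φ M₀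
    obtain ⟨g, hg⟩ := hext _ f fun m m' hm => by
      refine (Submodule.Quotient.eq I).2 ?_
      have hX := neg_mem (X_tmul_sub_mem_range M₀ m m' hm)
      rw [neg_sub] at hX
      have : X φ • ((1 : TwistedPolynomial φ) ⊗ₜ[A] m) = X φ ⊗ₜ[A] m := by
        rw [TensorProduct.smul_tmul', smul_eq_mul, mul_one]
      change 1 ⊗ₜ[A] m' - X φ • ((1 : TwistedPolynomial φ) ⊗ₜ[A] m) ∈ I
      rw [this]
      exact hX
    have hcomp : g ∘ₗ actionMap M₀ = I.mkQ := induced_hom_ext fun m => by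
      change g (actionMap M₀ (1 ⊗ₜ m)) = _
      rw [actionMap_tmul, one_smul, hg]
      rfl
    intro z hz
    rw [← Submodule.ker_mkQ I, ← hcomp]
    change g (actionMap M₀ z) = 0
    rw [LinearMap.mem_ker.1 hz, map_zero]
  · rw [ModuleCat.mono_iff_injective]
    exact mulMap_sub_inducedMap_injective h inf_le_left (relationsMap M₀)
  · rw [ModuleCat.epi_iff_surjective]
    change Function.Surjective (actionMap M₀)
    rw [← LinearMap.range_eq_top, eq_top_iff, ← hspan, Submodule.span_le]
    intro m hm
    exact ⟨1 ⊗ₜ ⟨m, hm⟩, one_smul _ _⟩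

variable (φ) in
/-- The component of degree one of `A[X]_φ ⊗_A N` is generated by the `X ⊗ m`.  If `b` kills `m`,
then `φ(b)` kills `X ⊗ m`. -/
theorem exists_fg_degreeOne_le {N : Type u} [AddCommGroup N] [Module A N]
    [Module.Finite A N] (I : Ideal A) (hI : (I • ⊤ : Submodule A N) = ⊥) :
    ∃ D : Submodule A (inducedRestrict φ N), D.FG ∧ degreeOne φ N ≤ D ∧ I.map φ • D = ⊥ := by
  obtain ⟨t, ht⟩ := (Module.Finite.fg_top (R := A) (M := N))
  let v : N → inducedRestrict φ N := fun m => X φ ⊗ₜ[A] m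
  have hv (a : A) (m : N) : v (a • m) = φ a • v m := by
    change X φ ⊗ₜ[A] (a • m) = C φ (φ a) • (X φ ⊗ₜ[A] m)
    rw [← TensorProduct.smul_tmul, TensorProduct.smul_tmul', right_smul_def, smul_eq_mul, X_mul_C]
  have hadd (m m' : N) : v (m + m') = v m + v m' := TensorProduct.tmul_add _ _ _
  have hzero : v 0 = 0 := TensorProduct.tmul_zero _ _
  let D := Submodule.span A (v '' t)
  refine ⟨D, Submodule.fg_span (t.finite_toSet.image v), fun z hz => ?_, ?_⟩
  · have hD (m : N) : v m ∈ D := by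
      have hm : m ∈ Submodule.span A (t : Set N) := ht ▸ Submodule.mem_top
      induction hm using Submodule.span_induction with
      | mem x hx => exact Submodule.subset_span ⟨x, hx, rfl⟩
      | zero => rw [hzero]; exact zero_mem D
      | add x y _ _ hx hy => rw [hadd]; exact add_mem hx hy
      | smul a x _ hx => rw [hv]; exact D.smul_mem _ hx
    let f : TwistedPolynomial φ ⊗[A] N →+ inducedRestrict φ N ⧸ D :=
      AddMonoidHom.comp (D.mkQ.toAddMonoidHom : inducedRestrict φ N →+ inducedRestrict φ N ⧸ D)
        (gradedProj φ N 1)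
    have hf : f = 0 := induced_addHom_ext fun n a m => by
      refine (Submodule.Quotient.mk_eq_zero D).2 ?_
      have hp := gradedProj_monomial_tmul φ 1 n a m
      refine (congrArg (fun w : inducedRestrict φ N => w ∈ D) hp).mpr ?_
      split_ifs with hn
      · subst hn
        rw [monomial_eq, pow_one, ← smul_eq_mul, ← TensorProduct.smul_tmul']
        exact D.smul_mem a (hD m)
      · exact zero_mem D
    have h0 : gradedProj φ N 1 z ∈ D :=
      (Submodule.Quotient.mk_eq_zero D).1 (DFunLike.congr_fun hf z)
    rw [mem_degreeOne] at hz
    rw [hz] at h0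
    exact h0
  · have hann : I.map φ ≤ D.annihilator := by
      rw [Ideal.map_le_iff_le_comap]
      intro b hb
      rw [Ideal.mem_comap, Submodule.mem_annihilator_span]
      rintro ⟨_, m, -, rfl⟩
      change φ b • v m = 0
      have : b • m = 0 := by
        rw [← Submodule.mem_bot A, ← hI]
        exact Submodule.smul_mem_smul hb Submodule.mem_top
      rw [← hv, this, hzero]
    rw [Submodule.eq_bot_iff]
    intro x hx
    induction hx using Submodule.smul_induction_on' with
    | smul a ha y hy => exact Submodule.mem_annihilator.1 (hann ha) y hy
    | add x _ y _ hx hy => rw [hx, hy, add_zero]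

end Sequence

section Finiteness

open IsLocalRing

variable {k : Type u} [Field k] {A : Type u} [CommRing A] [Algebra k A]

theorem finite_restrictScalars_of_le {N : Type u} [AddCommGroup N] [Module A N]
    {E D : Submodule A N} (h : E ≤ D) (hD : Module.Finite k
      ((ModuleCat.restrictScalars.{u} (algebraMap k A)).obj (ModuleCat.of A D))) :
    Module.Finite k ((ModuleCat.restrictScalars.{u} (algebraMap k A)).obj (ModuleCat.of A E)) :=
  Module.Finite.of_injective ((ModuleCat.restrictScalars.{u} (algebraMap k A)).map
    (ModuleCat.ofHom (Submodule.inclusion h))).hom (Submodule.inclusion_injective h)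

variable [IsLocalRing A]

theorem finite_restrictScalars_of_maximalIdeal_pow_smul_eq_bot (hm : (maximalIdeal A).FG)
    (hk : ∀ a : A, ∃ c : k, a - algebraMap k A c ∈ maximalIdeal A) {n : ℕ} (N : Type u)
    [AddCommGroup N] [Module A N] [Module.Finite A N]
    (hN : (maximalIdeal A ^ n • ⊤ : Submodule A N) = ⊥) :
    Module.Finite k ((ModuleCat.restrictScalars.{u} (algebraMap k A)).obj (ModuleCat.of A N)) := by
  let _ : Module k N := Module.compHom N (algebraMap k A)
  have : IsScalarTower k A N :=
    ⟨fun a b x => by rw [Algebra.smul_def, mul_smul]; rfl⟩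
  exact finite_of_maximalIdeal_pow_smul_eq_bot hm hk N hN

end Finiteness

end TwistedPolynomial

/-! ### Vanishing of the Euler-Poincaré characteristic -/

namespace TwistedPolynomial

variable {k : Type u} [Field k] {A : Type u} [CommRing A] [Algebra k A]

theorem C_algebraMap_commute (φ : A →ₐ[k] A) (c : k)
    (r : TwistedPolynomial (φ : A →+* A)) :
    C (φ : A →+* A) (algebraMap k A c) * r = r * C (φ : A →+* A) (algebraMap k A c) := by
  have hpow (n : ℕ) : ((φ : A →+* A) ^ n) (algebraMap k A c) = algebraMap k A c := by
    induction n with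
    | zero => rfl
    | succ n ih =>
      rw [pow_succ, RingHom.mul_def, RingHom.comp_apply]
      exact (congrArg _ (φ.commutes c)).trans ih
  have : AddMonoidHom.mulLeft (C (φ : A →+* A) (algebraMap k A c)) =
      AddMonoidHom.mulRight (C (φ : A →+* A) (algebraMap k A c)) := addHom_ext fun n a => by
    change C _ _ * monomial _ n a = monomial _ n a * C _ _
    rw [C_mul_monomial, monomial_mul_C, hpow, mul_comm]
  exact DFunLike.congr_fun this r

/-- If `φ` is `k`-linear, then `A[X]_φ` is a `k`-algebra. -/
@[reducible]
noncomputable def algebra (φ : A →ₐ[k] A) : Algebra k (TwistedPolynomial (φ : A →+* A)) :=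
  ((C (φ : A →+* A)).comp (algebraMap k A)).toAlgebra' (C_algebraMap_commute φ)

end TwistedPolynomial

section EulerPoincare

open TwistedPolynomial IsLocalRing

variable {k : Type u} [Field k] {A : Type u} [CommRing A] [IsLocalRing A] [Algebra k A]

/-- The rank over a domain may be computed after extending the scalars to the fraction field. -/
theorem torRank_eq_finrank {φ : A →+* A} (hφ : ∀ a, residue A (φ a) = residue A a) (i : ℕ)
    (M : ModuleCat.{u} (TwistedPolynomial φ)) :
    torRank k hφ i M = Module.finrank (Polynomial k) (torModule k hφ i M) :=
  (IsLocalization.finrank_eq (RatFunc k) (nonZeroDivisors (Polynomial k)) le_rfl).trans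
    (IsLocalizedModule.finrank_eq (nonZeroDivisors (Polynomial k))
      (TensorProduct.mk (Polynomial k) (RatFunc k) (torModule k hφ i M) 1) le_rfl)

/-- A smooth finitely presented module has a resolution of length one by modules `A[X]_φ ⊗_A N` with
`N` finite dimensional over `k`. -/
theorem exists_shortExact_induced {d : ℕ} (e : A ≃ₐ[k] MvPowerSeries (Fin d) k) {q : ℕ}
    (hq : 0 < q) (φ : A →ₐ[k] A)
    (hφ : ∀ j : Fin d, φ (e.symm (MvPowerSeries.X j)) = e.symm (MvPowerSeries.X j) ^ q)
    (M : Type u) [AddCommGroup M] [Module (TwistedPolynomial (φ : A →+* A)) M]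
    (hfp : Module.FinitePresentation (TwistedPolynomial (φ : A →+* A)) M)
    (hsm : TwistedPolynomial.IsSmooth (φ : A →+* A) M) :
    ∃ N₁ N₂ : ModuleCat.{u} A,
      Module.Finite k ((ModuleCat.restrictScalars (algebraMap k A)).obj N₁) ∧
      Module.Finite k ((ModuleCat.restrictScalars (algebraMap k A)).obj N₂) ∧
      ∃ S : ShortComplex (ModuleCat.{u} (TwistedPolynomial (φ : A →+* A))), S.ShortExact ∧
        S.X₁ = (induced (φ : A →+* A)).obj N₁ ∧ S.X₂ = (induced (φ : A →+* A)).obj N₂ ∧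
        S.X₃ = ModuleCat.of _ M := by
  obtain ⟨M₀, hfg, hS⟩ := exists_fg_shortExact_relationsComplex (flat_frobTwist e hq hφ) hfp
  have : IsArtinian A M₀ := hsm M₀ hfg
  have : Module.Finite A M₀ := Module.Finite.iff_fg.2 hfg
  have hm := maximalIdeal_fg e
  obtain ⟨n, hn⟩ := exists_maximalIdeal_pow_smul_eq_bot hm M₀
  obtain ⟨D, hD, hle, hbot⟩ := exists_fg_degreeOne_le (φ : A →+* A) _ hn
  obtain ⟨l, hl⟩ := exists_maximalIdeal_pow_le_map e hφ n
  have : Module.Finite A D := Module.Finite.iff_fg.2 hD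
  have hbot' : (maximalIdeal A ^ l • ⊤ : Submodule A D) = ⊥ := by
    refine Submodule.map_injective_of_injective D.subtype_injective ?_
    rw [Submodule.map_smul'', Submodule.map_top, Submodule.range_subtype, Submodule.map_bot,
      eq_bot_iff, ← hbot]
    exact Submodule.smul_mono_left hl
  exact ⟨ModuleCat.of A (relations M₀), ModuleCat.of A M₀,
    finite_restrictScalars_of_le (inf_le_left.trans hle)
      (finite_restrictScalars_of_maximalIdeal_pow_smul_eq_bot hm (exists_sub_algebraMap_mem e) D
        hbot'),
    finite_restrictScalars_of_maximalIdeal_pow_smul_eq_bot hm (exists_sub_algebraMap_mem e) M₀ hn,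
    relationsComplex M₀, hS, rfl, rfl, rfl⟩

end EulerPoincare

theorem mainTheorem2 (p : ℕ) [Fact p.Prime] (k : Type u) [Field k] [CharP k p]
    (d : ℕ) (hd : 1 ≤ d) (A : Type u) [CommRing A] [IsLocalRing A] [Algebra k A]
    (e : A ≃ₐ[k] MvPowerSeries (Fin d) k) (q : ℕ) (hq : ∃ r : ℕ, q = p ^ r) (φ : A →ₐ[k] A)
    (hφ : ∀ j : Fin d,
      φ (e.symm (MvPowerSeries.X j)) = e.symm (MvPowerSeries.X j) ^ q)
    (M : Type u) [AddCommGroup M] [Module (TwistedPolynomial (φ : A →+* A)) M]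
    (hfp : Module.FinitePresentation (TwistedPolynomial (φ : A →+* A)) M)
    (hsm : TwistedPolynomial.IsSmooth (φ : A →+* A) M) :
    (∀ i : ℕ, Module.Finite (Polynomial k)
      (torModule k (residue_algHom_apply e φ) i (ModuleCat.of _ M))) ∧
    (∀ i : ℕ, d < i →
      Subsingleton (torModule k (residue_algHom_apply e φ) i (ModuleCat.of _ M))) ∧
    eulerPoincare k (residue_algHom_apply e φ) (ModuleCat.of _ M) = 0 := by
  have hq0 : 0 < q := by
    obtain ⟨r, rfl⟩ := hq
    exact pow_pos (Fact.out : p.Prime).pos r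
  have hres := residue_algHom_apply e φ
  have hflat := flat_frobTwist e hq0 hφ
  let _ := TwistedPolynomial.algebra φ
  obtain ⟨N₁, N₂, h₁, h₂, S, hS, e₁, e₂, e₃⟩ := exists_shortExact_induced e hq0 φ hφ M hfp hsm
  obtain ⟨T, hT, i₁, i₂, i₃⟩ := exists_shortExact_leftDerived k hS (fiberPoly k hres)
  rw [e₁] at i₁
  rw [e₂] at i₂
  rw [e₃] at i₃
  have f₁ (i) := ModuleCat.finite_of_iso (i₁ i).some.symm
    (finite_leftDerived_fiberPoly_induced e hflat hres N₁ h₁ i)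
  have f₂ (i) := ModuleCat.finite_of_iso (i₂ i).some.symm
    (finite_leftDerived_fiberPoly_induced e hflat hres N₂ h₂ i)
  -- the `k[X]`-module `Tor_i` is the homology of the third complex
  have E (i : ℕ) : Nonempty (torModule k hres i (ModuleCat.of _ M) ≃ₗ[Polynomial k]
      T.X₃.homology i) :=
    ⟨(nonempty_torModule_equiv k hres i _).some.trans (i₃ i).some.symm.toLinearEquiv⟩
  have hsub (i : ℕ) (hi : d < i) : Subsingleton (torModule k hres i (ModuleCat.of _ M)) :=
    subsingleton_torModule k e hres hi _
  refine ⟨fun i => ?_, hsub, ?_⟩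
  · have := ShortComplex.ShortExact.finite_homology hT f₁ f₂ i
    exact Module.Finite.equiv (E i).some.symm
  · have hz : Limits.IsZero (T.X₃.homology (d + 1)) :=
      have := hsub (d + 1) d.lt_succ_self
      have := (E (d + 1)).some.symm.injective.subsingleton
      ModuleCat.isZero_of_subsingleton _
    have key := ShortComplex.ShortExact.altRank_homology hT f₁ f₂ hz
    rw [altRank_congr (fun i => (i₁ i).some.toLinearEquiv.finrank_eq),
      altRank_congr (fun i => (i₂ i).some.toLinearEquiv.finrank_eq),
      altRank_leftDerived_fiberPoly_induced e hd hflat hres N₁ h₁ d.lt_succ_self,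
      altRank_leftDerived_fiberPoly_induced e hd hflat hres N₂ h₂ d.lt_succ_self, zero_add] at key
    -- the terms of degree `> d` vanish
    rw [eulerPoincare, finsum_eq_sum_of_support_subset (s := Finset.range (d + 1))]
    · refine Eq.trans (Finset.sum_congr rfl fun i _ => ?_) key.symm
      rw [torRank_eq_finrank, (E i).some.finrank_eq]
    · intro i hi
      rw [Finset.coe_range, Set.mem_Iio, Nat.lt_succ_iff]
      by_contra! h
      have := hsub i h
      refine hi ?_
      change (-1) ^ i * (torRank k hres i (ModuleCat.of _ M) : ℤ) = 0
      rw [torRank_eq_finrank, Module.finrank_zero_of_subsingleton, Nat.cast_zero, mul_zero]
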